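/- **Games.** A move is a finite string over the keyboard alphabet; a labmove is a move labeled by a player, $\top$ (machine) or $\bot$ (environment); a run is a finite or infinite sequence of labmoves, a position is a finite run. A constant game is a set of legal runs (a run is legal iff all its finite initial segments are; the empty run is legal) together with a function telling the winner of each run, where a player making the first illegal move loses. A game is a function $A$ from valuations $e$ (assignments of natural numbers to the variables $v_0,v_1,\ldots$) to constant games $e[A]$. A constant game is static iff, for either player $\wp$, postponing $\wp$'s moves relative to those of the adversary (keeping each player's own order of moves) never makes a run $\wp$-illegal that was not so and never turns a run won by $\wp$ into a lost one. $\neg A$ switches the roles of the players. In $A_0\wedge A_1$ and $A_0\vee A_1$ all moves have the form $i.\beta$ with $i\in\{0,1\}$, the moves $i.\beta$ form a run of $A_i$, and $\top$ has to win both, resp. at least one, of the two. In the branching recurrence $\circ A$ and corecurrence $\bar\circ A$ all moves have the form $u.\beta$ with $u$ a finite bitstring; for every infinite bitstring $y$ the moves $u.\beta$ with $u$ a prefix of $y$ form a run of $A$; and $\top$ has to win for all, resp. for some, $y$. All component runs of a legal run must be legal. **Formulas.** Formulas are built from atoms $P$ and negated atoms $\neg P$ by $\wedge,\vee,\circ,\bar\circ$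 (negation of other formulas is an abbreviation by duality). An interpretation ${}^*$ sends each atom to a game all of whose instances are static, and extends to formulas $F\mapsto F^*$. It is constant if every $e[P^*]$ is independent of $e$. It is an enumeration interpretation if, in every $e[P^*]$, exactly the natural numbers (in decimal) are legal moves, for either player at any time, and the winner of a legal run depends only on the two sets of numbers that the players have made as moves. It is unary, in the variable $x$, if every $e[P^*]$ depends only on $e(x)$. **Machines.** An HPM is a deterministic Turing machine with a work tape, a read-only tape spelling a valuation $e$ and a read-only tape spelling the current position; on entering a designated move state it makes (as $\top$) the move written at the beginning of its work tape, and in each step the environment may make any finite sequence of moves. It wins $A$ iff for every $e$ every run so generated on $e$ is a run of $e[A]$ won by $\top$. $F$ is multiformly valid iff for every interpretation ${}^*$ some HPM wins $F^*$. **CL15.** A cirquent consists of nonempty finite sequences of oformulas (occurrences of formulas), undergroups and overgroups, the groups being nonempty sets of oformulas and every oformula being in at least one undergroup and one overgroup. Axioms: oformulas $\neg F_1,F_1,\ldots,\neg F_n,F_n$ ($n\ge1$), undergroups and overgroups both $\{\neg F_1,F_1\},\ldots,\{\neg F_n,F_n\}$. Rules (from premise to conclusion): Exchange (swap adjacent oformulas,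 undergroups or overgroups); Duplication (double an undergroup or overgroup); Merging (replace two adjacent overgroups by their union). Rules read from conclusion to premise: Weakening (remove an oformula from an undergroup with at least two members; if it is then in no undergroup, delete it, and delete the overgroups that become empty); Contraction (replace $\bar\circ E$ by two adjacent copies in the same groups); $\vee$-Introduction (replace $E\vee G$ by adjacent $E,G$ in the same groups); $\wedge$-Introduction (the same for $E\wedge G$, except that each undergroup containing it is split in two, one with $E$ and one with $G$ in its place); $\circ$-Introduction (replace $\circ E$ by $E$ and insert a new overgroup $\{E\}$); $\bar\circ$-Introduction (replace $\bar\circ E$ by $E$ and include $E$ in any number of further existing overgroups). $\mathrm{CL15}\vdash F$ iff the cirquent with the single oformula $F$, undergroup $\{F\}$ and overgroup $\{F\}$ is derivable from an axiom. **The counterstrategy $\mathcal E$ for $F_0$.** The address of an occurrence of a literal in $F_0$, relative to a choice of finite bitstrings for the occurrences of $\circ,\bar\circ$ above it, is the string of segments $0.$ or $1.$ (for $\wedge,\vee$) and $u.$ (for $\circ,\bar\circ$, $u$ the chosen bitstring) leading from $F_0$ to it. As the environment, $\mathcal E$ repeats forever: in the current position let $h$ be the smallest number exceeding the lengths of all bitstrings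 $u$ that have been used at occurrences of $\circ,\bar\circ$ in the moves made so far (with $h\geq 1$ if the position is nonempty); consecutively, in lexicographic order, for each literal address $\alpha$ all of whose bitstrings have length $h$, make the move $\alpha a$, where $a$ is the smallest number such that no $\alpha' a$ with $\alpha'$ a literal address has been made by either player so far; then let the opponent make one step. **Theorem.** Let $F_0$ be a formula with $\mathrm{CL15}\not\vdash F_0$ and let $x$ be a variable. The set of HPMs is countable; let $\mathcal H_0,\mathcal H_1,\ldots$ be any list of all HPMs, and let $e_n$ be the valuation assigning $n$ to $x$ and $0$ to all other variables. Then there are constant enumeration interpretations ${}^{*_n}$ ($n\ge 0$) such that, for every $n$, $\mathcal H_n$ loses $F_0^{*_n}$ when it plays against $\mathcal E$ on the valuation $e_n$; and there is an enumeration interpretation ${}^\dagger$, unary in $x$, with $e[P^\dagger]=P^{*_n}$ for every atom $P$ and every valuation $e$, where $n=e(x)$, such that no HPM wins $F_0^\dagger$. In particular, $F_0$ is not multiformly valid. -/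

import Mathlib

namespace CoL

/-! ## Players, moves, runs -/

/-- The two players: `top` is the machine, `bot` is its environment. -/
inductive Player
  | top
  | bot
  deriving DecidableEq

/-- The adversary of a player. -/
def Player.neg : Player → Player
  | .top => .bot
  | .bot => .top

/-- The (finite) keyboard alphabet: the ten digits, the period, and the remaining printable
characters. The bits are the digits `0` and `1`. -/
inductive Key
  | digit (d : Fin 10)
  | period
  | other (k : Fin 84)
  deriving DecidableEq

/-- A move is a finite string over the keyboard alphabet. -/
abbrev Move := List Key

/-- A labmove is a move labeled by the player who makes it. -/
abbrev LabMove := Player × Move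

/-- A position is a finite run. -/
abbrev Position := List LabMove

/-- A run is a finite or infinite sequence of labmoves. -/
abbrev Run := Stream'.Seq LabMove

/-- The key of a bit. -/
def bitKey : Bool → Key
  | false => .digit 0
  | true => .digit 1

/-- The decimal representation of a natural number (most significant digit first, no leading
zeros, `0` being represented by the one-digit string `0`). -/
def numeral (a : ℕ) : Move :=
  if a = 0 then [.digit 0] else ((Nat.digits 10 a).map fun d => Key.digit (Fin.ofNat 10 d)).reverse

/-- The address segment `u.` of a finite bitstring `u`. -/
def addrSegment (u : List Bool) : Move := u.map bitKey ++ [.period]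

/-- If `m` has the form `u.β` with `u` a (necessarily unique) finite bitstring, then
`readBits m = some (u, β)`; otherwise `readBits m = none`. -/
def readBits : Move → Option (List Bool × Move)
  | [] => none
  | .period :: m => some ([], m)
  | .other _ :: _ => none
  | .digit d :: m =>
      if d = 0 then (readBits m).map fun r => (false :: r.1, r.2)
      else if d = 1 then (readBits m).map fun r => (true :: r.1, r.2)
      else none

/-- If `m` is `i.β` for the bit `i`, then `some β`; otherwise `none`. -/
def component (i : Bool) (m : Move) : Option Move :=
  if addrSegment [i] <+: m then some (m.drop (addrSegment [i]).length) else none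

/-- If `m` is `u.β` for some finite initial segment `u` of the infinite bitstring `x`, then
`some β`; otherwise `none`. -/
def strand (x : ℕ → Bool) (m : Move) : Option Move :=
  match readBits m with
  | some (u, β) => if u = (List.range u.length).map x then some β else none
  | none => none

/-- Apply a partial transformation of moves to a labmove, keeping the label. -/
def onMove (f : Move → Option Move) (l : LabMove) : Option LabMove :=
  (f l.2).map fun β => (l.1, β)

/-- Reverse the label of a labmove. -/
def LabMove.neg (l : LabMove) : LabMove := (l.1.neg, l.2)

open Classical in
/-- The limit of a chain of positions each of which is an initial segment of the next one. -/
noncomputable def Run.limit (L : ℕ → Position) : Run :=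
  ⟨fun n => if h : ∃ k, n < (L k).length then (L h.choose)[n]? else none, by
    intro n hn
    have hno : ¬ ∃ k, n < (L k).length := by
      intro h
      simp only [dif_pos h] at hn
      exact absurd h.choose_spec (not_lt.2 (List.getElem?_eq_none_iff.1 hn))
    have hno' : ¬ ∃ k, n + 1 < (L k).length :=
      fun ⟨k, hk⟩ => hno ⟨k, (Nat.lt_succ_self n).trans hk⟩
    exact dif_neg hno'⟩

/-- Delete from `Γ` all labmoves on which `f` is undefined, and replace every other one by its
value under `f`. -/
noncomputable def Run.filterMap (f : LabMove → Option LabMove) (Γ : Run) : Run :=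
  Run.limit fun k => (Γ.take k).filterMap f

/-- `Γ` with all labels reversed. -/
def Run.neg (Γ : Run) : Run := Γ.map LabMove.neg

/-- The result `Γ^{i.}` of deleting from `Γ` all labmoves except those of the form `℘i.β`, and
changing each of those to `℘β`. -/
noncomputable def Run.component (i : Bool) (Γ : Run) : Run := Γ.filterMap (onMove (CoL.component i))

/-- The result `Γ^{≼x}` of deleting from `Γ` all labmoves except those of the form `℘u.β` with `u`
a finite initial segment of `x`, and changing each of those to `℘β`. -/
noncomputable def Run.strand (x : ℕ → Bool) (Γ : Run) : Run := Γ.filterMap (onMove (CoL.strand x))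

/-- `Γ` contains the labmove `l`. -/
def Run.Contains (Γ : Run) (l : LabMove) : Prop := ∃ i, Γ.get? i = some l

/-! ## Games -/

/-- Given the set of legal positions, a run is `p`-illegal when the last move of its shortest
illegal initial segment is made by `p`. -/
def IllegalBy (Legal : Position → Prop) (p : Player) (Γ : Run) : Prop :=
  ∃ k m, Legal (Γ.take k) ∧ ¬ Legal (Γ.take (k + 1)) ∧ Γ.get? k = some (p, m)

/-- A constant game. Since a run is legal iff all its finite initial segments are, the set of legal
runs is given by the legal positions, a prefix-closed set containing the empty position. `Wn` tells
who wins a given run; a player who makes the first illegal move loses. -/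
@[ext]
structure ConstGame where
  Legal : Position → Prop
  Wn : Run → Player
  legal_nil : Legal []
  legal_of_append : ∀ Φ l, Legal (Φ ++ [l]) → Legal Φ
  wn_illegal : ∀ p Γ, IllegalBy Legal p Γ → Wn Γ = p.neg

/-- The legal runs of a constant game. -/
def ConstGame.LegalRun (A : ConstGame) (Γ : Run) : Prop := ∀ k, A.Legal (Γ.take k)

theorem legal_take_of_le {Legal : Position → Prop}
    (hp : ∀ Φ l, Legal (Φ ++ [l]) → Legal Φ) (Γ : Run) {j k : ℕ} (hjk : j ≤ k)
    (hk : Legal (Γ.take k)) : Legal (Γ.take j) := by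
  have key : ∀ Φ Ψ : Position, Legal (Φ ++ Ψ) → Legal Φ := by
    intro Φ Ψ
    induction Ψ using List.reverseRecOn with
    | nil => intro h; simpa using h
    | append_singleton Ψ l ih =>
      intro h
      rw [← List.append_assoc] at h
      exact ih (hp _ _ h)
  have hpre : Γ.take j = (Γ.take k).take j := by
    apply List.ext_getElem?
    intro i
    rw [List.getElem?_take]
    split_ifs with hi
    · rw [Stream'.Seq.getElem?_take, Stream'.Seq.getElem?_take, if_pos hi,
        if_pos (hi.trans_le hjk)]
    · rw [Stream'.Seq.getElem?_take, if_neg hi]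
  rw [hpre]
  apply key _ ((Γ.take k).drop j)
  rwa [List.take_append_drop]

theorem not_illegalBy_both {Legal : Position → Prop}
    (hp : ∀ Φ l, Legal (Φ ++ [l]) → Legal Φ) (Γ : Run)
    (h1 : IllegalBy Legal .top Γ) (h2 : IllegalBy Legal .bot Γ) : False := by
  obtain ⟨k, m, hk, hk', hm⟩ := h1
  obtain ⟨j, m', hj, hj', hm'⟩ := h2
  rcases lt_trichotomy k j with h | h | h
  · exact hk' (legal_take_of_le hp Γ h hj)
  · subst h
    rw [hm] at hm'
    simp at hm'
  · exact hj' (legal_take_of_le hp Γ h hk)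

open Classical in
/-- The constant game with the given legal positions whose legal runs are won by `top` exactly when
they satisfy `W`; the winner of an illegal run is the adversary of the first offender. -/
noncomputable def ConstGame.ofLegal (Legal : Position → Prop) (h0 : Legal [])
    (hp : ∀ Φ l, Legal (Φ ++ [l]) → Legal Φ) (W : Run → Prop) : ConstGame where
  Legal := Legal
  Wn Γ := if IllegalBy Legal .top Γ then .bot
    else if IllegalBy Legal .bot Γ then .top
    else if W Γ then .top else .bot
  legal_nil := h0
  legal_of_append := hp
  wn_illegal := by
    intro p Γ h
    cases p with
    | top => simp [h, Player.neg]
    | bot =>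
      have : ¬ IllegalBy Legal .top Γ := fun h' => not_illegalBy_both hp Γ h' h
      simp [h, this, Player.neg]

/-- Negation `¬A`. -/
noncomputable def ConstGame.neg (A : ConstGame) : ConstGame :=
  .ofLegal (fun Φ => A.Legal (Φ.map LabMove.neg)) (by simpa using A.legal_nil)
    (fun Φ l h => by
      simp only [List.map_append, List.map_cons, List.map_nil] at h
      exact A.legal_of_append _ _ h)
    (fun Γ => A.Wn Γ.neg = .bot)

/-- Legal positions of the parallel combinations of `A` and `B`: every move has the form `0.β` or
`1.β`, and the two projections are legal positions of `A` and `B`. -/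
def parLegal (A B : ConstGame) (Φ : Position) : Prop :=
  (∀ l ∈ Φ, (component false l.2).isSome ∨ (component true l.2).isSome) ∧
    A.Legal (Φ.filterMap (onMove (component false))) ∧
    B.Legal (Φ.filterMap (onMove (component true)))

theorem legal_filterMap_of_append (A : ConstGame) (f : LabMove → Option LabMove) (Φ : Position)
    (l : LabMove) (h : A.Legal ((Φ ++ [l]).filterMap f)) : A.Legal (Φ.filterMap f) := by
  rw [List.filterMap_append] at h
  cases hl : f l with
  | none => simpa [hl] using h
  | some b =>
    simp only [List.filterMap_cons, hl, List.filterMap_nil] at h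
    exact A.legal_of_append _ _ h

theorem parLegal_of_append (A B : ConstGame) (Φ : Position) (l : LabMove)
    (h : parLegal A B (Φ ++ [l])) : parLegal A B Φ :=
  ⟨fun l' hl' => h.1 l' (List.mem_append_left _ hl'), legal_filterMap_of_append A _ Φ l h.2.1,
    legal_filterMap_of_append B _ Φ l h.2.2⟩

/-- Parallel conjunction `A ∧ B`. -/
noncomputable def ConstGame.and (A B : ConstGame) : ConstGame :=
  .ofLegal (parLegal A B) ⟨by simp, A.legal_nil, B.legal_nil⟩ (parLegal_of_append A B)
    (fun Γ => A.Wn (Γ.component false) = .top ∧ B.Wn (Γ.component true) = .top)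

/-- Parallel disjunction `A ∨ B`. -/
noncomputable def ConstGame.or (A B : ConstGame) : ConstGame :=
  .ofLegal (parLegal A B) ⟨by simp, A.legal_nil, B.legal_nil⟩ (parLegal_of_append A B)
    (fun Γ => A.Wn (Γ.component false) = .top ∨ B.Wn (Γ.component true) = .top)

/-- Legal positions of the branching (co)recurrence of `A`: every move has the form `u.β` with `u` a
finite bitstring, and the projection along every infinite bitstring is a legal position of `A`. -/
def recLegal (A : ConstGame) (Φ : Position) : Prop :=
  (∀ l ∈ Φ, (readBits l.2).isSome) ∧
    ∀ x : ℕ → Bool, A.Legal (Φ.filterMap (onMove (strand x)))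

theorem recLegal_of_append (A : ConstGame) (Φ : Position) (l : LabMove)
    (h : recLegal A (Φ ++ [l])) : recLegal A Φ :=
  ⟨fun l' hl' => h.1 l' (List.mem_append_left _ hl'),
    fun x => legal_filterMap_of_append A _ Φ l (h.2 x)⟩

/-- Branching recurrence of `A`. -/
noncomputable def ConstGame.st (A : ConstGame) : ConstGame :=
  .ofLegal (recLegal A) ⟨by simp, fun _ => A.legal_nil⟩ (recLegal_of_append A)
    (fun Γ => ∀ x : ℕ → Bool, A.Wn (Γ.strand x) = .top)

/-- Branching corecurrence of `A`. -/
noncomputable def ConstGame.cost (A : ConstGame) : ConstGame :=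
  .ofLegal (recLegal A) ⟨by simp, fun _ => A.legal_nil⟩ (recLegal_of_append A)
    (fun Γ => ∃ x : ℕ → Bool, A.Wn (Γ.strand x) = .top)

/-- The labmove at index `i` of `Γ` is the `n`-th (counting from `0`) move of `p` in `Γ`. -/
def IsNthMove (p : Player) (n : ℕ) (Γ : Run) (i : ℕ) : Prop :=
  (∃ m, Γ.get? i = some (p, m)) ∧ ((Γ.take i).filter fun l => l.1 = p).length = n

/-- `Δ` is a `p`-delay of `Γ`: each player makes the same moves in the same order in both runs, and
whenever the `n`-th move of `p` comes after the `k`-th move of its adversary in `Γ`, so it does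
in `Δ`. -/
def IsDelay (p : Player) (Γ Δ : Run) : Prop :=
  (∀ q : Player, Γ.filterMap (fun l => if l.1 = q then some l else none) =
      Δ.filterMap (fun l => if l.1 = q then some l else none)) ∧
    ∀ n k i j, IsNthMove p n Γ i → IsNthMove p.neg k Γ j → j < i →
      ∃ i' j', IsNthMove p n Δ i' ∧ IsNthMove p.neg k Δ j' ∧ j' < i'

/-- A constant game is static if delaying a player's own moves neither makes that player the first
offender nor turns a won run into a lost one. -/
def ConstGame.IsStatic (A : ConstGame) : Prop :=
  ∀ p Γ Δ, IsDelay p Γ Δ →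
    (¬ IllegalBy A.Legal p Γ → ¬ IllegalBy A.Legal p Δ) ∧ (A.Wn Γ = p → A.Wn Δ = p)

/-- A valuation assigns a constant (natural number) to each of the variables `v₀, v₁, …`. -/
abbrev Valuation := ℕ → ℕ

/-- A game is a function from valuations to constant games, its instances. -/
abbrev Game := Valuation → ConstGame

/-- Every instance of `A` is determined by the value that the valuation assigns to the variable
with index `x`. -/
def Game.DependsOnlyOn (A : Game) (x : ℕ) : Prop := ∀ e e' : Valuation, e x = e' x → A e = A e'

/-- `A` is constant: all its instances are the same. -/
def Game.IsConstant (A : Game) : Prop := ∀ e e' : Valuation, A e = A e'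

/-- Enumeration games: at any time exactly the natural numbers are legal moves of either player, and
the winner of a legal run depends only on the two sets of numbers made as moves. -/
def Game.IsEnumeration (A : Game) : Prop :=
  ∀ e : Valuation,
    (∀ Φ, (A e).Legal Φ ↔ ∀ l ∈ Φ, ∃ a, l.2 = numeral a) ∧
    ∀ Γ Δ, (A e).LegalRun Γ → (A e).LegalRun Δ →
      (∀ l, Γ.Contains l ↔ Δ.Contains l) → (A e).Wn Γ = (A e).Wn Δ

/-! ## Formulas and interpretations -/

/-- Formulas; negation is applied to atoms only. -/
inductive Formula
  | atom (P : ℕ)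
  | natom (P : ℕ)
  | and (E G : Formula)
  | or (E G : Formula)
  | st (E : Formula)
  | cost (E : Formula)

/-- The formula that `¬F` abbreviates. -/
def Formula.neg : Formula → Formula
  | .atom P => .natom P
  | .natom P => .atom P
  | .and E G => .or E.neg G.neg
  | .or E G => .and E.neg G.neg
  | .st E => .cost E.neg
  | .cost E => .st E.neg

/-- An interpretation sends every atom to a static game. -/
structure Interpretation where
  val : ℕ → Game
  isStatic : ∀ P e, (val P e).IsStatic

def Interpretation.IsConstant (I : Interpretation) : Prop := ∀ P, (I.val P).IsConstant

def Interpretation.IsEnumeration (I : Interpretation) : Prop := ∀ P, (I.val P).IsEnumeration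

/-- Every atom is sent to a game that depends on no variable other than `x`. -/
def Interpretation.IsUnaryIn (I : Interpretation) (x : ℕ) : Prop :=
  ∀ P, (I.val P).DependsOnlyOn x

/-- The game `F^*` into which an interpretation turns a formula. -/
noncomputable def Formula.game (I : Interpretation) : Formula → Game
  | .atom P => I.val P
  | .natom P => fun e => (I.val P e).neg
  | .and E G => fun e => (E.game I e).and (G.game I e)
  | .or E G => fun e => (E.game I e).or (G.game I e)
  | .st E => fun e => (E.game I e).st
  | .cost E => fun e => (E.game I e).cost

/-! ## Hard-play machines -/

/-- Possible actions of a scanning head. -/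
inductive Dir
  | left
  | stay
  | right

/-- The new location of a head on a tape with a leftmost cell. -/
def Dir.apply : Dir → ℕ → ℕ
  | .left, n => n - 1
  | .stay, n => n
  | .right, n => n + 1

/-- Contents of a cell of the valuation tape (`none` is the blank). -/
abbrev ValSym := Option Key

/-- Contents of a cell of the run tape (`none` is the blank). -/
abbrev RunSym := Option (Player ⊕ Key)

/-- Contents of a cell of the work tape (`none` is the blank), where `x` is the number of work symbols
beyond the keyboard alphabet. -/
abbrev WorkSym (x : ℕ) := Option (Key ⊕ Fin x)

/-- A hard-play machine: a deterministic Turing machine with a read-only valuation tape, a read-only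
run tape and a work tape, some of whose states are designated as move states. Depending on the
state and the three scanned symbols, it enters a state, writes a symbol on the work tape, and moves
the three heads (in the order: valuation, run, work). -/
structure HPM where
  numStates : ℕ
  numExtra : ℕ
  start : Fin numStates
  isMoveState : Fin numStates → Bool
  trans : Fin numStates → ValSym → RunSym → WorkSym numExtra →
    Fin numStates × WorkSym numExtra × Dir × Dir × Dir

/-- The initial part of the valuation tape spelling the values of the first `k` variables, each
followed by a blank. -/
def valPrefix (e : Valuation) (k : ℕ) : List ValSym :=
  (List.range k).flatMap fun i => (numeral (e i)).map some ++ [none]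

/-- The contents of cell `n` of the valuation tape. -/
def valCell (e : Valuation) (n : ℕ) : ValSym := (valPrefix e (n + 1)).getD n none

/-- The contents of cell `n` of the run tape spelling a position. -/
def runCell (Φ : Position) (n : ℕ) : RunSym :=
  (Φ.flatMap fun l => (Sum.inl l.1 : Player ⊕ Key) :: l.2.map Sum.inr)[n]?

/-- A configuration; `work` lists the contents of an initial part of the work tape, all further
cells being blank, and `run` is the position spelled on the run tape. -/
structure HPM.Config (M : HPM) where
  state : Fin M.numStates
  work : List (WorkSym M.numExtra)
  valHead : ℕ
  runHead : ℕ
  workHead : ℕ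
  run : Position

/-- Write `a` into cell `n` of a work tape. -/
def writeCell {x : ℕ} (w : List (WorkSym x)) (n : ℕ) (a : WorkSym x) : List (WorkSym x) :=
  (List.range (max w.length (n + 1))).map fun i => if i = n then a else w.getD i none

/-- The key in a work tape cell, if there is one. -/
def WorkSym.toKey {x : ℕ} : WorkSym x → Option Key
  | some (.inl κ) => some κ
  | _ => none

/-- The move constructed at the beginning of the work tape: the longest initial string of keys. -/
def workMove {x : ℕ} (w : List (WorkSym x)) : Move :=
  (w.takeWhile fun a => (WorkSym.toKey a).isSome).filterMap WorkSym.toKey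

/-- The initial configuration: start state, all heads at the leftmost cells, blank work tape and
empty run tape. -/
def HPM.init (M : HPM) : M.Config := ⟨M.start, [], 0, 0, 0, []⟩

/-- The successor configuration when the environment makes the moves `βs` during the clock cycle. On
entering a move state, the machine makes the move that stands at the beginning of its work tape. -/
def HPM.step (M : HPM) (e : Valuation) (C : M.Config) (βs : List Move) : M.Config :=
  let t := M.trans C.state (valCell e C.valHead) (runCell C.run C.runHead)
    (C.work.getD C.workHead none)
  let w := writeCell C.work C.workHead t.2.1
  { state := t.1
    work := w
    valHead := t.2.2.1.apply C.valHead
    runHead := t.2.2.2.1.apply C.runHead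
    workHead := t.2.2.2.2.apply C.workHead
    run := C.run ++ βs.map (fun β => (Player.bot, β)) ++
      (if M.isMoveState t.1 then [(Player.top, workMove w)] else []) }

/-- `B` is an `e`-computation branch of `M`: in each clock cycle the environment may make any finite
sequence of moves. -/
def HPM.IsBranch (M : HPM) (e : Valuation) (B : ℕ → M.Config) : Prop :=
  B 0 = M.init ∧ ∀ i, ∃ βs : List Move, B (i + 1) = M.step e (B i) βs

/-- The run spelled by a computation branch. -/
noncomputable def HPM.runOf (M : HPM) (B : ℕ → M.Config) : Run := Run.limit fun i => (B i).run

/-- `M` wins `A`: for every valuation `e`, every `e`-computation branch of `M` spells a run of `e[A]`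
won by `top`. -/
def HPM.Wins (M : HPM) (A : Game) : Prop :=
  ∀ e B, M.IsBranch e B → (A e).Wn (M.runOf B) = .top

/-- `F` is multiformly valid: for every interpretation some machine wins `F^*`. -/
def MultiformlyValid (F : Formula) : Prop := ∀ I : Interpretation, ∃ M : HPM, M.Wins (F.game I)

/-! ## The counterstrategy

A funit of `F` is an occurrence of a subformula of `F` together with a choice of finite bitstrings,
one for each occurrence of a (co)recurrence above it. Its address is the string of the segments `0.`,
`1.` (at conjunctions and disjunctions) and `u.` (at (co)recurrences with the chosen bitstring `u`)
leading to it, its height is the length of its longest bitstring. It is a politeral funit if the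
subformula is a literal, regular if its bitstrings have equal lengths, and active in a position if
its address is an initial segment of a move of that position. The prompts of a position are the
regular politeral funits that have no bitstrings or whose height is the smallest number exceeding
the heights of all active funits. -/

/-- A strategy of the environment that grants permission to its adversary infinitely many times. It
sends the position in which it resumes its work to the moves it makes before granting the next
permission. -/
abbrev EnvStrategy := Position → List Move

/-- The computation branch of `M` on `e` in which `M` makes one transition each time when the
environment, who follows `σ`, grants permission. -/
def HPM.branchVs (M : HPM) (e : Valuation) (σ : EnvStrategy) : ℕ → M.Config
  | 0 => M.init
  | i + 1 => M.step e (M.branchVs e σ i) (σ (M.branchVs e σ i).run)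

/-- `M` loses `A` against `σ` on `e`. -/
def HPM.LosesAgainst (M : HPM) (A : Game) (σ : EnvStrategy) (e : Valuation) : Prop :=
  (A e).Wn (M.runOf (M.branchVs e σ)) = .bot

/-- The greatest of the heights of those funits of `F` whose address is an initial segment of the
given move: the move is read along `F`, and the longest bitstring read at a (co)recurrence is
returned. -/
def activeHeight : Formula → Move → ℕ
  | .atom _, _ => 0
  | .natom _, _ => 0
  | .and E G, m => max (((component false m).map (activeHeight E)).getD 0)
      (((component true m).map (activeHeight G)).getD 0)
  | .or E G, m => max (((component false m).map (activeHeight E)).getD 0)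
      (((component true m).map (activeHeight G)).getD 0)
  | .st E, m => ((readBits m).map fun r => max r.1.length (activeHeight E r.2)).getD 0
  | .cost E, m => ((readBits m).map fun r => max r.1.length (activeHeight E r.2)).getD 0

/-- The smallest number exceeding the heights of all active funits. -/
def promptHeight (F : Formula) (Φ : Position) : ℕ :=
  (Φ.map fun l => activeHeight F l.2 + 1).foldr max 0

/-- The lexicographic list of all bitstrings of length `n`. -/
def bitstrings : ℕ → List (List Bool)
  | 0 => [[]]
  | n + 1 => (bitstrings n).map (List.cons false) ++ (bitstrings n).map (List.cons true)

/-- The lexicographic list of the addresses of all politeral funits of `F` all of whose bitstrings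
have length `h`. -/
def literalAddresses (h : ℕ) : Formula → List Move
  | .atom _ => [[]]
  | .natom _ => [[]]
  | .and E G => (literalAddresses h E).map (addrSegment [false] ++ ·) ++
      (literalAddresses h G).map (addrSegment [true] ++ ·)
  | .or E G => (literalAddresses h E).map (addrSegment [false] ++ ·) ++
      (literalAddresses h G).map (addrSegment [true] ++ ·)
  | .st E => (bitstrings h).flatMap fun u => (literalAddresses h E).map (addrSegment u ++ ·)
  | .cost E => (bitstrings h).flatMap fun u => (literalAddresses h E).map (addrSegment u ++ ·)

/-- If the move is `αβ` with `α` the address of a politeral funit of `F`, then `some β`; otherwise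
`none`. -/
def payload : Formula → Move → Option Move
  | .atom _, m => some m
  | .natom _, m => some m
  | .and E G, m =>
      ((component false m).bind (payload E)).or ((component true m).bind (payload G))
  | .or E G, m =>
      ((component false m).bind (payload E)).or ((component true m).bind (payload G))
  | .st E, m => (readBits m).bind fun r => payload E r.2
  | .cost E, m => (readBits m).bind fun r => payload E r.2

theorem numeral_injective : Function.Injective numeral := by
  have val : ∀ a : ℕ, Nat.ofDigits 10 ((numeral a).reverse.map fun κ =>
      match κ with
      | .digit d => (d : ℕ)
      | _ => 0) = a := by
    intro a
    unfold numeral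
    split_ifs with h
    · simp [h]
    · rw [List.reverse_reverse, List.map_map]
      conv_rhs => rw [← Nat.ofDigits_digits 10 a]
      congr 1
      conv_rhs => rw [← List.map_id (Nat.digits 10 a)]
      apply List.map_congr_left
      intro d hd
      have := Nat.digits_lt_base (by norm_num : 1 < 10) hd
      simp [Fin.ofNat, Nat.mod_eq_of_lt this]
  intro a b h
  rw [← val a, ← val b, h]

theorem exists_fresh (F : Formula) (Φ : Position) :
    ∃ a, ∀ l ∈ Φ, payload F l.2 ≠ some (numeral a) := by
  have hfin : {a : ℕ | some (numeral a) ∈ Φ.map fun l => payload F l.2}.Finite :=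
    Set.Finite.preimage
      (fun a _ b _ hab => numeral_injective (Option.some_injective _ hab)) (List.finite_toSet _)
  obtain ⟨a, ha⟩ := hfin.exists_notMem
  exact ⟨a, fun l hl h => ha (List.mem_map.2 ⟨l, hl, h⟩)⟩

/-- The smallest natural number never made so far as a numeric move in a politeral funit. -/
def fresh (F : Formula) (Φ : Position) : ℕ := Nat.find (exists_fresh F Φ)

/-- Consecutively make fresh numeric moves in the politeral funits with the given addresses. -/
def freshMoves (F : Formula) : List Move → Position → List Move
  | [], _ => []
  | α :: r, Φ =>
      let m := α ++ numeral (fresh F Φ)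
      m :: freshMoves F r (Φ ++ [(.bot, m)])

/-- The counterstrategy for `F`: between two permissions, make a fresh numeric move in each prompt
of the current position. -/
def counterstrategy (F : Formula) : EnvStrategy :=
  fun Φ => freshMoves F (literalAddresses (promptHeight F Φ) F) Φ

/-- The valuation that assigns `n` to the variable with index `x` and `0` to all others. -/
def diagVal (x n : ℕ) : Valuation := fun y => if y = x then n else 0

/-! ## The system CL15 -/

/-- The data of a cirquent: a sequence of formulas, and sequences of undergroups and overgroups, which
are sets of (indices of) oformulas. -/
structure Cirquent where
  formulas : List Formula
  undergroups : List (Finset ℕ)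
  overgroups : List (Finset ℕ)

/-- The three sequences are nonempty, the groups are nonempty sets of oformulas, and every oformula
is in at least one undergroup and at least one overgroup. -/
structure Cirquent.IsValid (C : Cirquent) : Prop where
  formulas_ne : C.formulas ≠ []
  under_ne : C.undergroups ≠ []
  over_ne : C.overgroups ≠ []
  under_group : ∀ U ∈ C.undergroups, U.Nonempty ∧ ∀ i ∈ U, i < C.formulas.length
  over_group : ∀ O ∈ C.overgroups, O.Nonempty ∧ ∀ i ∈ O, i < C.formulas.length
  covered : ∀ i < C.formulas.length, (∃ U ∈ C.undergroups, i ∈ U) ∧ ∃ O ∈ C.overgroups, i ∈ O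

/-- Transform a group when the oformula at index `k` is replaced by two adjacent ones: the new
indices of the members other than `k` are used, and `k` itself, if present, is replaced by `s`. -/
def splitWith (k : ℕ) (s : Finset ℕ) (G : Finset ℕ) : Finset ℕ :=
  G.biUnion fun i => if i < k then {i} else if i = k then s else {i + 1}

/-- Transform a group when the oformula at index `k` is deleted. -/
def dropIndex (k : ℕ) (G : Finset ℕ) : Finset ℕ :=
  (G.erase k).image fun i => if i < k then i else i - 1

/-- The axioms: `¬F₁, F₁, …, ¬Fₙ, Fₙ` with `n ≥ 1`, where the undergroups as well as the overgroups
are `{¬F₁, F₁}, …, {¬Fₙ, Fₙ}`. -/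
def Cirquent.IsAxiom (C : Cirquent) : Prop :=
  ∃ Fs : List Formula, Fs ≠ [] ∧
    C.formulas = Fs.flatMap (fun F => [F.neg, F]) ∧
    C.undergroups = (List.range Fs.length).map (fun i => {2 * i, 2 * i + 1}) ∧
    C.overgroups = (List.range Fs.length).map (fun i => {2 * i, 2 * i + 1})

/-- `Rule C' C`: the conclusion `C` follows from the premise `C'` by one of the rules of CL15. -/
inductive Rule : Cirquent → Cirquent → Prop
  /-- Swap two adjacent undergroups. -/
  | exchangeUnder (Fs : List Formula) (L R Os : List (Finset ℕ)) (A B : Finset ℕ) :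
      Rule ⟨Fs, L ++ A :: B :: R, Os⟩ ⟨Fs, L ++ B :: A :: R, Os⟩
  /-- Swap two adjacent overgroups. -/
  | exchangeOver (Fs : List Formula) (Us L R : List (Finset ℕ)) (A B : Finset ℕ) :
      Rule ⟨Fs, Us, L ++ A :: B :: R⟩ ⟨Fs, Us, L ++ B :: A :: R⟩
  /-- Swap two adjacent oformulas. -/
  | exchangeFormula (L R : List Formula) (E G : Formula) (Us Os : List (Finset ℕ)) :
      Rule ⟨L ++ E :: G :: R, Us, Os⟩
        ⟨L ++ G :: E :: R,
          Us.map (Finset.image (Equiv.swap L.length (L.length + 1))),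
          Os.map (Finset.image (Equiv.swap L.length (L.length + 1)))⟩
  /-- Replace an undergroup by two adjacent undergroups of the same content. -/
  | duplicateUnder (Fs : List Formula) (L R Os : List (Finset ℕ)) (A : Finset ℕ) :
      Rule ⟨Fs, L ++ A :: R, Os⟩ ⟨Fs, L ++ A :: A :: R, Os⟩
  /-- Replace an overgroup by two adjacent overgroups of the same content. -/
  | duplicateOver (Fs : List Formula) (Us L R : List (Finset ℕ)) (A : Finset ℕ) :
      Rule ⟨Fs, Us, L ++ A :: R⟩ ⟨Fs, Us, L ++ A :: A :: R⟩
  /-- Merge two adjacent overgroups. -/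
  | merge (Fs : List Formula) (Us L R : List (Finset ℕ)) (A B : Finset ℕ) :
      Rule ⟨Fs, Us, L ++ A :: B :: R⟩ ⟨Fs, Us, L ++ (A ∪ B) :: R⟩
  /-- Weakening, read bottom-up: remove the oformula `k` from an undergroup `U` with at least two
  members; here `k` belongs to some other undergroup. -/
  | weakenArc (Fs : List Formula) (L R Os : List (Finset ℕ)) (U : Finset ℕ) (k : ℕ) (hk : k ∈ U)
      (hU : 2 ≤ U.card) (h : ∃ V ∈ L ++ R, k ∈ V) :
      Rule ⟨Fs, L ++ U.erase k :: R, Os⟩ ⟨Fs, L ++ U :: R, Os⟩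
  /-- Weakening, continued: if `k` belongs to no other undergroup, then it is deleted altogether,
  together with the overgroups that become empty. -/
  | weakenFormula (Fs : List Formula) (L R Os : List (Finset ℕ)) (U : Finset ℕ) (k : ℕ) (hk : k ∈ U)
      (hU : 2 ≤ U.card) (h : ∀ V ∈ L ++ R, k ∉ V) :
      Rule
        ⟨Fs.eraseIdx k, (L ++ U :: R).map (dropIndex k),
          (Os.map (dropIndex k)).filter fun O => O ≠ ∅⟩
        ⟨Fs, L ++ U :: R, Os⟩
  /-- Contraction. -/
  | contract (L R : List Formula) (E : Formula) (Us Os : List (Finset ℕ)) :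
      Rule
        ⟨L ++ .cost E :: .cost E :: R,
          Us.map (splitWith L.length {L.length, L.length + 1}),
          Os.map (splitWith L.length {L.length, L.length + 1})⟩
        ⟨L ++ .cost E :: R, Us, Os⟩
  /-- Disjunction Introduction. -/
  | orIntro (L R : List Formula) (E G : Formula) (Us Os : List (Finset ℕ)) :
      Rule
        ⟨L ++ E :: G :: R,
          Us.map (splitWith L.length {L.length, L.length + 1}),
          Os.map (splitWith L.length {L.length, L.length + 1})⟩
        ⟨L ++ .or E G :: R, Us, Os⟩
  /-- Conjunction Introduction: every undergroup containing the conjunction is replaced by two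
  adjacent undergroups, one with each conjunct. -/
  | andIntro (L R : List Formula) (E G : Formula) (Us Os : List (Finset ℕ)) :
      Rule
        ⟨L ++ E :: G :: R,
          Us.flatMap (fun U =>
            if L.length ∈ U then
              [splitWith L.length {L.length} U, splitWith L.length {L.length + 1} U]
            else [splitWith L.length ∅ U]),
          Os.map (splitWith L.length {L.length, L.length + 1})⟩
        ⟨L ++ .and E G :: R, Us, Os⟩
  /-- Recurrence Introduction: read bottom-up, a new overgroup with `E` as its only member is
  inserted. -/
  | stIntro (L R : List Formula) (E : Formula) (Us OL OR : List (Finset ℕ)) :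
      Rule ⟨L ++ E :: R, Us, OL ++ {L.length} :: OR⟩ ⟨L ++ .st E :: R, Us, OL ++ OR⟩
  /-- Corecurrence Introduction: read bottom-up, `E` is included in any number of existing
  overgroups. -/
  | costIntro (L R : List Formula) (E : Formula) (Us Os Os' : List (Finset ℕ))
      (h : List.Forall₂ (fun O O' => O' = O ∨ O' = insert L.length O) Os Os') :
      Rule ⟨L ++ E :: R, Us, Os'⟩ ⟨L ++ .cost E :: R, Us, Os⟩

/-- Provability of a cirquent in CL15: there is a sequence of cirquents ending in it which starts with
an axiom and in which every other cirquent follows from its predecessor by a rule. -/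
inductive Cirquent.Provable : Cirquent → Prop
  | ax (C : Cirquent) (hC : C.IsValid) (h : C.IsAxiom) : Provable C
  | step (C' C : Cirquent) (hC : C.IsValid) (h' : Provable C') (h : Rule C' C) : Provable C

/-- `CL15 ⊢ F`: the cirquent with the only oformula `F`, one undergroup and one overgroup is
provable. -/
def Formula.Provable (F : Formula) : Prop := Cirquent.Provable ⟨[F], [{0}], [{0}]⟩

end CoL

namespace CoL

/-! ## Infinite bitstrings and open operations on them -/

/-! The counterstrategy does not look at the interpretation, so the run of a machine against it is
fixed before any interpretation is chosen. It is enough to construct, from this run alone, winning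
conditions for the atoms under which the run is lost (`exists_losing_interpretation`). The dagger
interpretation then diagonalizes over all machines by using the losing interpretation for machine
number `e x` at the valuation `e`.

Regard the formula as a tree of units: paths that pick a component at every conjunction or
disjunction and an infinite bitstring at every (co)recurrence. Suppose that the environment can fix
one component `κ` of every conjunction and one bitstring `ρ` of every recurrence so that no two
remaining dual literals have opposite contents in the run. Let an atom be won exactly on the
label-reversed contents of the remaining negative literals. Then every remaining literal is lost,
and the loss propagates up to the root (`wn_eq_bot`).

Suppose on the contrary that, for a suitable `ρ`, every `κ` leaves an opposite pair. Since
visibility of a unit is an open condition on `κ`, compactness of `Path → Bool` leaves finitely many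
pairs to consider. A CL15 derivation is then built bottom-up (`Formula.provable_of_resolution`):
oformulas are units, undergroups are the sets of units visible under some `κ`, and overgroups are
the sets of units depending on a given decomposed recurrence. The top cirquent reduces to an axiom
if opposite literals depend on the same recurrences. Recurrence Introduction requires that no other
oformula depends yet on the new recurrence, while Corecurrence Introduction can only join overgroups
that already exist; both are possible when dependence is well-founded. `Resolution` records these
requirements.

The crux is the choice of `ρ`. The environment never reuses a number and prompts every literal at
arbitrarily great heights. Therefore the bitstrings of either of two opposite literals are computed
from those of the other by one of countably many partial continuous operations read off the run
(`traceOp`, `Opp.computes`). Paths are well-ordered so that all proper initial segments have fewer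
than continuum many members, and `ρ U` is chosen generically by transfinite recursion: it lies
outside the closure of what is available at stage `U`, and adding it to the bitstrings above `U`
yields nothing else from that closure. A unit depends on `U` if its bitstrings generate something
that first appears when `ρ U` is added (`exists_resolution`). Generic choices exist by a fusion
argument: there is a perfect set on which two operations can agree at distinct points only in a
value that is already constant on a cylinder, hence is computable without the new bitstring
(`exists_independent`, `exists_generic`). -/

/-- The finite bitstring `σ` is an initial segment of the infinite bitstring `x`. -/
def Pre (σ : List Bool) (x : ℕ → Bool) : Prop := σ = (List.range σ.length).map x

/-- The initial segment of length `n` of an infinite bitstring. -/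
def trunc (n : ℕ) (x : ℕ → Bool) : List Bool := (List.range n).map x

@[simp] theorem length_trunc (n : ℕ) (x : ℕ → Bool) : (trunc n x).length = n := by simp [trunc]

theorem pre_trunc (n : ℕ) (x : ℕ → Bool) : Pre (trunc n x) x := by simp [Pre, trunc]

theorem trunc_succ (n : ℕ) (x : ℕ → Bool) : trunc (n + 1) x = trunc n x ++ [x n] := by
  simp [trunc, List.range_succ]

theorem getElem?_trunc {n k : ℕ} (x : ℕ → Bool) (h : k < n) : (trunc n x)[k]? = some (x k) := by
  simp [trunc, h]

theorem pre_iff {σ : List Bool} {x : ℕ → Bool} :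
    Pre σ x ↔ ∀ i c, σ[i]? = some c → x i = c := by
  constructor
  · intro h i c hi
    rw [h] at hi
    have hlt : i < σ.length := by
      by_contra hn
      rw [List.getElem?_eq_none (by simpa using not_lt.1 hn)] at hi
      simp at hi
    simpa [hlt] using hi
  · intro h
    apply List.ext_getElem? 
    intro i
    by_cases hi : i < σ.length
    · have := h i σ[i] (by simp [hi])
      simp [hi, this]
    · rw [List.getElem?_eq_none (not_lt.1 hi), List.getElem?_eq_none (by simpa using hi)]

theorem Pre.mono {σ τ : List Bool} {x : ℕ → Bool} (h : σ <+: τ) (hx : Pre τ x) : Pre σ x := by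
  rw [pre_iff] at *
  intro i c hi
  obtain ⟨r, rfl⟩ := h
  exact hx i c (by rw [List.getElem?_append_left (List.getElem?_eq_some_iff.1 hi).1]; exact hi)

theorem pre_iff_trunc {σ : List Bool} {x : ℕ → Bool} : Pre σ x ↔ σ = trunc σ.length x := Iff.rfl

theorem trunc_prefix_trunc {m n : ℕ} (h : m ≤ n) (x : ℕ → Bool) : trunc m x <+: trunc n x := by
  obtain ⟨k, rfl⟩ := Nat.exists_eq_add_of_le h
  exact ⟨(List.range k).map (fun i => x (m + i)), by simp [trunc, List.range_add, Function.comp_def]⟩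

theorem pre_trunc_iff {n : ℕ} {x y : ℕ → Bool} : Pre (trunc n x) y ↔ ∀ i < n, y i = x i := by
  rw [pre_iff]
  constructor
  · intro h i hi
    exact h i _ (getElem?_trunc x hi)
  · intro h i c hc
    have hi : i < n := by simpa using (List.getElem?_eq_some_iff.1 hc).1
    rw [getElem?_trunc x hi] at hc
    simpa [h i hi] using hc

theorem Pre.prefix_trunc {σ : List Bool} {x : ℕ → Bool} (h : Pre σ x) {n : ℕ}
    (hn : σ.length ≤ n) : σ <+: trunc n x := by
  rw [pre_iff_trunc] at h
  rw [h]
  exact trunc_prefix_trunc hn x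

theorem eq_of_forall_pre_trunc {x y : ℕ → Bool} (h : ∀ k, ∃ n, k ≤ n ∧ Pre (trunc n x) y) :
    x = y := by
  funext i
  obtain ⟨n, hn, hp⟩ := h (i + 1)
  exact (pre_trunc_iff.1 hp i hn).symm

theorem mem_bitstrings {n : ℕ} {u : List Bool} : u ∈ bitstrings n ↔ u.length = n := by
  induction n generalizing u with
  | zero => simp [bitstrings]
  | succ n ih =>
    cases u with
    | nil => simp [bitstrings]
    | cons b u => cases b <;> simp [bitstrings, ih]

theorem isOpen_pre (σ : List Bool) : IsOpen {x : ℕ → Bool | Pre σ x} := by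
  have : {x : ℕ → Bool | Pre σ x} = ⋂ i : Fin σ.length, {x | x i = σ[i]} := by
    ext x
    simp only [Set.mem_ofPred_eq, Set.mem_iInter, pre_iff]
    constructor
    · intro h i
      exact h i _ (by simp)
    · intro h i c hc
      obtain ⟨hi, rfl⟩ := List.getElem?_eq_some_iff.1 hc
      exact h ⟨i, hi⟩
  rw [this]
  refine isOpen_iInter_of_finite fun i => ?_
  have h : Continuous fun x : ℕ → Bool => x i := continuous_apply _
  exact (isOpen_discrete ({σ[i]} : Set Bool)).preimage h

theorem exists_trunc_subset {S : Set (ℕ → Bool)} (hS : IsOpen S) {x : ℕ → Bool} (hx : x ∈ S) :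
    ∃ n, ∀ y, (∀ i < n, y i = x i) → y ∈ S := by
  obtain ⟨I, u, hu, hI⟩ := isOpen_pi_iff.1 hS x hx
  refine ⟨I.sup id + 1, fun y hy => hI ?_⟩
  intro i hi
  rw [hy i (Nat.lt_succ_of_le (Finset.le_sup (f := id) hi))]
  exact (hu i hi).2

theorem exists_trunc_subset_pi {m : ℕ} {S : Set (Fin m → ℕ → Bool)} (hS : IsOpen S)
    {x : Fin m → ℕ → Bool} (hx : x ∈ S) :
    ∃ n, ∀ y, (∀ i, ∀ j < n, y i j = x i j) → y ∈ S := by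
  obtain ⟨I, u, hu, hI⟩ := isOpen_pi_iff.1 hS x hx
  have : ∀ i, ∃ n, i ∈ I → ∀ y, (∀ j < n, y j = x i j) → y ∈ u i := by
    intro i
    by_cases hi : i ∈ I
    · obtain ⟨n, hn⟩ := exists_trunc_subset (hu i hi).1 (hu i hi).2
      exact ⟨n, fun _ => hn⟩
    · exact ⟨0, fun h => absurd h hi⟩
  choose n hn using this
  refine ⟨Finset.univ.sup n, fun y hy => hI ?_⟩
  intro i hi
  exact hn i hi _ fun j hj => hy i j (hj.trans_le (Finset.le_sup (Finset.mem_univ i)))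

/-- An operation on `r` infinite bitstrings: `f k c` is the set of the arguments for which `c` is put
forward as the value of bit `k` of the result. -/
def Op (r : ℕ) := ℕ → Bool → Set (Fin r → ℕ → Bool)

/-- The operation has the value `b` at `a`. -/
def Op.Computes {r : ℕ} (f : Op r) (a : Fin r → ℕ → Bool) (b : ℕ → Bool) : Prop :=
  ∀ k c, a ∈ f k c ↔ b k = c

def Op.IsOpen {r : ℕ} (f : Op r) : Prop := ∀ k c, _root_.IsOpen (f k c)

/-- Projection to a coordinate. -/
def Op.proj {r : ℕ} (i : Fin r) : Op r := fun k c => {a | a i k = c}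

/-- The operation that sends `a` to the common value of `f (x, a)` for `x` extending `σ`. -/
def Op.const {r : ℕ} (f : Op (r + 1)) (σ : List Bool) : Op r :=
  fun k c => {a | ∃ x, Pre σ x ∧ (Fin.cons x a : Fin (r + 1) → ℕ → Bool) ∈ f k c}

/-- Composition of operations. -/
def Op.comp {m r : ℕ} (f : Op m) (g : Fin m → Op r) : Op r :=
  fun k c => {a | ∃ (n : ℕ) (τ : Fin m → ℕ → Bool), (∀ i, ∀ j < n, a ∈ g i j (τ i j)) ∧
    ∀ y : Fin m → ℕ → Bool, (∀ i, ∀ j < n, y i j = τ i j) → y ∈ f k c}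

theorem Op.Computes.unique {r : ℕ} {f : Op r} {a : Fin r → ℕ → Bool} {b b' : ℕ → Bool}
    (h : f.Computes a b) (h' : f.Computes a b') : b = b' := by
  funext k
  exact ((h' k _).1 ((h k _).2 rfl)).symm

theorem Op.isOpen_proj {r : ℕ} (i : Fin r) : (Op.proj i).IsOpen := by
  intro k c
  have h : Continuous fun a : Fin r → ℕ → Bool => a i k :=
    (continuous_apply k).comp (continuous_apply i)
  exact (isOpen_discrete ({c} : Set Bool)).preimage h

theorem Op.isOpen_const {r : ℕ} {f : Op (r + 1)} (hf : f.IsOpen) (σ : List Bool) :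
    (f.const σ).IsOpen := by
  intro k c
  have : f.const σ k c = ⋃ x ∈ {x | Pre σ x},
      (fun a => (Fin.cons x a : Fin (r + 1) → ℕ → Bool)) ⁻¹' f k c := by
    ext a
    simp [Op.const]
  rw [this]
  refine isOpen_biUnion fun x _ => (hf k c).preimage ?_
  refine continuous_pi fun i => ?_
  refine Fin.cases ?_ (fun i => ?_) i
  · simpa using continuous_const
  · simpa using continuous_apply i

/-- Bit `k` of the composite is secured by finitely many bits of the inner values that force it for
`f`, so the set is a union of finite intersections of sets of the `g i`. Openness of `f` plays no
role here. -/
theorem Op.isOpen_comp {m r : ℕ} {f : Op m} {g : Fin m → Op r} (hg : ∀ i, (g i).IsOpen) :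
    (f.comp g).IsOpen := by
  intro k c
  have : f.comp g k c = ⋃ (n : ℕ) (τ : Fin m → ℕ → Bool)
      (_ : ∀ y : Fin m → ℕ → Bool, (∀ i, ∀ j < n, y i j = τ i j) → y ∈ f k c),
      ⋂ (i : Fin m) (j : Fin n), g i j (τ i j) := by
    ext a
    simp only [Op.comp, Set.mem_ofPred_eq, Set.mem_iUnion, Set.mem_iInter, exists_prop]
    refine exists_congr fun n => exists_congr fun τ => ?_
    rw [and_comm]
    refine and_congr_right fun _ => ?_
    exact ⟨fun h i j => h i j j.2, fun h i j hj => h i ⟨j, hj⟩⟩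
  rw [this]
  exact isOpen_iUnion fun n => isOpen_iUnion fun τ => isOpen_iUnion fun _ =>
    isOpen_iInter_of_finite fun i => isOpen_iInter_of_finite fun j => hg i _ _

theorem Op.computes_proj {r : ℕ} (i : Fin r) (a : Fin r → ℕ → Bool) :
    (Op.proj i).Computes a (a i) := fun _ _ => Iff.rfl

/-- This is where openness of the outer operation matters: its bit `k` is decided by finitely many
bits of its arguments, as the definition of composition demands. -/
theorem Op.computes_comp {m r : ℕ} {f : Op m} (hf : f.IsOpen) {g : Fin m → Op r}
    {a : Fin r → ℕ → Bool} {y : Fin m → ℕ → Bool} {b : ℕ → Bool}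
    (hy : ∀ i, (g i).Computes a (y i)) (hb : f.Computes y b) : (f.comp g).Computes a b := by
  intro k c
  constructor
  · rintro ⟨n, τ, h1, h2⟩
    exact (hb k c).1 (h2 y fun i j hj => (hy i j _).1 (h1 i j hj))
  · intro h
    obtain ⟨n, hn⟩ := exists_trunc_subset_pi (hf k c) ((hb k c).2 h)
    exact ⟨n, y, fun i j _ => (hy i j _).2 rfl, hn⟩

/-! ### A perfect independent family -/

/-- `b` is the common value on a cylinder of one of the given unary operations. -/
def IsConstValue (O : ℕ → ℕ → Bool → Set (ℕ → Bool)) (b : ℕ → Bool) : Prop :=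
  ∃ n σ, ∀ k c, (∃ x, Pre σ x ∧ x ∈ O n k c) ↔ b k = c

/-- The only common values of the operations `n` and `m` on two cylinders are constant values. -/
def Settled (O : ℕ → ℕ → Bool → Set (ℕ → Bool)) (n m : ℕ) (σ τ : List Bool) : Prop :=
  ∀ x y b, Pre σ x → Pre τ y → (∀ k c, x ∈ O n k c ↔ b k = c) → (∀ k c, y ∈ O m k c ↔ b k = c) →
    IsConstValue O b

theorem Settled.mono {O : ℕ → ℕ → Bool → Set (ℕ → Bool)} {n m : ℕ} {σ τ σ' τ' : List Bool}
    (h : Settled O n m σ τ) (hσ : σ <+: σ') (hτ : τ <+: τ') : Settled O n m σ' τ' :=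
  fun x y b hx hy => h x y b (hx.mono hσ) (hy.mono hτ)

theorem exists_extension_subset {S : Set (ℕ → Bool)} (hS : IsOpen S) {x : ℕ → Bool} (hx : x ∈ S)
    {σ : List Bool} (hσ : Pre σ x) : ∃ σ', σ <+: σ' ∧ ∀ y, Pre σ' y → y ∈ S := by
  obtain ⟨n, hn⟩ := exists_trunc_subset hS hx
  refine ⟨trunc (max n σ.length) x, hσ.prefix_trunc (le_max_right _ _), fun y hy => hn y ?_⟩
  intro i hi
  exact pre_trunc_iff.1 hy i (hi.trans_le (le_max_left _ _))

/-- If some bit of operation `n` takes both values on the cylinder of `σ`, the two cylinders can be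
shrunk until the operations disagree at that bit, unless operation `m` never yields this bit on `τ`.
Otherwise every bit takes at most one value on `σ`, and any value of operation `n` there is a
constant value. -/
theorem exists_settled {O : ℕ → ℕ → Bool → Set (ℕ → Bool)} (hO : ∀ n k c, IsOpen (O n k c))
    (n m : ℕ) (σ τ : List Bool) :
    ∃ σ' τ', σ <+: σ' ∧ τ <+: τ' ∧ Settled O n m σ' τ' := by
  by_cases hA : ∃ k, ∀ c, ∃ x, Pre σ x ∧ x ∈ O n k c
  · obtain ⟨k, hk⟩ := hA
    by_cases hB : ∃ c y, Pre τ y ∧ y ∈ O m k c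
    · obtain ⟨c, y, hy, hyO⟩ := hB
      obtain ⟨x, hx, hxO⟩ := hk (!c)
      obtain ⟨σ', hσ, hσ'⟩ := exists_extension_subset (hO n k (!c)) hxO hx
      obtain ⟨τ', hτ, hτ'⟩ := exists_extension_subset (hO m k c) hyO hy
      refine ⟨σ', τ', hσ, hτ, fun x y b hx hy hbx hby => ?_⟩
      have h1 := (hbx k _).1 (hσ' x hx)
      have h2 := (hby k _).1 (hτ' y hy)
      simp [h1] at h2
    · refine ⟨σ, τ, List.prefix_rfl, List.prefix_rfl, fun x y b _ hy _ hby => ?_⟩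
      exact absurd ⟨b k, y, hy, (hby k _).2 rfl⟩ hB
  · refine ⟨σ, τ, List.prefix_rfl, List.prefix_rfl, fun x y b hx _ hbx _ => ⟨n, σ, fun k c => ?_⟩⟩
    constructor
    · rintro ⟨x', hx', hx'O⟩
      by_contra hne
      refine hA ⟨k, fun d => ?_⟩
      by_cases hd : d = c
      · exact ⟨x', hx', hd ▸ hx'O⟩
      · refine ⟨x, hx, (hbx k d).2 ?_⟩
        revert hne hd
        cases b k <;> cases c <;> cases d <;> simp
    · rintro h
      exact ⟨x, hx, (hbx k c).2 h⟩

/-- The finitely many requirements are met one after another. Further extension preserves settled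
pairs, and distinctness of the two nodes allows their strings to be extended independently. -/
theorem exists_all_settled {O : ℕ → ℕ → Bool → Set (ℕ → Bool)} (hO : ∀ n k c, IsOpen (O n k c))
    (R : List ((List Bool × List Bool) × ℕ × ℕ)) (hR : ∀ q ∈ R, q.1.1 ≠ q.1.2)
    (S : List Bool → List Bool) :
    ∃ S' : List Bool → List Bool, (∀ s, S s <+: S' s) ∧
      ∀ q ∈ R, Settled O q.2.1 q.2.2 (S' q.1.1) (S' q.1.2) := by
  induction R with
  | nil => exact ⟨S, fun _ => List.prefix_rfl, by simp⟩
  | cons q R ih =>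
    obtain ⟨S', hS', hR'⟩ := ih fun q hq => hR q (List.mem_cons_of_mem _ hq)
    obtain ⟨σ, τ, hσ, hτ, hs⟩ := exists_settled hO q.2.1 q.2.2 (S' q.1.1) (S' q.1.2)
    have hne := hR q List.mem_cons_self
    set S'' : List Bool → List Bool :=
      Function.update (Function.update S' q.1.1 σ) q.1.2 τ with hS''
    have hext : ∀ s, S' s <+: S'' s := by
      intro s
      by_cases h2 : s = q.1.2
      · subst h2
        simpa [hS''] using hτ
      · by_cases h1 : s = q.1.1
        · subst h1
          simpa [hS'', Function.update_of_ne hne] using hσ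
        · simp [hS'', Function.update_of_ne h1, Function.update_of_ne h2]
    refine ⟨S'', fun s => (hS' s).trans (hext s), ?_⟩
    intro q' hq'
    rcases List.mem_cons.1 hq' with rfl | hq'
    · have e1 : S'' q'.1.1 = σ := by simp [hS'', Function.update_of_ne hne]
      have e2 : S'' q'.1.2 = τ := by simp [hS'']
      rw [e1, e2]
      exact hs
    · exact (hR' q' hq').mono (hext _) (hext _)

/-- Fusion along the binary tree: a finite string is attached to every node, and at level `k + 1`
the strings of all distinct nodes are extended until all pairs of operations with indices at most
`k` are settled. The points of the family are the limits along the branches. -/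
theorem exists_independent {O : ℕ → ℕ → Bool → Set (ℕ → Bool)} (hO : ∀ n k c, IsOpen (O n k c)) :
    ∃ Q : (ℕ → Bool) → ℕ → Bool, Function.Injective Q ∧ ∀ t t', t ≠ t' → ∀ n m b,
      (∀ k c, Q t ∈ O n k c ↔ b k = c) → (∀ k c, Q t' ∈ O m k c ↔ b k = c) →
        IsConstValue O b := by
  have step : ∀ (k : ℕ) (S : List Bool → List Bool), ∃ S' : List Bool → List Bool,
      (∀ s c, S s ++ [c] <+: S' (s ++ [c])) ∧
      ∀ s s' : List Bool, s.length = k + 1 → s'.length = k + 1 → s ≠ s' → ∀ n ≤ k, ∀ m ≤ k,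
        Settled O n m (S' s) (S' s') := by
    intro k S
    obtain ⟨S', h1, h2⟩ := exists_all_settled hO
      ((((bitstrings (k + 1)) ×ˢ (bitstrings (k + 1))).filter fun q => q.1 ≠ q.2) ×ˢ
        ((List.range (k + 1)) ×ˢ (List.range (k + 1))))
      (by
        rintro ⟨⟨s, s'⟩, n, m⟩ hq
        simp only [List.mem_product, List.mem_filter] at hq
        simpa using hq.1.2)
      -- The two children of a node start from the parent's string followed by different bits; this
      -- makes the family injective.
      (fun s => S s.dropLast ++ [s.getLastD false])
    refine ⟨S', fun s c => by simpa using h1 (s ++ [c]), ?_⟩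
    intro s s' hs hs' hne n hn m hm
    refine h2 ((s, s'), n, m) ?_
    simp only [List.mem_product, List.mem_filter, mem_bitstrings, List.mem_range]
    exact ⟨⟨⟨hs, hs'⟩, by simpa using hne⟩, by omega, by omega⟩
  choose next hnext1 hnext2 using step
  let S : ℕ → List Bool → List Bool := fun k => Nat.rec (fun _ => []) (fun k S => next k S) k
  have hS1 : ∀ k s c, S k s ++ [c] <+: S (k + 1) (s ++ [c]) := fun k => hnext1 k (S k)
  have hS2 := fun k => hnext2 k (S k)
  have hlen : ∀ t k, k ≤ (S k (trunc k t)).length := by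
    intro t k
    induction k with
    | zero => simp
    | succ k ih =>
      have := (hS1 k (trunc k t) (t k)).length_le
      rw [← trunc_succ] at this
      simp only [List.length_append, List.length_singleton] at this
      omega
  have hmono : ∀ t k j, S k (trunc k t) <+: S (k + j) (trunc (k + j) t) := by
    intro t k j
    induction j with
    | zero => exact List.prefix_rfl
    | succ j ih =>
      refine ih.trans ?_
      have := hS1 (k + j) (trunc (k + j) t) (t (k + j))
      rw [← trunc_succ] at this
      exact (List.prefix_append _ _).trans this
  -- By `hlen` the string at level `i + 1` has more than `i` bits, so the default value is never
  -- used.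
  let Q : (ℕ → Bool) → ℕ → Bool := fun t i => (S (i + 1) (trunc (i + 1) t)).getD i false
  have hQ : ∀ t k, Pre (S k (trunc k t)) (Q t) := by
    intro t k
    rw [pre_iff]
    intro i c hi
    have hcomp : (S (i + 1) (trunc (i + 1) t))[i]? = some c := by
      have hi' : i < (S (i + 1) (trunc (i + 1) t)).length := hlen t (i + 1)
      rcases le_total k (i + 1) with h | h
      · obtain ⟨j, hj⟩ := Nat.exists_eq_add_of_le h
        obtain ⟨r, hr⟩ := hmono t k j
        rw [hj, ← hr, List.getElem?_append_left (List.getElem?_eq_some_iff.1 hi).1, hi]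
      · obtain ⟨j, hj⟩ := Nat.exists_eq_add_of_le h
        obtain ⟨r, hr⟩ := hmono t (i + 1) j
        rw [hj, ← hr, List.getElem?_append_left hi'] at hi
        exact hi
    simp [Q, List.getD_eq_getElem?_getD, hcomp]
  refine ⟨Q, ?_, ?_⟩
  · intro t t' hQQ
    by_contra hne
    obtain ⟨k, hk⟩ := Function.ne_iff.1 hne
    -- At the first place where the branches differ, both limits continue the same string by
    -- different bits.
    let P : ℕ → Prop := fun k => t k ≠ t' k
    have hex : ∃ k, P k := ⟨k, hk⟩
    classical
    have hmin : ∀ j < Nat.find hex, t j = t' j := fun j hj => by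
      simpa [P] using Nat.find_min hex hj
    have hP : t (Nat.find hex) ≠ t' (Nat.find hex) := Nat.find_spec hex
    generalize Nat.find hex = j at hmin hP
    have htr : trunc j t = trunc j t' := by
      apply List.map_congr_left
      intro i hi
      exact hmin i (List.mem_range.1 hi)
    have h1 := (hQ t (j + 1)).mono (trunc_succ j t ▸ hS1 j (trunc j t) (t j))
    have h2 := (hQ t' (j + 1)).mono (trunc_succ j t' ▸ hS1 j (trunc j t') (t' j))
    rw [← htr] at h2
    have e1 := pre_iff.1 h1 (S j (trunc j t)).length (t j) (by simp)
    have e2 := pre_iff.1 h2 (S j (trunc j t)).length (t' j) (by simp)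
    exact hP (by rw [← e1, ← e2, hQQ])
  · intro t t' hne n m b hb hb'
    obtain ⟨j, hj⟩ := Function.ne_iff.1 hne
    -- Level `K + 1` lies beyond a difference of the two branches, and its requirements include both
    -- operations.
    let K := max j (max n m)
    have hne' : trunc (K + 1) t ≠ trunc (K + 1) t' := by
      intro h
      have := congrArg (fun l => l[j]?) h
      have hjK : j < K + 1 := by omega
      simp only [getElem?_trunc _ hjK] at this
      exact hj (by simpa using this)
    exact hS2 K _ _ (by simp) (by simp) hne' n (by omega) m (by omega) _ _ b (hQ t (K + 1))
      (hQ t' (K + 1)) hb hb'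

end CoL

namespace CoL

open Cardinal

/-! ### Closure under countably many operations -/

/-- The operations generated in at most `n` steps from the given ones and the projections by
composition and by taking constant values. -/
def ops (base : (r : ℕ) → Set (Op r)) : ℕ → (r : ℕ) → Set (Op r)
  | 0, r => base r ∪ Set.range Op.proj
  | n + 1, r => ops base n r ∪
      {h | ∃ (m : ℕ) (f : Op m) (g : Fin m → Op r), f ∈ ops base n m ∧ (∀ i, g i ∈ ops base n r) ∧
        h = f.comp g} ∪
      {h | ∃ f ∈ ops base n (r + 1), ∃ σ, h = Op.const f σ}

theorem ops_mono (base : (r : ℕ) → Set (Op r)) {m n : ℕ} (h : m ≤ n) (r : ℕ) :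
    ops base m r ⊆ ops base n r := by
  induction n, h using Nat.le_induction with
  | base => exact subset_rfl
  | succ n _ ih => exact fun f hf => Or.inl (Or.inl (ih hf))

theorem isOpen_of_mem_ops {base : (r : ℕ) → Set (Op r)} (hb : ∀ r, ∀ f ∈ base r, f.IsOpen)
    {n r : ℕ} {f : Op r} (hf : f ∈ ops base n r) : f.IsOpen := by
  induction n generalizing r with
  | zero =>
    rcases hf with hf | ⟨i, rfl⟩
    · exact hb r f hf
    · exact Op.isOpen_proj i
  | succ n ih =>
    rcases hf with (hf | ⟨m, f, g, hf, hg, rfl⟩) | ⟨f, hf, σ, rfl⟩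
    · exact ih hf
    · exact Op.isOpen_comp fun i => ih (hg i)
    · exact Op.isOpen_const (ih hf) σ

theorem countable_ops {base : (r : ℕ) → Set (Op r)} (hb : ∀ r, (base r).Countable) (n r : ℕ) :
    (ops base n r).Countable := by
  induction n generalizing r with
  | zero => exact (hb r).union (Set.countable_range _)
  | succ n ih =>
    refine ((ih r).union ?_).union ?_
    · have : ∀ m, Countable (ops base n m) := fun m => (ih m).to_subtype
      refine (Set.countable_range (fun q : (Σ m, ops base n m × (Fin m → ops base n r)) =>
        q.2.1.1.comp fun i => (q.2.2 i).1)).mono ?_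
      rintro _ ⟨m, f, g, hf, hg, rfl⟩
      exact ⟨⟨m, ⟨f, hf⟩, fun i => ⟨g i, hg i⟩⟩, rfl⟩
    · have : Countable (ops base n (r + 1)) := (ih (r + 1)).to_subtype
      refine (Set.countable_range (fun q : ops base n (r + 1) × List Bool =>
        q.1.1.const q.2)).mono ?_
      rintro _ ⟨f, hf, σ, rfl⟩
      exact ⟨⟨⟨f, hf⟩, σ⟩, rfl⟩

/-- The values at `l` of the operations generated by `base`. -/
def cl (base : (r : ℕ) → Set (Op r)) (l : List (ℕ → Bool)) : Set (ℕ → Bool) :=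
  {b | ∃ n, ∃ f ∈ ops base n l.length, Op.Computes f l.get b}

section

variable {base : (r : ℕ) → Set (Op r)}

/-- There are countably many generated operations, each with at most one value at the given tuple.
-/
theorem countable_cl (hb : ∀ r, (base r).Countable) (l : List (ℕ → Bool)) :
    (cl base l).Countable := by
  classical
  have hc : (⋃ n, ops base n l.length).Countable :=
    Set.countable_iUnion fun n => countable_ops hb n _
  refine (hc.image fun f => if h : ∃ b, Op.Computes f l.get b then h.choose else default).mono ?_
  rintro b ⟨n, f, hf, hfb⟩
  refine ⟨f, Set.mem_iUnion.2 ⟨n, hf⟩, ?_⟩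
  have h : ∃ b, Op.Computes f l.get b := ⟨b, hfb⟩
  simp only [dif_pos h]
  exact h.choose_spec.unique hfb

theorem mem_cl_of_mem {l : List (ℕ → Bool)} {a : ℕ → Bool} (h : a ∈ l) : a ∈ cl base l := by
  obtain ⟨i, rfl⟩ := List.get_of_mem h
  exact ⟨0, _, Or.inr ⟨i, rfl⟩, Op.computes_proj i _⟩

theorem mem_cl_of_base {l : List (ℕ → Bool)} {f : Op l.length} (hf : f ∈ base l.length)
    {b : ℕ → Bool} (h : f.Computes l.get b) : b ∈ cl base l :=
  ⟨0, f, Or.inl hf, h⟩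

/-- Closure under composition makes generation transitive. A tuple is finite, so one stage contains
all operations that produce its entries. -/
theorem cl_subset_cl (hb : ∀ r, ∀ f ∈ base r, f.IsOpen) {l l' : List (ℕ → Bool)}
    (h : ∀ a ∈ l, a ∈ cl base l') : cl base l ⊆ cl base l' := by
  rintro b ⟨n, f, hf, hfb⟩
  have : ∀ i, ∃ k, ∃ g ∈ ops base k l'.length, Op.Computes g l'.get (l.get i) :=
    fun i => h _ (List.get_mem l i)
  choose k g hg hgc using this
  let N := max n (Finset.univ.sup k)
  refine ⟨N + 1, f.comp g, Or.inl (Or.inr ⟨_, f, g, ops_mono _ (le_max_left _ _) _ hf,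
    fun i => ?_, rfl⟩), Op.computes_comp (isOpen_of_mem_ops hb hf) hgc hfb⟩
  exact ops_mono _ ((Finset.le_sup (Finset.mem_univ i)).trans (le_max_right _ _)) _ (hg i)

theorem cl_mono (hb : ∀ r, ∀ f ∈ base r, f.IsOpen) {l l' : List (ℕ → Bool)} (h : l ⊆ l') :
    cl base l ⊆ cl base l' :=
  cl_subset_cl hb fun _ ha => mem_cl_of_mem (h ha)

/-- A new bitstring can be chosen outside of a given small set `B` in such a way that no elements of
`B` are added to the closure. -/
theorem exists_generic (hb : ∀ r, ∀ f ∈ base r, f.IsOpen) (hc : ∀ r, (base r).Countable)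
    (l : List (ℕ → Bool)) {B : Set (ℕ → Bool)} (hB : #B < 𝔠) :
    ∃ x, x ∉ B ∧ ∀ b ∈ cl base (x :: l), b ∈ B → b ∈ cl base l := by
  classical
  have hcount : (⋃ n, ops base n (l.length + 1)).Countable :=
    Set.countable_iUnion fun n => countable_ops hc n _
  -- One sequence lists all generated operations with one argument more than `l` supplies; a
  -- projection shows that there are any.
  obtain ⟨F, hF⟩ := hcount.exists_eq_range
    ⟨Op.proj 0, Set.mem_iUnion.2 ⟨0, Or.inr ⟨0, rfl⟩⟩⟩
  have hFmem : ∀ n, ∃ k, F n ∈ ops base k (l.length + 1) := fun n =>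
    Set.mem_iUnion.1 (hF ▸ Set.mem_range_self n)
  have hget : ∀ x, (x :: l).get = (Fin.cons x l.get : Fin (l.length + 1) → ℕ → Bool) := by
    intro x
    funext i
    refine Fin.cases rfl (fun i => rfl) i
  -- With the other arguments frozen at `l`, these operations become unary in the new bitstring.
  obtain ⟨Q, hQi, hQ⟩ := exists_independent
    (O := fun n k c => {x | (Fin.cons x l.get : Fin (l.length + 1) → ℕ → Bool) ∈ F n k c}) (by
      intro n k c
      obtain ⟨m, hm⟩ := hFmem n
      refine (isOpen_of_mem_ops hb hm k c).preimage ?_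
      refine continuous_pi fun i => ?_
      refine Fin.cases ?_ (fun i => ?_) i
      · simpa using continuous_id'
      · simpa using continuous_const)
  by_contra hno
  push Not at hno
  -- If no bitstring is generic, every member of the perfect family is charged to an element of `B`:
  -- either itself, or an element that it newly makes computable.
  have hbad : ∀ t, ∃ b ∈ B, Q t = b ∨ (b ∈ cl base (Q t :: l) ∧ b ∉ cl base l) := by
    intro t
    by_cases hQB : Q t ∈ B
    · exact ⟨_, hQB, Or.inl rfl⟩
    · obtain ⟨b, h1, h2, h3⟩ := hno (Q t) hQB
      exact ⟨b, h2, Or.inr ⟨h1, h3⟩⟩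
  choose g hgB hg using hbad
  -- The charge, together with a flag for the kind of failure, determines `t`; this bounds the
  -- continuum by twice the cardinality of `B`.
  have hinj : Function.Injective fun t =>
      ((⟨g t, hgB t⟩, decide (Q t = g t)) : B × Bool) := by
    intro t t' htt
    simp only [Prod.mk.injEq, Subtype.mk.injEq, decide_eq_decide] at htt
    obtain ⟨h1, h2⟩ := htt
    by_cases ht : Q t = g t
    · exact hQi (by rw [ht, h1, ← h2.1 ht])
    · obtain ⟨⟨n, f, hf, hfc⟩, hncl⟩ := (hg t).resolve_left ht
      obtain ⟨⟨n', f', hf', hfc'⟩, -⟩ := (hg t').resolve_left fun h => ht (h2.2 h)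
      by_contra hne
      have hfr : f ∈ Set.range F := hF ▸ Set.mem_iUnion.2 ⟨n, hf⟩
      have hfr' : f' ∈ Set.range F := hF ▸ Set.mem_iUnion.2 ⟨n', hf'⟩
      obtain ⟨i, rfl⟩ := hfr
      obtain ⟨i', rfl⟩ := hfr'
      rw [hget] at hfc hfc'
      obtain ⟨j, σ, hσ⟩ := hQ t t' hne i i' (g t) hfc (h1 ▸ hfc')
      obtain ⟨m, hm⟩ := hFmem j
      -- A value common to two members is constant on a cylinder, so taking the constant value
      -- computes it from `l` alone, although it was supposed to be new.
      exact hncl ⟨m + 1, (F j).const σ, Or.inr ⟨_, hm, σ, rfl⟩, hσ⟩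
  have hle := Cardinal.mk_le_of_injective hinj
  have hX : #(ℕ → Bool) = 𝔠 := by simp
  rw [hX, Cardinal.mk_prod, Cardinal.lift_id, Cardinal.lift_id] at hle
  refine absurd hle (not_le.2 (Cardinal.mul_lt_of_lt aleph0_le_continuum hB ?_))
  simpa using (Cardinal.natCast_lt_aleph0 (n := 2)).trans_le aleph0_le_continuum

/-- The set of all values at tuples of elements of `S`. -/
def clSet (base : (r : ℕ) → Set (Op r)) (S : Set (ℕ → Bool)) : Set (ℕ → Bool) :=
  {b | ∃ l : List (ℕ → Bool), (∀ a ∈ l, a ∈ S) ∧ b ∈ cl base l}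

theorem clSet_mono {S S' : Set (ℕ → Bool)} (h : S ⊆ S') : clSet base S ⊆ clSet base S' :=
  fun _ ⟨l, hl, hb⟩ => ⟨l, fun a ha => h (hl a ha), hb⟩

theorem cl_subset_clSet {S : Set (ℕ → Bool)} {l : List (ℕ → Bool)} (h : ∀ a ∈ l, a ∈ S) :
    cl base l ⊆ clSet base S :=
  fun _ hb => ⟨l, h, hb⟩

/-- There are at most `max ℵ₀ #S` finite tuples, and each generates only countably many values. -/
theorem mk_clSet_le (hc : ∀ r, (base r).Countable) (S : Set (ℕ → Bool)) :
    #(clSet base S) ≤ max ℵ₀ #S := by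
  have hsub : clSet base S ⊆ ⋃ l : List S, cl base (l.map Subtype.val) := by
    rintro b ⟨l, hl, hb⟩
    refine Set.mem_iUnion.2 ⟨l.attach.map fun a => ⟨a.1, hl a.1 a.2⟩, ?_⟩
    simpa [Function.comp_def] using hb
  refine (Cardinal.mk_le_mk_of_subset hsub).trans ((Cardinal.mk_iUnion_le _).trans ?_)
  have h1 : #(List S) ≤ max ℵ₀ #S := Cardinal.mk_list_le_max _
  have h2 : (⨆ l : List S, #(cl base (l.map Subtype.val))) ≤ ℵ₀ :=
    ciSup_le' fun l => (countable_cl hc _).le_aleph0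
  refine (mul_le_mul' h1 (h2.trans (le_max_left _ #S))).trans ?_
  rw [Cardinal.mul_eq_self (le_max_left _ _)]

/-- Each `ρ U` is chosen generically over everything available at stage `U`, and `D l` collects the
stages at which some element of the closure of `l` first appears. Genericity says that passing from
`s U` to `ρ U :: s U` creates no dependence except the one on `U` itself. -/
theorem exists_resolution {ι : Type} (hι : #ι ≤ 𝔠) (s : ι → List (ℕ → Bool))
    (hb : ∀ r, ∀ f ∈ base r, f.IsOpen) (hc : ∀ r, (base r).Countable) :
    ∃ (lt : ι → ι → Prop) (ρ : ι → ℕ → Bool) (D : List (ℕ → Bool) → Set ι),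
      IsWellOrder ι lt ∧
      (∀ l l', cl base l ⊆ cl base l' → D l ⊆ D l') ∧
      (∀ U V, V ∈ D (ρ U :: s U) ↔ V ∈ D (s U) ∨ V = U) ∧
      (∀ U V, U ∈ D (s V) → lt U V) ∧ D [] = ∅ := by
  classical
  -- The order type is an initial ordinal, so each element has fewer than `#ι ≤ 𝔠` predecessors.
  -- This keeps the sets to be avoided small without any assumption on the continuum.
  obtain ⟨lt, wo, hord⟩ := Cardinal.exists_ord_eq ι
  have wf : WellFounded lt := wo.toIsWellFounded.wf
  -- The default is never taken, as `exists_generic` applies at every stage.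
  let pick : List (ℕ → Bool) → Set (ℕ → Bool) → ℕ → Bool := fun l B =>
    if h : ∃ x, x ∉ B ∧ ∀ b ∈ cl base (x :: l), b ∈ B → b ∈ cl base l then h.choose else default
  let ρ : ι → ℕ → Bool := wf.fix fun p rec =>
    pick (s p) (clSet base ({a | ∃ q, ∃ h : lt q p, a ∈ rec q h :: s q} ∪ {a | a ∈ s p}))
  -- `S p` is what is at hand before `ρ p` is chosen, with the bitstrings of `p` itself included;
  -- `S' p` adds `ρ p`.
  let S : ι → Set (ℕ → Bool) := fun p => {a | ∃ q, lt q p ∧ a ∈ ρ q :: s q} ∪ {a | a ∈ s p}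
  let S' : ι → Set (ℕ → Bool) := fun p => S p ∪ {ρ p}
  have hρ : ∀ p, ρ p = pick (s p) (clSet base (S p)) := by
    intro p
    have := wf.fix_eq (C := fun _ => ℕ → Bool) (fun p rec =>
      pick (s p) (clSet base ({a | ∃ q, ∃ h : lt q p, a ∈ rec q h :: s q} ∪ {a | a ∈ s p}))) p
    simp only [S, ← exists_prop]
    exact this
  have hcard : ∀ p, #(clSet base (S p)) < 𝔠 := by
    intro p
    refine (mk_clSet_le hc _).trans_lt (max_lt aleph0_lt_continuum ?_)
    refine (Cardinal.mk_union_le _ _).trans_lt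
      (Cardinal.add_lt_of_lt aleph0_le_continuum ?_ ?_)
    · have hsub : {a | ∃ q, lt q p ∧ a ∈ ρ q :: s q} ⊆
          ⋃ q : {q // lt q p}, {a | a ∈ ρ q.1 :: s q.1} := by
        rintro a ⟨q, hq, ha⟩
        exact Set.mem_iUnion.2 ⟨⟨q, hq⟩, ha⟩
      refine (Cardinal.mk_le_mk_of_subset hsub).trans_lt
        ((Cardinal.mk_iUnion_le _).trans_lt (Cardinal.mul_lt_of_lt aleph0_le_continuum ?_ ?_))
      · have := Cardinal.card_typein_lt p hord
        exact this.trans_le hι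
      · refine lt_of_le_of_lt (ciSup_le' fun q => ?_) aleph0_lt_continuum
        exact (List.finite_toSet (ρ q.1 :: s q.1)).countable.le_aleph0
    · exact (List.finite_toSet (s p)).countable.le_aleph0.trans_lt aleph0_lt_continuum
  have hpick : ∀ p, ρ p ∉ clSet base (S p) ∧
      ∀ b ∈ cl base (ρ p :: s p), b ∈ clSet base (S p) → b ∈ cl base (s p) := by
    intro p
    have h := exists_generic hb hc (s p) (hcard p)
    rw [hρ p]
    simp only [pick, dif_pos h]
    exact h.choose_spec
  have hSS' : ∀ p q, lt p q → S' p ⊆ S q := by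
    rintro p q hpq a ((⟨q', hq', ha⟩ | ha) | ha)
    · exact Or.inl ⟨q', _root_.trans hq' hpq, ha⟩
    · exact Or.inl ⟨p, hpq, List.mem_cons_of_mem _ ha⟩
    · exact Or.inl ⟨p, hpq, by simp [Set.mem_singleton_iff.1 ha]⟩
  have hcS : ∀ p, cl base (s p) ⊆ clSet base (S p) := fun p =>
    cl_subset_clSet fun a ha => Or.inr ha
  have hcS' : ∀ p, cl base (ρ p :: s p) ⊆ clSet base (S' p) := fun p =>
    cl_subset_clSet fun a ha => by
      rcases List.mem_cons.1 ha with rfl | ha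
      · exact Or.inr rfl
      · exact Or.inl (Or.inr ha)
  refine ⟨lt, ρ, fun l => {U | ∃ b ∈ cl base l, b ∈ clSet base (S' U) ∧ b ∉ clSet base (S U)},
    wo, ?_, ?_, ?_, ?_⟩
  · rintro l l' h U ⟨b, hbl, hbU⟩
    exact ⟨b, h hbl, hbU⟩
  · intro U V
    constructor
    · rintro ⟨b, hbl, hbV, hbV'⟩
      rcases wo.toTrichotomous.rel_or_eq_or_rel_swap (a := V) (b := U) with h | h | h
      -- An element that appeared at an earlier stage `V` belongs to the avoided closure, so by
      -- genericity it was generated by `s U` already.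
      · exact Or.inl ⟨b, (hpick U).2 b hbl (clSet_mono (hSS' V U h) hbV), hbV, hbV'⟩
      · exact Or.inr h
      -- Whatever `ρ U :: s U` generates is present by the end of stage `U`, so it cannot first
      -- appear later.
      · exact absurd (clSet_mono (hSS' U V h) (hcS' U hbl)) hbV'
    · rintro (⟨b, hbl, hbV⟩ | rfl)
      · exact ⟨b, cl_mono hb (List.subset_cons_self _ _) hbl, hbV⟩
      · have := mem_cl_of_mem (base := base) (l := ρ V :: s V) (List.mem_cons_self (a := ρ V))
        exact ⟨ρ V, this, hcS' V this, (hpick V).1⟩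
  · rintro U V ⟨b, hbl, hbU, hbU'⟩
    rcases wo.toTrichotomous.rel_or_eq_or_rel_swap (a := U) (b := V) with h | h | h
    · exact h
    · subst h
      exact absurd (hcS U hbl) hbU'
    · refine absurd (clSet_mono ?_ (hcS V hbl)) hbU'
      exact (Set.subset_union_left).trans (hSS' V U h)
  · refine Set.eq_empty_iff_forall_notMem.2 ?_
    rintro U ⟨b, hbl, -, hbU'⟩
    exact hbU' ⟨[], by simp, hbl⟩

end

end CoL

namespace CoL

/-! ## Cirquents with labelled oformulas -/

section Labelled

variable {α : Type*}

open Classical in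
/-- The set of the indices of those members of the list `ns` that belong to `s`. -/
noncomputable def idx (ns : List α) (s : Set α) : Finset ℕ :=
  (Finset.range ns.length).filter fun i => ∃ a ∈ s, ns[i]? = some a

theorem mem_idx {ns : List α} {s : Set α} {i : ℕ} :
    i ∈ idx ns s ↔ ∃ a ∈ s, ns[i]? = some a := by
  simp only [idx, Finset.mem_filter, Finset.mem_range, and_iff_right_iff_imp]
  rintro ⟨a, -, h⟩
  exact (List.getElem?_eq_some_iff.1 h).1

theorem getElem?_append_cons (l r : List α) (a : α) (i : ℕ) :
    (l ++ a :: r)[i]? =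
      if i < l.length then l[i]? else if i = l.length then some a else r[i - l.length - 1]? := by
  split_ifs with h1 h2
  · exact List.getElem?_append_left h1
  · subst h2; simp
  · rw [List.getElem?_append_right (not_lt.1 h1)]
    obtain ⟨k, hk⟩ := Nat.exists_eq_add_of_lt (lt_of_le_of_ne (not_lt.1 h1) (Ne.symm h2))
    subst hk
    have : l.length + k + 1 - l.length = k + 1 := by omega
    simp [this]

/-- The index bookkeeping shared by contraction and by the introduction of disjunctions and
conjunctions: `t` says which of the two new positions belong to the new group, and it only matters
if the replaced label belonged to the old one. -/
theorem splitWith_idx {l r : List α} {a b c : α} {g g' : Set α} {t : Finset ℕ}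
    (hn : ∀ n, n ∈ l ∨ n ∈ r → (n ∈ g' ↔ n ∈ g))
    (ha : a ∈ g → ∀ j, j ∈ t ↔ (j = l.length ∧ b ∈ g') ∨ (j = l.length + 1 ∧ c ∈ g'))
    (hna : a ∉ g → b ∉ g' ∧ c ∉ g') :
    splitWith l.length t (idx (l ++ a :: r) g) = idx (l ++ b :: c :: r) g' := by
  ext j
  simp only [splitWith, Finset.mem_biUnion, mem_idx, getElem?_append_cons l]
  constructor
  · rintro ⟨i, ⟨x, hx, hi⟩, hj⟩
    split_ifs at hi hj with h1 h2
    · rw [Finset.mem_singleton] at hj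
      subst hj
      rw [if_pos h1]
      exact ⟨x, (hn x (Or.inl (List.mem_of_getElem? hi))).2 hx, hi⟩
    · obtain rfl := Option.some.inj hi
      rcases (ha hx j).1 hj with ⟨rfl, hb⟩ | ⟨rfl, hc⟩
      · exact ⟨b, hb, by simp⟩
      · exact ⟨c, hc, by simp⟩
    · rw [Finset.mem_singleton] at hj
      subst hj
      refine ⟨x, (hn x (Or.inr (List.mem_of_getElem? hi))).2 hx, ?_⟩
      rw [if_neg (by omega), if_neg (by omega)]
      have : i + 1 - l.length - 1 = (i - l.length - 1) + 1 := by omega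
      rw [this, List.getElem?_cons_succ, hi]
  · rintro ⟨x, hx, hj⟩
    split_ifs at hj with h1 h2
    · exact ⟨j, ⟨x, (hn x (Or.inl (List.mem_of_getElem? hj))).1 hx, by rw [if_pos h1, hj]⟩,
        by simp [h1]⟩
    · obtain rfl := Option.some.inj hj
      have hag : a ∈ g := by
        by_contra h
        exact (hna h).1 hx
      refine ⟨l.length, ⟨a, hag, by simp⟩, ?_⟩
      simp [ha hag, h2, hx]
    · by_cases h3 : j = l.length + 1
      · subst h3
        have hjc : c = x := by simpa using hj
        subst hjc
        have hag : a ∈ g := by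
          by_contra h
          exact (hna h).2 hx
        refine ⟨l.length, ⟨a, hag, by simp⟩, ?_⟩
        simp [ha hag, hx]
      · have : j - l.length - 1 = (j - 1 - l.length - 1) + 1 := by omega
        rw [this, List.getElem?_cons_succ] at hj
        refine ⟨j - 1, ⟨x, (hn x (Or.inr (List.mem_of_getElem? hj))).1 hx, ?_⟩, ?_⟩
        · rw [if_neg (by omega), if_neg (by omega), hj]
        · rw [if_neg (by omega), if_neg (by omega), Finset.mem_singleton]
          omega

theorem idx_replace {l r : List α} {a b : α} {g : Set α} (h : b ∈ g ↔ a ∈ g) :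
    idx (l ++ b :: r) g = idx (l ++ a :: r) g := by
  ext j
  simp only [mem_idx, getElem?_append_cons l]
  split_ifs with h1 h2
  · rfl
  · simp [h]
  · rfl

theorem idx_replace_insert {l r : List α} {a b : α} {g : Set α} (hb : b ∈ g) :
    idx (l ++ b :: r) g = insert l.length (idx (l ++ a :: r) g) := by
  ext j
  simp only [mem_idx, getElem?_append_cons l, Finset.mem_insert]
  split_ifs with h1 h2
  · simp [h1.ne]
  · simp [hb, h2]
  · simp [h2]

theorem idx_swap (l r : List α) (a b : α) (g : Set α) :
    idx (l ++ b :: a :: r) g =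
      (idx (l ++ a :: b :: r) g).image (Equiv.swap l.length (l.length + 1)) := by
  have key : ∀ j, (l ++ b :: a :: r)[j]? =
      (l ++ a :: b :: r)[Equiv.swap l.length (l.length + 1) j]? := by
    intro j
    rcases lt_trichotomy j l.length with h | h | h
    · rw [Equiv.swap_apply_of_ne_of_ne (by omega) (by omega), List.getElem?_append_left h,
        List.getElem?_append_left h]
    · subst h
      simp
    · by_cases h3 : j = l.length + 1
      · subst h3
        simp
      · rw [Equiv.swap_apply_of_ne_of_ne (by omega) (by omega)]
        obtain ⟨k, rfl⟩ : ∃ k, j = l.length + (k + 2) := ⟨j - l.length - 2, by omega⟩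
        rw [List.getElem?_append_right (by omega), List.getElem?_append_right (by omega),
          show l.length + (k + 2) - l.length = k + 2 by omega]
        rfl
  ext j
  simp only [mem_idx, Finset.mem_image]
  constructor
  · rintro ⟨x, hx, hj⟩
    exact ⟨Equiv.swap l.length (l.length + 1) j, ⟨x, hx, by rw [← key, hj]⟩, by simp⟩
  · rintro ⟨i, ⟨x, hx, hi⟩, rfl⟩
    exact ⟨x, hx, by rw [key]; simpa using hi⟩

theorem idx_congr {ns : List α} {s t : Set α} (h : ∀ n ∈ ns, n ∈ s ↔ n ∈ t) :
    idx ns s = idx ns t := by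
  ext j
  simp only [mem_idx]
  refine exists_congr fun a => ?_
  rw [and_congr_left_iff]
  exact fun hj => h a (List.mem_of_getElem? hj)

variable (fm : α → Formula)

/-- The cirquent whose oformulas and groups are given by a list of labels and by lists of sets of
labels. -/
noncomputable def labelled (ns : List α) (us os : List (Set α)) : Cirquent :=
  ⟨ns.map fm, us.map (idx ns), os.map (idx ns)⟩

/-- The condition on the labels under which a labelled cirquent is valid. -/
structure LabelValid (ns : List α) (us os : List (Set α)) : Prop where
  ns_ne : ns ≠ []
  us_ne : us ≠ []
  os_ne : os ≠ []
  us_group : ∀ s ∈ us, ∃ n ∈ ns, n ∈ s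
  os_group : ∀ s ∈ os, ∃ n ∈ ns, n ∈ s
  covered : ∀ n ∈ ns, (∃ s ∈ us, n ∈ s) ∧ ∃ s ∈ os, n ∈ s

variable {fm}

theorem idx_nonempty {ns : List α} {s : Set α} : (idx ns s).Nonempty ↔ ∃ n ∈ ns, n ∈ s := by
  constructor
  · rintro ⟨i, hi⟩
    obtain ⟨a, ha, hi⟩ := mem_idx.1 hi
    exact ⟨a, List.mem_of_getElem? hi, ha⟩
  · rintro ⟨n, hn, hs⟩
    obtain ⟨i, hi⟩ := List.mem_iff_getElem?.1 hn
    exact ⟨i, mem_idx.2 ⟨n, hs, hi⟩⟩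

theorem lt_of_mem_idx {ns : List α} {s : Set α} {i : ℕ} (h : i ∈ idx ns s) : i < ns.length := by
  obtain ⟨a, -, hi⟩ := mem_idx.1 h
  exact (List.getElem?_eq_some_iff.1 hi).1

theorem labelled_isValid_iff {ns : List α} {us os : List (Set α)} :
    (labelled fm ns us os).IsValid ↔ LabelValid ns us os := by
  constructor
  · intro h
    refine ⟨?_, ?_, ?_, ?_, ?_, ?_⟩
    · rintro rfl; exact h.formulas_ne rfl
    · rintro rfl; exact h.under_ne rfl
    · rintro rfl; exact h.over_ne rfl
    · exact fun s hs => idx_nonempty.1 (h.under_group _ (List.mem_map_of_mem hs)).1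
    · exact fun s hs => idx_nonempty.1 (h.over_group _ (List.mem_map_of_mem hs)).1
    · intro n hn
      obtain ⟨i, hi⟩ := List.mem_iff_getElem?.1 hn
      have hlt := (List.getElem?_eq_some_iff.1 hi).1
      obtain ⟨⟨U, hU, hiU⟩, O, hO, hiO⟩ := h.covered i (by simpa [labelled] using hlt)
      obtain ⟨s, hs, rfl⟩ := List.mem_map.1 hU
      obtain ⟨t, ht, rfl⟩ := List.mem_map.1 hO
      obtain ⟨a, ha, hia⟩ := mem_idx.1 hiU
      obtain ⟨b, hb, hib⟩ := mem_idx.1 hiO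
      rw [hi] at hia hib
      cases hia
      cases hib
      exact ⟨⟨s, hs, ha⟩, t, ht, hb⟩
  · intro h
    refine ⟨?_, ?_, ?_, ?_, ?_, ?_⟩
    · simpa [labelled] using h.ns_ne
    · simpa [labelled] using h.us_ne
    · simpa [labelled] using h.os_ne
    · intro U hU
      obtain ⟨s, hs, rfl⟩ := List.mem_map.1 hU
      exact ⟨idx_nonempty.2 (h.us_group s hs), fun i hi => by simpa [labelled] using lt_of_mem_idx hi⟩
    · intro U hU
      obtain ⟨s, hs, rfl⟩ := List.mem_map.1 hU
      exact ⟨idx_nonempty.2 (h.os_group s hs), fun i hi => by simpa [labelled] using lt_of_mem_idx hi⟩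
    · intro i hi
      have hi' : i < ns.length := by simpa [labelled] using hi
      obtain ⟨⟨s, hs, hs'⟩, t, ht, ht'⟩ := h.covered ns[i] (List.getElem_mem hi')
      exact ⟨⟨_, List.mem_map_of_mem hs, mem_idx.2 ⟨_, hs', by simp [hi']⟩⟩,
        _, List.mem_map_of_mem ht, mem_idx.2 ⟨_, ht', by simp [hi']⟩⟩

theorem Cirquent.Provable.isValid {C : Cirquent} (h : C.Provable) : C.IsValid := by
  cases h <;> assumption

/-- As groups are sets of labels, premise and conclusion can use the same lists `us` and `os`; the
shift of positions is absorbed by `idx`. -/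
theorem provable_of_or {l r : List α} {a b c : α} {us os : List (Set α)}
    (hf : fm a = .or (fm b) (fm c)) (hv : LabelValid (l ++ a :: r) us os)
    (hu : ∀ s ∈ us, (b ∈ s ↔ a ∈ s) ∧ (c ∈ s ↔ a ∈ s))
    (ho : ∀ s ∈ os, (b ∈ s ↔ a ∈ s) ∧ (c ∈ s ↔ a ∈ s))
    (h : (labelled fm (l ++ b :: c :: r) us os).Provable) :
    (labelled fm (l ++ a :: r) us os).Provable := by
  refine .step _ _ (labelled_isValid_iff.2 hv) h ?_
  have hsplit : ∀ s : Set α, (b ∈ s ↔ a ∈ s) ∧ (c ∈ s ↔ a ∈ s) →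
      idx (l ++ b :: c :: r) s =
        splitWith l.length {l.length, l.length + 1} (idx (l ++ a :: r) s) := by
    intro s hs
    refine (splitWith_idx (fun _ _ => Iff.rfl) (fun ha j => ?_) fun ha => ?_).symm
    · simp [hs, ha]
    · simp [hs, ha]
  have e := Rule.orIntro (l.map fm) (r.map fm) (fm b) (fm c) (us.map (idx (l ++ a :: r)))
    (os.map (idx (l ++ a :: r)))
  convert e using 1
  · simp only [labelled, Cirquent.mk.injEq, List.map_append, List.map_cons, List.length_map,
      List.map_map, List.map_inj_left, Function.comp]
    exact ⟨trivial, fun s hs => hsplit s (hu s hs), fun s hs => hsplit s (ho s hs)⟩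
  · simp [labelled, hf]

/-- The labels need not be distinct. In particular `b` and `c` may both be `a`, which is how a spare
copy of a corecurrence is made. -/
theorem provable_of_contract {l r : List α} {a b c : α} {us os : List (Set α)} {E : Formula}
    (hf : fm a = .cost E) (hfb : fm b = .cost E) (hfc : fm c = .cost E)
    (hv : LabelValid (l ++ a :: r) us os)
    (hu : ∀ s ∈ us, (b ∈ s ↔ a ∈ s) ∧ (c ∈ s ↔ a ∈ s))
    (ho : ∀ s ∈ os, (b ∈ s ↔ a ∈ s) ∧ (c ∈ s ↔ a ∈ s))
    (h : (labelled fm (l ++ b :: c :: r) us os).Provable) :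
    (labelled fm (l ++ a :: r) us os).Provable := by
  refine .step _ _ (labelled_isValid_iff.2 hv) h ?_
  have hsplit : ∀ s : Set α, (b ∈ s ↔ a ∈ s) ∧ (c ∈ s ↔ a ∈ s) →
      idx (l ++ b :: c :: r) s =
        splitWith l.length {l.length, l.length + 1} (idx (l ++ a :: r) s) := by
    intro s hs
    refine (splitWith_idx (fun _ _ => Iff.rfl) (fun ha j => ?_) fun ha => ?_).symm
    · simp [hs, ha]
    · simp [hs, ha]
  have e := Rule.contract (l.map fm) (r.map fm) E (us.map (idx (l ++ a :: r)))
    (os.map (idx (l ++ a :: r)))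
  convert e using 1
  · simp only [labelled, Cirquent.mk.injEq, List.map_append, List.map_cons, List.length_map,
      List.map_map, List.map_inj_left, Function.comp, hfb, hfc]
    exact ⟨trivial, fun s hs => hsplit s (hu s hs), fun s hs => hsplit s (ho s hs)⟩
  · simp [labelled, hf]

-- An undergroup containing the conjunction splits into `s₀ s` and `s₁ s`, which have to agree with
-- `s` on the remaining labels only.
open Classical in
theorem provable_of_and {l r : List α} {a b c : α} {us os : List (Set α)} {s₀ s₁ : Set α → Set α}
    (hf : fm a = .and (fm b) (fm c)) (hv : LabelValid (l ++ a :: r) us os)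
    (hu : ∀ s ∈ us, a ∈ s → ((∀ n, n ∈ l ∨ n ∈ r → (n ∈ s₀ s ↔ n ∈ s)) ∧ b ∈ s₀ s ∧ c ∉ s₀ s) ∧
      (∀ n, n ∈ l ∨ n ∈ r → (n ∈ s₁ s ↔ n ∈ s)) ∧ b ∉ s₁ s ∧ c ∈ s₁ s)
    (hu' : ∀ s ∈ us, a ∉ s → b ∉ s ∧ c ∉ s)
    (ho : ∀ s ∈ os, (b ∈ s ↔ a ∈ s) ∧ (c ∈ s ↔ a ∈ s))
    (h : (labelled fm (l ++ b :: c :: r)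
      (us.flatMap fun s => if a ∈ s then [s₀ s, s₁ s] else [s]) os).Provable) :
    (labelled fm (l ++ a :: r) us os).Provable := by
  refine .step _ _ (labelled_isValid_iff.2 hv) h ?_
  have e := Rule.andIntro (l.map fm) (r.map fm) (fm b) (fm c) (us.map (idx (l ++ a :: r)))
    (os.map (idx (l ++ a :: r)))
  have hmem : ∀ s : Set α, l.length ∈ idx (l ++ a :: r) s ↔ a ∈ s := by
    intro s
    simp [mem_idx]
  convert e using 1
  · simp only [labelled, Cirquent.mk.injEq, List.map_append, List.map_cons, List.length_map,
      List.map_map, List.map_inj_left, Function.comp, List.map_flatMap, List.flatMap_map, hmem]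
    refine ⟨trivial, ?_, fun s hs => ?_⟩
    · refine List.flatMap_congr fun s hs => ?_
      split_ifs with ha
      · obtain ⟨⟨h1, h2, h3⟩, h4, h5, h6⟩ := hu s hs ha
        simp only [List.map_cons, List.map_nil]
        congr 1
        · exact (splitWith_idx h1 (fun _ j => by simp [h2, h3]) (fun h => absurd ha h)).symm
        · congr 1
          exact (splitWith_idx h4 (fun _ j => by simp [h5, h6]) (fun h => absurd ha h)).symm
      · simp only [List.map_cons, List.map_nil]
        congr 1
        exact (splitWith_idx (fun _ _ => Iff.rfl) (fun h => absurd h ha) (fun _ => hu' s hs ha)).symm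
    · refine (splitWith_idx (fun _ _ => Iff.rfl) (fun ha j => ?_) fun ha => ?_).symm
      · simp [ho s hs, ha]
      · simp [ho s hs, ha]
  · simp [labelled, hf]

/-- The new overgroup `o` may be any set of labels that meets the current list in `b` alone, since
only its trace on the list becomes a group. -/
theorem provable_of_st {l r : List α} {a b : α} {us os : List (Set α)} {o : Set α}
    (hf : fm a = .st (fm b)) (hv : LabelValid (l ++ a :: r) us os)
    (hu : ∀ s ∈ us, (b ∈ s ↔ a ∈ s)) (ho : ∀ s ∈ os, (b ∈ s ↔ a ∈ s))
    (hbo : b ∈ o) (hno : ∀ n, n ∈ l ∨ n ∈ r → n ∉ o)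
    (h : (labelled fm (l ++ b :: r) us (os ++ [o])).Provable) :
    (labelled fm (l ++ a :: r) us os).Provable := by
  refine .step _ _ (labelled_isValid_iff.2 hv) h ?_
  have e := Rule.stIntro (l.map fm) (r.map fm) (fm b) (us.map (idx (l ++ a :: r)))
    (os.map (idx (l ++ a :: r))) []
  have hidx : idx (l ++ b :: r) o = {l.length} := by
    ext j
    simp only [mem_idx, getElem?_append_cons l, Finset.mem_singleton]
    split_ifs with h1 h2
    · simp only [h1.ne, iff_false, not_exists, not_and]
      exact fun x hx hj => hno x (Or.inl (List.mem_of_getElem? hj)) hx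
    · simp [h2, hbo]
    · simp only [h2, iff_false, not_exists, not_and]
      exact fun x hx hj => hno x (Or.inr (List.mem_of_getElem? hj)) hx
  convert e using 1
  · simp only [labelled, Cirquent.mk.injEq, List.map_append, List.map_cons, List.length_map,
      List.map_nil, hidx]
    refine ⟨trivial, List.map_congr_left fun s hs => idx_replace (hu s hs), ?_⟩
    rw [List.map_congr_left fun s hs => idx_replace (ho s hs)]
  · simp [labelled, hf]

/-- For overgroups an implication suffices, because the rule lets `b` join further existing
overgroups. -/
theorem provable_of_cost {l r : List α} {a b : α} {us os : List (Set α)}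
    (hf : fm a = .cost (fm b)) (hv : LabelValid (l ++ a :: r) us os)
    (hu : ∀ s ∈ us, (b ∈ s ↔ a ∈ s)) (ho : ∀ s ∈ os, a ∈ s → b ∈ s)
    (h : (labelled fm (l ++ b :: r) us os).Provable) :
    (labelled fm (l ++ a :: r) us os).Provable := by
  refine .step _ _ (labelled_isValid_iff.2 hv) h ?_
  have e := Rule.costIntro (l.map fm) (r.map fm) (fm b) (us.map (idx (l ++ a :: r)))
    (os.map (idx (l ++ a :: r))) (os.map (idx (l ++ b :: r))) (by
      rw [List.forall₂_map_left_iff, List.forall₂_map_right_iff, List.forall₂_same]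
      intro s hs
      rw [List.length_map]
      by_cases hb : b ∈ s
      · exact Or.inr (idx_replace_insert hb)
      · exact Or.inl (idx_replace ⟨fun h => absurd h hb, ho s hs⟩))
  convert e using 1
  · simp only [labelled, Cirquent.mk.injEq, List.map_append, List.map_cons, and_true, true_and]
    exact List.map_congr_left fun s hs => idx_replace (hu s hs)
  · simp [labelled, hf]

end Labelled

end CoL

namespace CoL

/-! ### Structural rules -/

theorem Cirquent.IsValid.congr {Fs : List Formula} {Us Us' Os Os' : List (Finset ℕ)}
    (h : Cirquent.IsValid ⟨Fs, Us, Os⟩) (hU : ∀ u, u ∈ Us' ↔ u ∈ Us) (hO : ∀ o, o ∈ Os' ↔ o ∈ Os) :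
    Cirquent.IsValid ⟨Fs, Us', Os'⟩ where
  formulas_ne := h.formulas_ne
  under_ne := by
    obtain ⟨u, hu⟩ := List.exists_mem_of_ne_nil _ h.under_ne
    exact List.ne_nil_of_mem ((hU u).2 hu)
  over_ne := by
    obtain ⟨u, hu⟩ := List.exists_mem_of_ne_nil _ h.over_ne
    exact List.ne_nil_of_mem ((hO u).2 hu)
  under_group u hu := h.under_group u ((hU u).1 hu)
  over_group u hu := h.over_group u ((hO u).1 hu)
  covered i hi := by
    obtain ⟨⟨u, hu, h1⟩, o, ho, h2⟩ := h.covered i hi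
    exact ⟨⟨u, (hU u).2 hu, h1⟩, o, (hO o).2 ho, h2⟩

namespace Cirquent.Provable

variable {Fs : List Formula} {Us Us' Os Os' : List (Finset ℕ)} {A B : Finset ℕ}

theorem perm_under (hp : Us.Perm Us') (h : Provable ⟨Fs, Us, Os⟩) : Provable ⟨Fs, Us', Os⟩ := by
  have aux : ∀ L, Provable ⟨Fs, L ++ Us, Os⟩ → Provable ⟨Fs, L ++ Us', Os⟩ := by
    clear h
    induction hp with
    | nil => exact fun _ h => h
    | cons x _ ih =>
      intro L h
      have := ih (L ++ [x]) (by simpa using h)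
      simpa using this
    | swap x y l =>
      intro L h
      refine .step _ _ (h.isValid.congr (fun u => ?_) fun _ => Iff.rfl) h
        (Rule.exchangeUnder Fs L l Os y x)
      simp only [List.mem_append, List.mem_cons]
      tauto
    | trans _ _ ih1 ih2 => exact fun L h => ih2 L (ih1 L h)
  exact aux [] h

theorem perm_over (hp : Os.Perm Os') (h : Provable ⟨Fs, Us, Os⟩) : Provable ⟨Fs, Us, Os'⟩ := by
  have aux : ∀ L, Provable ⟨Fs, Us, L ++ Os⟩ → Provable ⟨Fs, Us, L ++ Os'⟩ := by
    clear h
    induction hp with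
    | nil => exact fun _ h => h
    | cons x _ ih =>
      intro L h
      have := ih (L ++ [x]) (by simpa using h)
      simpa using this
    | swap x y l =>
      intro L h
      refine .step _ _ (h.isValid.congr (fun _ => Iff.rfl) fun u => ?_) h
        (Rule.exchangeOver Fs Us L l y x)
      simp only [List.mem_append, List.mem_cons]
      tauto
    | trans _ _ ih1 ih2 => exact fun L h => ih2 L (ih1 L h)
  exact aux [] h

theorem duplicate_under (hA : A ∈ Us) (h : Provable ⟨Fs, Us, Os⟩) : Provable ⟨Fs, A :: Us, Os⟩ := by
  have hp := List.perm_cons_erase hA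
  have h1 := h.perm_under hp
  have h2 : Provable ⟨Fs, A :: A :: Us.erase A, Os⟩ := by
    refine .step _ _ (h1.isValid.congr (fun u => ?_) fun _ => Iff.rfl) h1
      (Rule.duplicateUnder Fs [] _ Os A)
    simp
  exact h2.perm_under (List.Perm.cons _ hp.symm)

theorem duplicate_over (hA : A ∈ Os) (h : Provable ⟨Fs, Us, Os⟩) : Provable ⟨Fs, Us, A :: Os⟩ := by
  have hp := List.perm_cons_erase hA
  have h1 := h.perm_over hp
  have h2 : Provable ⟨Fs, Us, A :: A :: Os.erase A⟩ := by
    refine .step _ _ (h1.isValid.congr (fun _ => Iff.rfl) fun u => ?_) h1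
      (Rule.duplicateOver Fs Us [] _ A)
    simp
  exact h2.perm_over (List.Perm.cons _ hp.symm)

theorem merge_head (h : Provable ⟨Fs, Us, A :: B :: Os⟩) : Provable ⟨Fs, Us, (A ∪ B) :: Os⟩ := by
  refine .step _ _ ?_ h (Rule.merge Fs Us [] Os A B)
  have hv := h.isValid
  refine ⟨hv.formulas_ne, hv.under_ne, by simp, hv.under_group, ?_, ?_⟩
  · intro O hO
    have hA := hv.over_group A (by simp)
    have hB := hv.over_group B (by simp)
    rcases List.mem_cons.1 hO with rfl | hO
    · refine ⟨hA.1.mono Finset.subset_union_left, fun i hi => ?_⟩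
      rcases Finset.mem_union.1 hi with hi | hi
      · exact hA.2 i hi
      · exact hB.2 i hi
    · exact hv.over_group O (by simp [hO])
  · intro i hi
    obtain ⟨h1, O, hO, hiO⟩ := hv.covered i hi
    refine ⟨h1, ?_⟩
    simp only [List.mem_cons] at hO
    rcases hO with rfl | rfl | hO
    · exact ⟨_, List.mem_cons_self, Finset.mem_union_left _ hiO⟩
    · exact ⟨_, List.mem_cons_self, Finset.mem_union_right _ hiO⟩
    · exact ⟨O, List.mem_cons_of_mem _ hO, hiO⟩

/-- Merging an overgroup with a larger one reproduces the larger one. -/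
theorem absorb_over (hB : B ∈ Os) (hAB : A ⊆ B) (h : Provable ⟨Fs, Us, A :: Os⟩) :
    Provable ⟨Fs, Us, Os⟩ := by
  have hp := List.perm_cons_erase hB
  have h1 := (h.perm_over (List.Perm.cons A hp)).merge_head
  rw [Finset.union_eq_right.2 hAB] at h1
  exact h1.perm_over hp.symm

/-- Members are duplicated before they are merged, so the original overgroups all stay available. -/
theorem insert_sup_over {S : Finset (Finset ℕ)} (hS : S.Nonempty) (hSO : ∀ A ∈ S, A ∈ Os)
    (h : Provable ⟨Fs, Us, Os⟩) : Provable ⟨Fs, Us, S.sup id :: Os⟩ := by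
  induction hS using Finset.Nonempty.cons_induction with
  | singleton A => simpa using h.duplicate_over (hSO A (by simp))
  | cons A S hA hS ih =>
    have h1 := ih fun B hB => hSO B (by simp [hB])
    have h2 := h1.duplicate_over (A := S.sup id) (by simp)
    have h3 := h2.duplicate_over (A := A) (by simp [hSO A (by simp)])
    have h4 := h3.merge_head.perm_over (List.Perm.swap _ _ _)
    have h5 := h4.absorb_over (B := A ∪ S.sup id) (by simp) Finset.subset_union_right
    simpa using h5

/-- All desired unions are added first; afterwards each original overgroup is absorbed by a union
that contains it. -/
theorem over_of_sups {Ps : List (Finset ℕ)} (h : Provable ⟨Fs, Us, Ps⟩)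
    (hO : ∀ O ∈ Os, ∃ S : Finset (Finset ℕ), S.Nonempty ∧ (∀ A ∈ S, A ∈ Ps) ∧ O = S.sup id)
    (hP : ∀ A ∈ Ps, ∃ O ∈ Os, A ⊆ O) : Provable ⟨Fs, Us, Os⟩ := by
  have h1 : Provable ⟨Fs, Us, Os ++ Ps⟩ := by
    clear hP
    induction Os with
    | nil => exact h
    | cons O Os ih =>
      have h1 := ih fun O hO' => hO O (List.mem_cons_of_mem _ hO')
      obtain ⟨S, hS, hSP, rfl⟩ := hO O List.mem_cons_self
      exact h1.insert_sup_over hS fun A hA => List.mem_append_right _ (hSP A hA)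
  clear h hO
  induction Ps with
  | nil => simpa using h1
  | cons A Ps ih =>
    refine ih (fun B hB => hP B (List.mem_cons_of_mem _ hB)) ?_
    obtain ⟨O, hO, hAO⟩ := hP A List.mem_cons_self
    exact (h1.perm_over List.perm_middle).absorb_over (List.mem_append_left _ hO) hAO

/-- Duplication and exchange adjust multiplicities and order. Without repetitions in `Us`, the list
`Us'` contains it up to order, and the remaining entries are added as duplicates. -/
theorem under_of_mem_iff (h : Provable ⟨Fs, Us, Os⟩) (hnd : Us.Nodup)
    (hU : ∀ u, u ∈ Us' ↔ u ∈ Us) : Provable ⟨Fs, Us', Os⟩ := by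
  have hadd : ∀ ex : List (Finset ℕ), (∀ u ∈ ex, u ∈ Us) → Provable ⟨Fs, ex ++ Us, Os⟩ := by
    intro ex
    induction ex with
    | nil => exact fun _ => h
    | cons u ex ih =>
      intro hex
      exact (ih fun v hv => hex v (List.mem_cons_of_mem _ hv)).duplicate_under
        (List.mem_append_right _ (hex u List.mem_cons_self))
  have hsp : Us.Subperm Us' := List.subperm_of_subset hnd fun u hu => (hU u).2 hu
  have hp : (Us ++ Us'.diff Us).Perm Us' :=
    List.subperm_append_diff_self_of_count_le (List.subperm_ext_iff.1 hsp)
  refine (hadd (Us'.diff Us) fun u hu => ?_).perm_under (List.perm_append_comm.trans hp)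
  exact (hU u).1 (List.diff_subset _ _ hu)

end Cirquent.Provable

section Labelled

variable {α : Type*} {fm : α → Formula}

theorem LabelValid.perm {ns ns' : List α} {us os : List (Set α)} (hp : ns.Perm ns')
    (h : LabelValid ns us os) : LabelValid ns' us os where
  ns_ne := fun e => h.ns_ne (by simpa [e] using hp)
  us_ne := h.us_ne
  os_ne := h.os_ne
  us_group s hs := by simpa [hp.mem_iff] using h.us_group s hs
  os_group s hs := by simpa [hp.mem_iff] using h.os_group s hs
  covered n hn := h.covered n (hp.mem_iff.2 hn)

/-- Exchange of oformulas renumbers positions but leaves the label sets unchanged. -/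
theorem provable_of_perm {ns ns' : List α} {us os : List (Set α)} (hp : ns.Perm ns')
    (h : (labelled fm ns us os).Provable) : (labelled fm ns' us os).Provable := by
  have aux : ∀ l, (labelled fm (l ++ ns) us os).Provable →
      (labelled fm (l ++ ns') us os).Provable := by
    clear h
    induction hp with
    | nil => exact fun _ h => h
    | cons x _ ih =>
      intro l h
      have := ih (l ++ [x]) (by simpa using h)
      simpa using this
    | swap x y r =>
      intro l h
      have hv := (labelled_isValid_iff.1 h.isValid).perm
        (List.Perm.append_left l (List.Perm.swap x y r))
      refine .step _ _ (labelled_isValid_iff.2 hv) h ?_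
      convert Rule.exchangeFormula (l.map fm) (r.map fm) (fm y) (fm x)
        (us.map (idx (l ++ y :: x :: r))) (os.map (idx (l ++ y :: x :: r))) using 1
      · simp [labelled]
      · simp only [labelled, List.map_append, List.map_cons, List.map_map, List.length_map,
          Cirquent.mk.injEq, true_and]
        exact ⟨List.map_congr_left fun s _ => idx_swap l r y x s,
          List.map_congr_left fun s _ => idx_swap l r y x s⟩
    | trans _ _ ih1 ih2 => exact fun l h => ih2 l (ih1 l h)
  exact aux [] h

theorem dropIndex_idx (l r : List α) (k : α) (s : Set α) :
    dropIndex l.length (idx (l ++ k :: r) s) = idx (l ++ r) s := by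
  ext j
  simp only [dropIndex, Finset.mem_image, Finset.mem_erase, mem_idx, getElem?_append_cons l,
    List.getElem?_append]
  constructor
  · rintro ⟨i, ⟨hne, x, hx, hi⟩, rfl⟩
    rw [if_neg hne] at hi
    by_cases h : i < l.length
    · rw [if_pos h] at hi
      rw [if_pos h, if_pos h]
      exact ⟨x, hx, hi⟩
    · rw [if_neg h] at hi
      rw [if_neg h, if_neg (by omega)]
      exact ⟨x, hx, by rw [← hi]; congr 1; omega⟩
  · rintro ⟨x, hx, hj⟩
    by_cases h : j < l.length
    · rw [if_pos h] at hj
      exact ⟨j, ⟨h.ne, x, hx, by rw [if_pos h, hj]⟩, by rw [if_pos h]⟩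
    · rw [if_neg h] at hj
      refine ⟨j + 1, ⟨by omega, x, hx, ?_⟩, ?_⟩
      · rw [if_neg (by omega), if_neg (by omega), ← hj]
        congr 1
        omega
      · rw [if_neg (by omega)]
        omega

theorem erase_idx {l r : List α} {k : α} (hl : k ∉ l) (hr : k ∉ r) (s : Set α) :
    (idx (l ++ k :: r) s).erase l.length = idx (l ++ k :: r) (s \ {k}) := by
  ext j
  simp only [Finset.mem_erase, mem_idx, getElem?_append_cons l, Set.mem_sdiff,
    Set.mem_singleton_iff]
  constructor
  · rintro ⟨hne, x, hx, hj⟩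
    refine ⟨x, ⟨hx, ?_⟩, hj⟩
    rintro rfl
    rw [if_neg hne] at hj
    split_ifs at hj with h
    · exact hl (List.mem_of_getElem? hj)
    · exact hr (List.mem_of_getElem? hj)
  · rintro ⟨x, ⟨hx, hxk⟩, hj⟩
    refine ⟨?_, x, hx, hj⟩
    rintro rfl
    simp at hj
    exact hxk hj.symm

theorem provable_of_weakenArc {l r : List α} {k : α} {L R os : List (Set α)} {u : Set α}
    (hl : k ∉ l) (hr : k ∉ r) (hv : LabelValid (l ++ k :: r) (L ++ u :: R) os) (hk : k ∈ u)
    (hcard : 2 ≤ (idx (l ++ k :: r) u).card) (hex : ∃ v ∈ L ++ R, k ∈ v)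
    (h : (labelled fm (l ++ k :: r) (L ++ (u \ {k}) :: R) os).Provable) :
    (labelled fm (l ++ k :: r) (L ++ u :: R) os).Provable := by
  refine .step _ _ (labelled_isValid_iff.2 hv) h ?_
  have hmem : ∀ s : Set α, k ∈ s → l.length ∈ idx (l ++ k :: r) s := fun s hs =>
    mem_idx.2 ⟨k, hs, by simp⟩
  obtain ⟨v, hv, hkv⟩ := hex
  have e := Rule.weakenArc ((l ++ k :: r).map fm) (L.map (idx (l ++ k :: r)))
    (R.map (idx (l ++ k :: r))) (os.map (idx (l ++ k :: r))) _ l.length (hmem u hk) hcard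
    ⟨_, by rw [← List.map_append]; exact List.mem_map_of_mem hv, hmem v hkv⟩
  rw [erase_idx hl hr] at e
  simpa [labelled] using e

-- The label `k` may stay in the set `u`: once it has left the list of oformulas, it no longer
-- contributes to the group.
open Classical in
theorem provable_of_weakenFormula {l r : List α} {k : α} {L R os : List (Set α)} {u : Set α}
    (hv : LabelValid (l ++ k :: r) (L ++ u :: R) os) (hk : k ∈ u)
    (hcard : 2 ≤ (idx (l ++ k :: r) u).card) (hno : ∀ v ∈ L ++ R, k ∉ v)
    (h : (labelled fm (l ++ r) (L ++ u :: R)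
      (os.filter fun o => ∃ n ∈ l ++ r, n ∈ o)).Provable) :
    (labelled fm (l ++ k :: r) (L ++ u :: R) os).Provable := by
  refine .step _ _ (labelled_isValid_iff.2 hv) h ?_
  have hmem : ∀ s : Set α, l.length ∈ idx (l ++ k :: r) s ↔ k ∈ s := fun s => by simp [mem_idx]
  have e := Rule.weakenFormula ((l ++ k :: r).map fm) (L.map (idx (l ++ k :: r)))
    (R.map (idx (l ++ k :: r))) (os.map (idx (l ++ k :: r))) _ l.length ((hmem u).2 hk) hcard
    (by
      rw [← List.map_append]
      intro V hV
      obtain ⟨v, hv, rfl⟩ := List.mem_map.1 hV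
      exact fun hh => hno v hv ((hmem v).1 hh))
  convert e using 1
  · simp only [labelled, List.map_append, List.map_cons, Cirquent.mk.injEq, List.map_map,
      Function.comp_def, dropIndex_idx, List.filter_map]
    refine ⟨?_, trivial, ?_⟩
    · rw [List.eraseIdx_append_of_length_le (by simp)]
      simp
    · congr 1
      refine List.filter_congr fun o _ => ?_
      rw [decide_eq_decide, ← idx_nonempty, Finset.nonempty_iff_ne_empty]
  · simp [labelled]

end Labelled

end CoL

namespace CoL

/-! ### Reduction of cirquents with paired dual literals to axioms -/

section Labelled

variable {α : Type*} {fm : α → Formula}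

theorem getElem?_flatMap_pair (f : α → α) (bs : List α) (i : ℕ) :
    (bs.flatMap fun b => [f b, b])[2 * i]? = bs[i]?.map f ∧
      (bs.flatMap fun b => [f b, b])[2 * i + 1]? = bs[i]? := by
  induction bs generalizing i with
  | nil => simp
  | cons b bs ih =>
    cases i with
    | zero => simp
    | succ i => simpa [Nat.mul_add] using ih i

theorem idx_flatMap_pair {f : α → α} {bs : List α} (hnd : (bs.flatMap fun b => [f b, b]).Nodup)
    {i : ℕ} {b : α} (hi : bs[i]? = some b) :
    idx (bs.flatMap fun b => [f b, b]) {f b, b} = {2 * i, 2 * i + 1} := by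
  obtain ⟨h1, h2⟩ := getElem?_flatMap_pair f bs i
  rw [hi] at h1 h2
  have inj : ∀ (j k : ℕ) x, (bs.flatMap fun b => [f b, b])[j]? = some x →
      (bs.flatMap fun b => [f b, b])[k]? = some x → k = j := by
    intro j k x hj hk
    exact (List.getElem?_inj (List.getElem?_eq_some_iff.1 hk).1 hnd).1 (hk.trans hj.symm)
  ext j
  simp only [mem_idx, Finset.mem_insert, Finset.mem_singleton, Set.mem_insert_iff,
    Set.mem_singleton_iff]
  constructor
  · rintro ⟨a, rfl | rfl, ha⟩
    · exact Or.inl (inj _ _ _ h1 ha)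
    · exact Or.inr (inj _ _ _ h2 ha)
  · rintro (rfl | rfl)
    · exact ⟨f b, Or.inl rfl, h1⟩
    · exact ⟨b, Or.inr rfl, h2⟩

theorem provable_pairs_axiom {f : α → α} {bs : List α}
    (hnd : (bs.flatMap fun b => [f b, b]).Nodup) (hne : bs ≠ [])
    (hf : ∀ b ∈ bs, fm (f b) = (fm b).neg) :
    (labelled fm (bs.flatMap fun b => [f b, b]) (bs.map fun b => {f b, b})
      (bs.map fun b => {f b, b})).Provable := by
  have hmap : (bs.map fun b => idx (bs.flatMap fun b => [f b, b]) {f b, b}) =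
      (List.range bs.length).map fun i => {2 * i, 2 * i + 1} := by
    apply List.ext_getElem?
    intro i
    rw [List.getElem?_map, List.getElem?_map]
    cases hi : bs[i]? with
    | none =>
      rw [List.getElem?_eq_none (by simpa using hi)]
      rfl
    | some b =>
      have hlt := (List.getElem?_eq_some_iff.1 hi).1
      rw [List.getElem?_range hlt]
      simp only [Option.map_some]
      rw [idx_flatMap_pair hnd hi]
  refine .ax _ (labelled_isValid_iff.2 ?_) ⟨bs.map fm, by simpa using hne, ?_, ?_, ?_⟩
  · have hg : ∀ s ∈ bs.map fun b => ({f b, b} : Set α),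
        ∃ n ∈ bs.flatMap fun b => [f b, b], n ∈ s := by
      intro s hs
      obtain ⟨b, hb, rfl⟩ := List.mem_map.1 hs
      exact ⟨b, List.mem_flatMap.2 ⟨b, hb, by simp⟩, by simp⟩
    have hc : ∀ n ∈ bs.flatMap fun b => [f b, b], ∃ s ∈ bs.map fun b => ({f b, b} : Set α),
        n ∈ s := by
      intro n hn
      obtain ⟨b, hb, hn⟩ := List.mem_flatMap.1 hn
      exact ⟨_, List.mem_map_of_mem hb, by simpa using hn⟩
    refine ⟨?_, by simpa using hne, by simpa using hne, hg, hg, fun n hn => ⟨hc n hn, hc n hn⟩⟩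
    obtain ⟨b, hb⟩ := List.exists_mem_of_ne_nil _ hne
    exact List.ne_nil_of_mem (List.mem_flatMap.2 ⟨b, hb, List.mem_cons_self⟩)
  · simp only [labelled, List.map_flatMap, List.flatMap_map]
    exact List.flatMap_congr fun b hb => by simp [hf b hb]
  · simpa [labelled, Function.comp_def] using hmap
  · simpa [labelled, Function.comp_def] using hmap

variable {pr : α → α → Prop}

/-- A cirquent all of whose undergroups are pairs of dual literals and whose overgroups respect
the pairing. -/
theorem provable_of_exact_pairs (h1 : ∀ a b b', pr a b → pr a b' → b = b')
    (h2 : ∀ a a' b, pr a b → pr a' b → a = a')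
    (hfm : ∀ a b, pr a b → ∃ P, fm a = .natom P ∧ fm b = .atom P)
    {ns : List α} (hnd : ns.Nodup) {us os : List (Set α)} (hv : LabelValid ns us os)
    (hus : ∀ u ∈ us, ∃ a ∈ ns, ∃ b ∈ ns, pr a b ∧ a ∈ u ∧ b ∈ u ∧ ∀ k ∈ ns, k ∈ u → k = a ∨ k = b)
    (hos : ∀ o ∈ os, ∀ a ∈ ns, ∀ b ∈ ns, pr a b → (a ∈ o ↔ b ∈ o)) :
    (labelled fm ns us os).Provable := by
  classical
  -- No unit is the positive member of one pair and the negative member of another.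
  have h3 : ∀ a b c, pr a b → ¬ pr b c := by
    intro a b c hab hbc
    obtain ⟨P, -, hP⟩ := hfm a b hab
    obtain ⟨Q, hQ, -⟩ := hfm b c hbc
    rw [hP] at hQ
    cases hQ
  set bs := ns.filter fun b => ∃ a ∈ ns, pr a b with hbs
  have hf : ∃ f : α → α, ∀ b ∈ bs, f b ∈ ns ∧ pr (f b) b := by
    refine ⟨fun b => if h : ∃ a ∈ ns, pr a b then h.choose else b, fun b hb => ?_⟩
    have h : ∃ a ∈ ns, pr a b := by simpa using (List.mem_filter.1 hb).2
    simp only [dif_pos h]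
    exact h.choose_spec
  obtain ⟨f, hf⟩ := hf
  have hbn : ∀ b ∈ bs, b ∈ ns := fun b hb => (List.mem_filter.1 hb).1
  have hmem : ∀ a ∈ ns, ∀ b ∈ ns, pr a b → b ∈ bs ∧ f b = a := by
    intro a ha b hb hab
    have : b ∈ bs := List.mem_filter.2 ⟨hb, by simpa using ⟨a, ha, hab⟩⟩
    exact ⟨this, h2 _ _ _ (hf b this).2 hab⟩
  set n0 := bs.flatMap fun b => [f b, b] with hn0
  have hne : ∀ b ∈ bs, ∀ b' ∈ bs, f b ≠ b' := by
    intro b hb b' hb' e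
    exact h3 _ _ _ (hf b' hb').2 (e ▸ (hf b hb).2)
  have hnd0 : n0.Nodup := by
    rw [hn0, List.nodup_flatMap]
    refine ⟨fun b hb => by simpa using hne b hb b hb, ?_⟩
    refine List.Pairwise.imp_of_mem ?_ (hnd.filter _ : bs.Nodup)
    intro a b ha hb hab
    simp only [Function.onFun, List.disjoint_cons_left, List.mem_cons, List.not_mem_nil, or_false,
      List.disjoint_nil_left, and_true, not_or]
    refine ⟨⟨fun e => hab (h1 _ _ _ (hf a ha).2 (e ▸ (hf b hb).2)), hne a ha b hb⟩,
      fun e => hne b hb a ha e.symm, hab⟩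
  -- Each oformula is covered by an undergroup and each undergroup is a pair, so the pairs exhaust
  -- the oformulas.
  have hperm : n0.Perm ns := by
    rw [List.perm_ext_iff_of_nodup hnd0 hnd]
    intro n
    rw [hn0, List.mem_flatMap]
    constructor
    · rintro ⟨b, hb, hn⟩
      simp only [List.mem_cons, List.not_mem_nil, or_false] at hn
      rcases hn with rfl | rfl
      · exact (hf b hb).1
      · exact hbn n hb
    · intro hn
      obtain ⟨⟨u, hu, hnu⟩, -⟩ := hv.covered n hn
      obtain ⟨a, ha, b, hb, hab, -, -, hk⟩ := hus u hu
      obtain ⟨hb', rfl⟩ := hmem a ha b hb hab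
      exact ⟨b, hb', by simpa using hk n hn hnu⟩
  have hv0 := hv.perm hperm.symm
  refine provable_of_perm hperm ?_
  have hbne : bs ≠ [] := by
    obtain ⟨n, hn⟩ := List.exists_mem_of_ne_nil _ hv0.ns_ne
    obtain ⟨b, hb, -⟩ := List.mem_flatMap.1 hn
    exact List.ne_nil_of_mem hb
  have hax := provable_pairs_axiom (fm := fm) hnd0 hbne (fun b hb => by
    obtain ⟨P, h, h'⟩ := hfm _ _ (hf b hb).2
    rw [h, h']
    rfl)
  have hidx : ∀ b ∈ bs, ∃ u ∈ us, idx n0 u = idx n0 {f b, b} := by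
    intro b hb
    obtain ⟨⟨u, hu, hnu⟩, -⟩ := hv.covered b (hbn b hb)
    obtain ⟨a, ha, b', hb', hab, hau, hbu, hk⟩ := hus u hu
    obtain rfl | rfl := hk b (hbn b hb) hnu
    · exact absurd hab (h3 _ _ _ (hf b hb).2)
    · obtain ⟨-, rfl⟩ := hmem a ha b hb' hab
      refine ⟨u, hu, idx_congr fun n hn => ⟨fun h => ?_, ?_⟩⟩
      · simpa using hk n (hperm.mem_iff.1 hn) h
      · rintro (rfl | rfl)
        · exact hau
        · exact hbu
  have hidx' : ∀ u ∈ us, ∃ b ∈ bs, idx n0 u = idx n0 {f b, b} := by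
    intro u hu
    obtain ⟨a, ha, b, hb, hab, hau, hbu, hk⟩ := hus u hu
    obtain ⟨hb', rfl⟩ := hmem a ha b hb hab
    refine ⟨b, hb', idx_congr fun n hn => ⟨fun h => ?_, ?_⟩⟩
    · simpa using hk n (hperm.mem_iff.1 hn) h
    · rintro (rfl | rfl)
      · exact hau
      · exact hbu
  unfold labelled at hax ⊢
  simp only [List.map_map] at hax
  -- As index sets, the undergroups are the pairs of the axiom up to order and repetition.
  have hund := hax.under_of_mem_iff (Us' := us.map (idx n0)) ?_ ?_
  · refine hund.over_of_sups ?_ ?_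
    · intro O hO
      obtain ⟨o, ho, rfl⟩ := List.mem_map.1 hO
      have hcl : ∀ b ∈ bs, (f b ∈ o ↔ b ∈ o) := fun b hb =>
        hos o ho _ (hf b hb).1 _ (hbn b hb) (hf b hb).2
      -- An overgroup that separates no pair is the union of the pairs it contains.
      refine ⟨(bs.toFinset.filter (· ∈ o)).image fun b => idx n0 {f b, b}, ?_, ?_, ?_⟩
      · obtain ⟨n, hn, hno⟩ := hv0.os_group o ho
        obtain ⟨b, hb, hnb⟩ := List.mem_flatMap.1 hn
        refine Finset.Nonempty.image ⟨b, ?_⟩ _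
        simp only [Finset.mem_filter, List.mem_toFinset, hb, true_and]
        simp only [List.mem_cons, List.not_mem_nil, or_false] at hnb
        rcases hnb with rfl | rfl
        · exact (hcl b hb).1 hno
        · exact hno
      · intro A hA
        obtain ⟨b, hb, rfl⟩ := Finset.mem_image.1 hA
        exact List.mem_map.2 ⟨b, by simpa using (Finset.mem_filter.1 hb).1, rfl⟩
      · ext j
        simp only [Finset.mem_sup, Finset.mem_image, id, mem_idx, Finset.mem_filter,
          List.mem_toFinset]
        constructor
        · rintro ⟨n, hno, hj⟩
          obtain ⟨b, hb, hnb⟩ := List.mem_flatMap.1 (List.mem_of_getElem? hj)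
          simp only [List.mem_cons, List.not_mem_nil, or_false] at hnb
          refine ⟨_, ⟨b, ⟨hb, ?_⟩, rfl⟩, mem_idx.2 ⟨n, hnb, hj⟩⟩
          rcases hnb with rfl | rfl
          · exact (hcl b hb).1 hno
          · exact hno
        · rintro ⟨_, ⟨b, ⟨hb, hbo⟩, rfl⟩, hj⟩
          obtain ⟨n, hn, hj⟩ := mem_idx.1 hj
          refine ⟨n, ?_, hj⟩
          rcases hn with rfl | rfl
          · exact (hcl b hb).2 hbo
          · exact hbo
    · intro A hA
      obtain ⟨b, hb, rfl⟩ := List.mem_map.1 hA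
      obtain ⟨-, o, ho, hbo⟩ := hv.covered b (hbn b hb)
      refine ⟨_, List.mem_map_of_mem ho, fun j hj => ?_⟩
      obtain ⟨n, hn, hj⟩ := mem_idx.1 hj
      refine mem_idx.2 ⟨n, ?_, hj⟩
      rcases hn with rfl | rfl
      · exact (hos o ho _ (hf b hb).1 _ (hbn b hb) (hf b hb).2).2 hbo
      · exact hbo
  · refine List.Nodup.map_on ?_ (hnd.filter _)
    intro b hb b' hb' e
    have hb0 : b ∈ n0 := List.mem_flatMap.2 ⟨b, hb, by simp⟩
    obtain ⟨j, hj⟩ := List.mem_iff_getElem?.1 hb0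
    have hj' : j ∈ idx n0 {f b, b} := mem_idx.2 ⟨b, by simp, hj⟩
    simp only [Function.comp] at e
    rw [e] at hj'
    obtain ⟨x, hx, hxj⟩ := mem_idx.1 hj'
    rw [hj] at hxj
    cases hxj
    rcases hx with hx | hx
    · exact absurd hx.symm (hne b' hb' b hb)
    · exact hx
  · intro u
    simp only [List.mem_map, Function.comp]
    constructor
    · rintro ⟨s, hs, rfl⟩
      obtain ⟨b, hb, e⟩ := hidx' s hs
      exact ⟨b, hb, e.symm⟩
    · rintro ⟨b, hb, rfl⟩
      exact hidx b hb

/-- Weakening removes every member of an undergroup outside of its chosen pair, so that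
`provable_of_exact_pairs` applies. The number of oformulas plus the total size of the undergroups
decreases at each removal. -/
theorem provable_of_pairs (h1 : ∀ a b b', pr a b → pr a b' → b = b')
    (h2 : ∀ a a' b, pr a b → pr a' b → a = a')
    (hfm : ∀ a b, pr a b → ∃ P, fm a = .natom P ∧ fm b = .atom P)
    {ns : List α} (hnd : ns.Nodup) {us os : List (Set α)} (hv : LabelValid ns us os)
    (hus : ∀ u ∈ us, ∃ a ∈ ns, ∃ b ∈ ns, pr a b ∧ a ∈ u ∧ b ∈ u)
    (hos : ∀ o ∈ os, ∀ a ∈ ns, ∀ b ∈ ns, pr a b → (a ∈ o ↔ b ∈ o)) :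
    (labelled fm ns us os).Provable := by
  classical
  induction hN : ns.length + (us.map fun u => (idx ns u).card).sum using Nat.strong_induction_on
    generalizing ns us os with
  | _ N ih =>
  by_cases hx : ∃ u ∈ us, ∃ k ∈ ns, k ∈ u ∧ ∃ a ∈ ns, ∃ b ∈ ns, pr a b ∧ a ∈ u ∧ b ∈ u ∧
      k ≠ a ∧ k ≠ b
  · obtain ⟨u, hu, k, hk, hku, a, ha, b, hb, hab, hau, hbu, hka, hkb⟩ := hx
    obtain ⟨L, R, rfl⟩ := List.append_of_mem hu
    obtain ⟨l, r, rfl⟩ := List.append_of_mem hk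
    have hlr : k ∉ l ∧ k ∉ r := by
      have := (List.nodup_middle.1 hnd)
      simpa using (List.nodup_cons.1 this).1
    have hmem : ∀ {n}, n ∈ l ++ k :: r → n ≠ k → n ∈ l ++ r := by
      intro n hn hnk
      simpa [hnk] using hn
    have hmem' : ∀ {n}, n ∈ l ++ r → n ∈ l ++ k :: r ∧ n ≠ k := by
      intro n hn
      refine ⟨by simp only [List.mem_append, List.mem_cons] at hn ⊢; tauto, ?_⟩
      rintro rfl
      simp [hlr] at hn
    have hcard : 2 ≤ (idx (l ++ k :: r) u).card := by
      obtain ⟨i, hi⟩ := List.mem_iff_getElem?.1 hk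
      obtain ⟨j, hj⟩ := List.mem_iff_getElem?.1 ha
      refine Finset.one_lt_card.2 ⟨i, mem_idx.2 ⟨k, hku, hi⟩, j, mem_idx.2 ⟨a, hau, hj⟩, ?_⟩
      rintro rfl
      rw [hi] at hj
      exact hka (Option.some.inj hj)
    -- If `k` occurs in another undergroup only the arc is removed; otherwise the oformula
    -- disappears together with the overgroups that become empty.
    by_cases hex : ∃ v ∈ L ++ R, k ∈ v
    · refine provable_of_weakenArc hlr.1 hlr.2 hv hku hcard hex ?_
      refine ih _ ?_ hnd ?_ ?_ hos rfl
      · rw [← hN]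
        have h3 : ((idx (l ++ k :: r) u).erase l.length).card < (idx (l ++ k :: r) u).card :=
          Finset.card_erase_lt_of_mem (mem_idx.2 ⟨k, hku, by simp⟩)
        simp only [List.map_append, List.map_cons, List.sum_append, List.sum_cons]
        rw [← erase_idx hlr.1 hlr.2]
        omega
      · refine ⟨hv.ns_ne, by simp, hv.os_ne, ?_, hv.os_group, ?_⟩
        · intro s hs
          simp only [List.mem_append, List.mem_cons] at hs
          by_cases hsu : s = u \ {k}
          · subst hsu
            exact ⟨a, ha, hau, fun h => hka h.symm⟩
          · exact hv.us_group s (by simp only [List.mem_append, List.mem_cons]; tauto)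
        · intro n hn
          refine ⟨?_, (hv.covered n hn).2⟩
          by_cases hnk : n = k
          · subst hnk
            obtain ⟨v, hv, hnv⟩ := hex
            exact ⟨v, by simp only [List.mem_append, List.mem_cons] at hv ⊢; tauto, hnv⟩
          · obtain ⟨s, hs, hns⟩ := (hv.covered n hn).1
            simp only [List.mem_append, List.mem_cons] at hs
            by_cases hsu : s = u
            · subst hsu
              exact ⟨s \ {k}, by simp, hns, hnk⟩
            · exact ⟨s, by simp only [List.mem_append, List.mem_cons]; tauto, hns⟩
      · intro s hs
        by_cases hsu : s = u \ {k}
        · subst hsu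
          exact ⟨a, ha, b, hb, hab, ⟨hau, fun h => hka h.symm⟩, hbu, fun h => hkb h.symm⟩
        · refine hus s ?_
          simp only [List.mem_append, List.mem_cons] at hs ⊢
          tauto
    · push Not at hex
      refine provable_of_weakenFormula hv hku hcard hex ?_
      have hpair : ∀ s ∈ L ++ u :: R, ∃ a ∈ l ++ r, ∃ b ∈ l ++ r, pr a b ∧ a ∈ s ∧ b ∈ s := by
        intro s hs
        by_cases hsu : s = u
        · subst hsu
          exact ⟨a, hmem ha hka.symm, b, hmem hb hkb.symm, hab, hau, hbu⟩
        · have hks := hex s (by simp only [List.mem_append, List.mem_cons] at hs ⊢; tauto)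
          obtain ⟨a, ha, b, hb, hab, has, hbs⟩ := hus s hs
          exact ⟨a, hmem ha (fun e => hks (e ▸ has)), b, hmem hb (fun e => hks (e ▸ hbs)), hab,
            has, hbs⟩
      refine ih _ ?_ ?_ ?_ hpair ?_ rfl
      · rw [← hN]
        have hle : ((L ++ u :: R).map fun u => (idx (l ++ r) u).card).sum ≤
            ((L ++ u :: R).map fun u => (idx (l ++ k :: r) u).card).sum := by
          refine List.sum_le_sum fun s _ => ?_
          rw [← dropIndex_idx l r k]
          exact Finset.card_image_le.trans Finset.card_erase_le
        have : (l ++ r).length < (l ++ k :: r).length := by simp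
        omega
      · exact (List.nodup_cons.1 (List.nodup_middle.1 hnd)).2
      · refine ⟨List.ne_nil_of_mem (hmem ha hka.symm), by simp, ?_, ?_, ?_, ?_⟩
        · obtain ⟨o, ho, hao⟩ := (hv.covered a ha).2
          exact List.ne_nil_of_mem (List.mem_filter.2 ⟨ho, by
            simpa using ⟨a, by simpa using hmem ha hka.symm, hao⟩⟩)
        · intro s hs
          obtain ⟨a, ha, -, -, -, has, -⟩ := hpair s hs
          exact ⟨a, ha, has⟩
        · intro s hs
          simpa only [decide_eq_true_eq] using (List.mem_filter.1 hs).2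
        · intro n hn
          obtain ⟨h3, o, ho, hno⟩ := hv.covered n (hmem' hn).1
          exact ⟨h3, o, List.mem_filter.2 ⟨ho, by
            simpa only [decide_eq_true_eq] using ⟨n, hn, hno⟩⟩, hno⟩
      · intro o ho a ha b hb
        exact hos o (List.mem_filter.1 ho).1 a (hmem' ha).1 b (hmem' hb).1
  · refine provable_of_exact_pairs h1 h2 hfm hnd hv (fun u hu => ?_) hos
    obtain ⟨a, ha, b, hb, hab, hau, hbu⟩ := hus u hu
    refine ⟨a, ha, b, hb, hab, hau, hbu, fun k hk hku => ?_⟩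
    by_contra hne
    push Not at hne
    exact hx ⟨u, hu, k, hk, hku, a, ha, b, hb, hab, hau, hbu, hne.1, hne.2⟩

end Labelled

end CoL

namespace CoL

/-! ## Paths -/

/-- A step from a unit to one of its subunits: to a component of a conjunction or disjunction, or
to the copy of the body of a (co)recurrence that belongs to an infinite bitstring. -/
inductive Step
  | side (i : Bool)
  | str (x : ℕ → Bool)

/-- A path from a formula to one of its units. -/
abbrev Path := List Step

/-- The formula reached by one step. -/
def Formula.child : Formula → Step → Option Formula
  | .and E G, .side i => some (bif i then G else E)
  | .or E G, .side i => some (bif i then G else E)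
  | .st E, .str _ => some E
  | .cost E, .str _ => some E
  | _, _ => none

/-- The formula reached by a path. -/
def Formula.sub : Formula → Path → Option Formula
  | F, [] => some F
  | F, s :: p => (F.child s).bind fun G => G.sub p

theorem Formula.sub_append (F : Formula) (p q : Path) :
    F.sub (p ++ q) = (F.sub p).bind fun G => G.sub q := by
  induction p generalizing F with
  | nil => rfl
  | cons s p ih => simp [Formula.sub, ih, Option.bind_assoc]

theorem Formula.sub_concat (F : Formula) (p : Path) (s : Step) :
    F.sub (p ++ [s]) = (F.sub p).bind fun G => G.child s := by
  rw [Formula.sub_append]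
  simp [Formula.sub]

/-- At all conjunctions the path goes to the component chosen by `κ`. -/
def Vis (F : Formula) (κ : Path → Bool) (q : Path) : Prop :=
  ∀ p i, p ++ [.side i] <+: q → (∃ E G, F.sub p = some (.and E G)) → i = κ p

/-- At all recurrences the path follows the bitstring chosen by `ρ`. -/
def RCons (F : Formula) (ρ : Path → ℕ → Bool) (q : Path) : Prop :=
  ∀ p x, p ++ [.str x] <+: q → (∃ E, F.sub p = some (.st E)) → x = ρ p

variable {F : Formula}

theorem vis_nil (κ : Path → Bool) : Vis F κ [] := by
  intro p i h
  simp at h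

theorem vis_concat {κ : Path → Bool} {p : Path} {s : Step} :
    Vis F κ (p ++ [s]) ↔
      Vis F κ p ∧ ∀ i, s = .side i → (∃ E G, F.sub p = some (.and E G)) → i = κ p := by
  constructor
  · exact fun h => ⟨fun q i hq => h q i (hq.trans (List.prefix_append _ _)),
      fun i hi => h p i (by rw [hi])⟩
  · rintro ⟨h1, h2⟩ q i hq
    rcases List.prefix_concat_iff.1 hq with hq | hq
    · obtain ⟨rfl, hs⟩ := List.append_inj' hq rfl
      exact h2 i (by simpa using hs.symm)
    · exact h1 q i hq

theorem Vis.mono {κ : Path → Bool} {p q : Path} (h : Vis F κ q) (hpq : p <+: q) : Vis F κ p :=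
  fun r i hr => h r i (hr.trans hpq)

theorem exists_vis (q : Path) : ∃ κ, Vis F κ q := by
  refine ⟨fun p => match q[p.length]? with
    | some (.side i) => i
    | _ => false, fun p i hp _ => ?_⟩
  obtain ⟨t, rfl⟩ := hp
  simp

theorem rcons_nil (ρ : Path → ℕ → Bool) : RCons F ρ [] := by
  intro p i h
  simp at h

theorem rcons_concat {ρ : Path → ℕ → Bool} {p : Path} {s : Step} :
    RCons F ρ (p ++ [s]) ↔
      RCons F ρ p ∧ ∀ x, s = .str x → (∃ E, F.sub p = some (.st E)) → x = ρ p := by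
  constructor
  · exact fun h => ⟨fun q i hq => h q i (hq.trans (List.prefix_append _ _)),
      fun i hi => h p i (by rw [hi])⟩
  · rintro ⟨h1, h2⟩ q i hq
    rcases List.prefix_concat_iff.1 hq with hq | hq
    · obtain ⟨rfl, hs⟩ := List.append_inj' hq rfl
      exact h2 i (by simpa using hs.symm)
    · exact h1 q i hq

theorem RCons.mono {ρ : Path → ℕ → Bool} {p q : Path} (h : RCons F ρ q) (hpq : p <+: q) :
    RCons F ρ p :=
  fun r i hr => h r i (hr.trans hpq)

theorem exists_concat_prefix {α : Type*} {p q : List α} (h : p <+: q) (hne : p ≠ q) :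
    ∃ s, p ++ [s] <+: q := by
  obtain ⟨t, rfl⟩ := h
  cases t with
  | nil => simp at hne
  | cons s t => exact ⟨s, t, by simp⟩

theorem Formula.sub_isSome_of_prefix {p q : Path} {G : Formula} (hq : F.sub q = some G)
    (h : p <+: q) : ∃ E, F.sub p = some E := by
  obtain ⟨t, rfl⟩ := h
  rw [Formula.sub_append] at hq
  obtain ⟨E, hE, -⟩ := Option.bind_eq_some_iff.1 hq
  exact ⟨E, hE⟩

theorem Formula.eq_str_of_st {p q : Path} {s : Step} {E G : Formula} (hq : F.sub q = some G)
    (h : p ++ [s] <+: q) (hp : F.sub p = some (.st E) ∨ F.sub p = some (.cost E)) :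
    ∃ x, s = .str x := by
  obtain ⟨E', hE'⟩ := Formula.sub_isSome_of_prefix hq h
  rw [Formula.sub_concat] at hE'
  rcases hp with hp | hp <;> rw [hp] at hE' <;> cases s <;> simp [Formula.child] at hE' ⊢

theorem Formula.eq_side_of_and {p q : Path} {s : Step} {E E' G : Formula} (hq : F.sub q = some G)
    (h : p ++ [s] <+: q) (hp : F.sub p = some (.and E E') ∨ F.sub p = some (.or E E')) :
    ∃ i, s = .side i := by
  obtain ⟨E', hE'⟩ := Formula.sub_isSome_of_prefix hq h
  rw [Formula.sub_concat] at hE'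
  rcases hp with hp | hp <;> rw [hp] at hE' <;> cases s <;> simp [Formula.child] at hE' ⊢

theorem Formula.not_concat_prefix_of_literal {p q : Path} {s : Step} {G : Formula} {P : ℕ}
    (hq : F.sub q = some G) (hp : F.sub p = some (.atom P) ∨ F.sub p = some (.natom P)) :
    ¬ p ++ [s] <+: q := by
  intro h
  obtain ⟨E', hE'⟩ := Formula.sub_isSome_of_prefix hq h
  rw [Formula.sub_concat] at hE'
  rcases hp with hp | hp <;> rw [hp] at hE' <;> cases s <;> simp [Formula.child] at hE'

/-! ## Derivations from resolved pairs of dual literals -/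

/-- A choice of a bitstring for every recurrence unit, together with a notion of dependence of units
on recurrence units. -/
structure Resolution where
  ρ : Path → ℕ → Bool
  D : Path → Set Path
  lt : Path → Path → Prop
  wf : WellFounded lt
  D_nil : D [] = ∅
  D_side : ∀ p i, D (p ++ [.side i]) = D p
  D_str : ∀ p x, D p ⊆ D (p ++ [.str x])
  D_rho : ∀ p U, U ∈ D (p ++ [.str (ρ p)]) ↔ U ∈ D p ∨ U = p
  lt_of_mem : ∀ U V, U ∈ D V → lt U V

theorem Resolution.D_mono (R : Resolution) {p q : Path} (h : p <+: q) : R.D p ⊆ R.D q := by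
  obtain ⟨t, rfl⟩ := h
  induction t using List.reverseRecOn with
  | nil => simp
  | append_singleton t s ih =>
    rw [← List.append_assoc]
    refine ih.trans ?_
    cases s with
    | side i => rw [R.D_side]
    | str x => exact R.D_str _ _

/-- A path that passes through the recurrence `U` and respects the choice continues with `ρ U`. The
dependence acquired there persists along the path. -/
theorem Resolution.mem_D_of_st (R : Resolution) {U q : Path} {E G : Formula} (hq : F.sub q = some G)
    (hU : F.sub U = some (.st E)) (hc : RCons F R.ρ q) (h : U <+: q) (hne : U ≠ q) : U ∈ R.D q := by
  obtain ⟨s, hs⟩ := exists_concat_prefix h hne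
  obtain ⟨x, rfl⟩ := Formula.eq_str_of_st hq hs (Or.inl hU)
  obtain rfl := hc _ _ hs ⟨E, hU⟩
  exact R.D_mono hs ((R.D_rho _ _).2 (Or.inr rfl))

section Derivation

variable (F) (R : Resolution) (T : Set Path)

/-- The formula of a unit. -/
def fmAt (p : Path) : Formula := (F.sub p).getD (.atom 0)

/-- The state of a bottom-up construction of a derivation: `ns` lists the units in the cirquent, and
`S` lists the recurrence units that have been decomposed. -/
structure Inv (ns S : List Path) : Prop where
  ne : ns ≠ []
  nodup : ns.Nodup
  -- Only a corecurrence may coexist with its descendants, as the spare copy kept by contraction.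
  cost : ∀ p ∈ ns, ∀ q ∈ ns, p <+: q → p ≠ q → ∃ E, F.sub p = some (.cost E)
  st : ∀ U ∈ S, (∃ E, F.sub U = some (.st E)) ∧ ∃ q ∈ ns, U <+: q ∧ U ≠ q
  -- All relevant dependences of present units already have their overgroups.
  dep : ∀ q ∈ ns, ∀ U ∈ T, (∃ E, F.sub U = some (.st E)) → U ∈ R.D q → U ∈ S
  -- Once the construction has entered a unit `c`, every target below `c` can still be reached from,
  -- or has been reached by, some present unit below `c`.
  cover : ∀ q ∈ ns, ∀ c, c <+: q → ∀ t ∈ T, c <+: t → ∃ n ∈ ns, c <+: n ∧ (n <+: t ∨ t <+: n)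
  rcons : ∀ q ∈ ns, RCons F R.ρ q
  sub : ∀ q ∈ ns, ∃ G, F.sub q = some G

/-- Provability of all cirquents whose undergroups consist of the visible units and whose overgroups
consist of the units depending on a decomposed recurrence unit. -/
def PV (ns S : List Path) : Prop :=
  ∀ ks : List (Path → Bool), (∀ κ, ∃ κ' ∈ ks, ∀ n ∈ ns, Vis F κ n ↔ Vis F κ' n) →
    (labelled (fmAt F) ns (ks.map fun κ => {q | Vis F κ q})
      (Set.univ :: S.map fun U => {q | U ∈ R.D q})).Provable

variable {F R T}

theorem fmAt_eq {p : Path} {G : Formula} (h : F.sub p = some G) : fmAt F p = G := by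
  simp [fmAt, h]

/-- By `cover`, a visible target literal has itself or an ancestor in the list, so no undergroup is
empty. A decomposed recurrence retains a proper descendant, so its overgroup is not empty either. -/
theorem Inv.labelValid {ns S : List Path} (h : Inv F R T ns S)
    (hT : ∀ κ, ∃ t ∈ T, (∃ P, F.sub t = some (.atom P)) ∧ Vis F κ t)
    {ks : List (Path → Bool)} (hks : ∀ κ, ∃ κ' ∈ ks, ∀ n ∈ ns, Vis F κ n ↔ Vis F κ' n) :
    LabelValid ns (ks.map fun κ => {q | Vis F κ q})
      (Set.univ :: S.map fun U => {q | U ∈ R.D q}) where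
  ns_ne := h.ne
  us_ne := by
    obtain ⟨κ, hκ, -⟩ := hks fun _ => false
    simpa using List.ne_nil_of_mem hκ
  os_ne := by simp
  us_group := by
    intro s hs
    obtain ⟨κ, -, rfl⟩ := List.mem_map.1 hs
    obtain ⟨t, ht, ⟨P, hP⟩, hv⟩ := hT κ
    obtain ⟨q, hq⟩ := List.exists_mem_of_ne_nil _ h.ne
    obtain ⟨n, hn, -, hnt⟩ := h.cover q hq [] (List.nil_prefix) t ht List.nil_prefix
    refine ⟨n, hn, hv.mono ?_⟩
    rcases hnt with hnt | hnt
    · exact hnt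
    · by_cases e : t = n
      · exact e ▸ List.prefix_rfl
      · obtain ⟨s, hs⟩ := exists_concat_prefix hnt e
        obtain ⟨G, hG⟩ := h.sub n hn
        exact absurd hs (Formula.not_concat_prefix_of_literal hG (Or.inl hP))
  os_group := by
    intro s hs
    rcases List.mem_cons.1 hs with rfl | hs
    · obtain ⟨q, hq⟩ := List.exists_mem_of_ne_nil _ h.ne
      exact ⟨q, hq, trivial⟩
    · obtain ⟨U, hU, rfl⟩ := List.mem_map.1 hs
      obtain ⟨⟨E, hE⟩, q, hq, hUq, hne⟩ := h.st U hU
      obtain ⟨G, hG⟩ := h.sub q hq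
      exact ⟨q, hq, R.mem_D_of_st hG hE (h.rcons q hq) hUq hne⟩
  covered := by
    intro n hn
    obtain ⟨κ, hκ⟩ := exists_vis (F := F) n
    obtain ⟨κ', hκ', hv⟩ := hks κ
    exact ⟨⟨_, List.mem_map_of_mem hκ', (hv n hn).1 hκ⟩, _, List.mem_cons_self, trivial⟩

/-- Preservation of the invariant for all four connectives at once: the subunits `p ++ [s]` with `s
∈ ss` are added, and `p` is dropped unless it is a corecurrence. -/
theorem Inv.expand {ns S ns' S' : List Path} (h : Inv F R T ns S) {p : Path} {ss : Set Step}
    (hp : p ∈ ns) (hne : ss.Nonempty) (hnd : ns'.Nodup)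
    (hmem : ∀ n, n ∈ ns' ↔
      (n ∈ ns ∧ (n = p → ∃ E, F.sub p = some (.cost E))) ∨ ∃ s ∈ ss, n = p ++ [s])
    (hsub : ∀ s ∈ ss, ∃ G, F.sub (p ++ [s]) = some G)
    (hrc : ∀ s ∈ ss, ∀ x, s = .str x → (∃ E, F.sub p = some (.st E)) → x = R.ρ p)
    (hcov : ∀ t ∈ T, ∀ s, p ++ [s] <+: t → s ∈ ss ∨ ∃ E, F.sub p = some (.cost E))
    (hnew : ∀ s ∈ ss, ∀ n ∈ ns, ¬ p ++ [s] <+: n)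
    (hS : ∀ U, U ∈ S' ↔ U ∈ S ∨ (U = p ∧ ∃ E, F.sub p = some (.st E)))
    (hdep : ∀ s ∈ ss, ∀ U ∈ T, (∃ E, F.sub U = some (.st E)) → U ∈ R.D (p ++ [s]) → U ∈ S') :
    Inv F R T ns' S' := by
  have hext : ∀ n ∈ ns, ∃ n' ∈ ns', n <+: n' := by
    intro n hn
    by_cases e : n = p
    · obtain ⟨s, hs⟩ := hne
      exact ⟨p ++ [s], (hmem _).2 (Or.inr ⟨s, hs, rfl⟩), e ▸ List.prefix_append _ _⟩
    · exact ⟨n, (hmem n).2 (Or.inl ⟨hn, fun h => absurd h e⟩), List.prefix_rfl⟩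
  refine ⟨?_, hnd, ?_, ?_, ?_, ?_, ?_, ?_⟩
  · obtain ⟨s, hs⟩ := hne
    exact List.ne_nil_of_mem ((hmem _).2 (Or.inr ⟨s, hs, rfl⟩))
  · intro a ha b hb hab hne'
    rcases (hmem a).1 ha with ⟨ha, hac⟩ | ⟨s, hs, rfl⟩
    · rcases (hmem b).1 hb with ⟨hb, -⟩ | ⟨s, hs, rfl⟩
      · exact h.cost a ha b hb hab hne'
      · rcases List.prefix_concat_iff.1 hab with e | hab
        · exact absurd e hne'
        · by_cases e : a = p
          · rw [e]
            exact hac e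
          · exact h.cost a ha p hp hab e
    · rcases (hmem b).1 hb with ⟨hb, -⟩ | ⟨s', hs', rfl⟩
      · exact absurd hab (hnew s hs b hb)
      · exact absurd (hab.eq_of_length (by simp)) hne'
  · intro U hU
    rcases (hS U).1 hU with hU | ⟨rfl, hU⟩
    · obtain ⟨h1, q, hq, hUq, hne'⟩ := h.st U hU
      obtain ⟨q', hq', hqq⟩ := hext q hq
      refine ⟨h1, q', hq', hUq.trans hqq, ?_⟩
      rintro rfl
      exact hne' (hUq.eq_of_length_le hqq.length_le)
    · obtain ⟨s, hs⟩ := hne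
      exact ⟨hU, U ++ [s], (hmem _).2 (Or.inr ⟨s, hs, rfl⟩), List.prefix_append _ _, by simp⟩
  · intro q hq U hU hst hUq
    rcases (hmem q).1 hq with ⟨hq, -⟩ | ⟨s, hs, rfl⟩
    · exact (hS U).2 (Or.inl (h.dep q hq U hU hst hUq))
    · exact hdep s hs U hU hst hUq
  -- If the covering unit was `p` and has been dropped, a child takes over: the one in the direction
  -- of `t`, or any child when `t` is `p` or an ancestor of it.
  · intro q hq c hc t ht hct
    have old : ∀ q ∈ ns, c <+: q → ∃ n ∈ ns', c <+: n ∧ (n <+: t ∨ t <+: n) := by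
      intro q hq hc
      obtain ⟨n, hn, hcn, hnt⟩ := h.cover q hq c hc t ht hct
      by_cases hn' : n ∈ ns'
      · exact ⟨n, hn', hcn, hnt⟩
      · have hnp : n = p ∧ ¬ ∃ E, F.sub p = some (.cost E) := by
          rw [hmem n] at hn'
          tauto
        obtain ⟨rfl, hcost⟩ := hnp
        by_cases htn : t <+: n
        · obtain ⟨s, hs⟩ := hne
          exact ⟨n ++ [s], (hmem _).2 (Or.inr ⟨s, hs, rfl⟩), hcn.trans (List.prefix_append _ _),
            Or.inr (htn.trans (List.prefix_append _ _))⟩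
        · have hnt := hnt.resolve_right htn
          obtain ⟨s, hs⟩ := exists_concat_prefix hnt (fun e => htn (e ▸ List.prefix_rfl))
          exact ⟨n ++ [s], (hmem _).2 (Or.inr ⟨s, (hcov t ht s hs).resolve_right hcost, rfl⟩),
            hcn.trans (List.prefix_append _ _), Or.inl hs⟩
    rcases (hmem q).1 hq with ⟨hq, -⟩ | ⟨s, hs, rfl⟩
    · exact old q hq hc
    · rcases List.prefix_concat_iff.1 hc with rfl | hc
      · exact ⟨_, hq, List.prefix_rfl, Or.inl hct⟩
      · exact old p hp hc
  · intro q hq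
    rcases (hmem q).1 hq with ⟨hq, -⟩ | ⟨s, hs, rfl⟩
    · exact h.rcons q hq
    · exact rcons_concat.2 ⟨h.rcons p hp, hrc s hs⟩
  · intro q hq
    rcases (hmem q).1 hq with ⟨hq, -⟩ | ⟨s, hs, rfl⟩
    · exact h.sub q hq
    · exact hsub s hs

end Derivation

end CoL

namespace CoL

/-! ### Bottom-up construction of the derivation -/

section Derivation

variable {F : Formula} {R : Resolution} {T : Set Path}

theorem vis_concat_of_ne_and {κ : Path → Bool} {p : Path} {s : Step}
    (h : ∀ E G, F.sub p ≠ some (.and E G)) : Vis F κ (p ++ [s]) ↔ Vis F κ p := by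
  rw [vis_concat, and_iff_left_iff_imp]
  rintro - i - ⟨E, G, hEG⟩
  exact absurd hEG (h E G)

theorem vis_update {κ : Path → Bool} {p q : Path} [DecidableEq Path] (b : Bool)
    (h : ∀ s, ¬ p ++ [s] <+: q) : Vis F (Function.update κ p b) q ↔ Vis F κ q := by
  refine forall_congr' fun r => forall_congr' fun i => imp_congr_right fun hr => ?_
  rw [Function.update_of_ne]
  rintro rfl
  exact h _ hr

theorem PV.of_or {l r S : List Path} {p : Path} {E G : Formula} (h : Inv F R T (l ++ p :: r) S)
    (hT : ∀ κ, ∃ t ∈ T, (∃ P, F.sub t = some (.atom P)) ∧ Vis F κ t)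
    (hp : F.sub p = some (.or E G))
    (hpv : PV F R (l ++ (p ++ [.side false]) :: (p ++ [.side true]) :: r) S) :
    PV F R (l ++ p :: r) S := by
  intro ks hks
  have hvis : ∀ κ i, Vis F κ (p ++ [.side i]) ↔ Vis F κ p := fun κ i =>
    vis_concat_of_ne_and fun E G => by simp [hp]
  refine provable_of_or (b := p ++ [.side false]) (c := p ++ [.side true]) ?_
    (h.labelValid hT hks) ?_ ?_ (hpv ks ?_)
  · rw [fmAt_eq hp, fmAt_eq (G := E), fmAt_eq (G := G)] <;>
      simp [Formula.sub_concat, hp, Formula.child]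
  · intro s hs
    obtain ⟨κ, -, rfl⟩ := List.mem_map.1 hs
    exact ⟨hvis κ _, hvis κ _⟩
  · intro s hs
    rcases List.mem_cons.1 hs with rfl | hs
    · simp
    · obtain ⟨U, -, rfl⟩ := List.mem_map.1 hs
      simp [R.D_side]
  · intro κ
    obtain ⟨κ', hκ', hv⟩ := hks κ
    refine ⟨κ', hκ', fun n hn => ?_⟩
    simp only [List.mem_append, List.mem_cons] at hn hv
    rcases hn with hn | rfl | rfl | hn
    · exact hv n (Or.inl hn)
    · rw [hvis, hvis]
      exact hv p (Or.inr (Or.inl rfl))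
    · rw [hvis, hvis]
      exact hv p (Or.inr (Or.inl rfl))
    · exact hv n (Or.inr (Or.inr hn))

/-- As no other unit depends on `p`, the units depending on it form a singleton overgroup. The
overgroups of other recurrences are not affected, since following `ρ p` adds a dependence on `p`
only. -/
theorem PV.of_st {l r S : List Path} {p : Path} {E : Formula} (h : Inv F R T (l ++ p :: r) S)
    (hT : ∀ κ, ∃ t ∈ T, (∃ P, F.sub t = some (.atom P)) ∧ Vis F κ t)
    (hp : F.sub p = some (.st E)) (hno : ∀ n, n ∈ l ∨ n ∈ r → p ∉ R.D n)
    (hpv : PV F R (l ++ (p ++ [.str (R.ρ p)]) :: r) (S ++ [p])) (hpS : p ∉ S) :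
    PV F R (l ++ p :: r) S := by
  intro ks hks
  have hvis : ∀ κ x, Vis F κ (p ++ [.str x]) ↔ Vis F κ p := fun κ i =>
    vis_concat_of_ne_and fun E G => by simp [hp]
  refine provable_of_st (b := p ++ [.str (R.ρ p)]) (o := {q | p ∈ R.D q}) ?_
    (h.labelValid hT hks) ?_ ?_ ?_ hno ?_
  · rw [fmAt_eq hp, fmAt_eq (G := E)]
    simp [Formula.sub_concat, hp, Formula.child]
  · intro s hs
    obtain ⟨κ, -, rfl⟩ := List.mem_map.1 hs
    exact hvis κ _
  · intro s hs
    rcases List.mem_cons.1 hs with rfl | hs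
    · simp
    · obtain ⟨U, hU, rfl⟩ := List.mem_map.1 hs
      refine (R.D_rho p U).trans (or_iff_left ?_)
      rintro rfl
      exact hpS hU
  · exact (R.D_rho p p).2 (Or.inr rfl)
  · have := hpv ks ?_
    · simpa using this
    · intro κ
      obtain ⟨κ', hκ', hv⟩ := hks κ
      refine ⟨κ', hκ', fun n hn => ?_⟩
      simp only [List.mem_append, List.mem_cons] at hn hv
      rcases hn with hn | rfl | hn
      · exact hv n (Or.inl hn)
      · rw [hvis, hvis]
        exact hv p (Or.inr (Or.inl rfl))
      · exact hv n (Or.inr (Or.inr hn))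

/-- Contraction first leaves a spare copy of `p`, from which further subunits can be taken later.
The other copy becomes the subunit for `x` and joins the existing overgroups of the recurrences on
which it depends. -/
theorem PV.of_cost {l r S : List Path} {p : Path} {E : Formula} {x : ℕ → Bool}
    (h : Inv F R T (l ++ p :: r) S)
    (hT : ∀ κ, ∃ t ∈ T, (∃ P, F.sub t = some (.atom P)) ∧ Vis F κ t)
    (hp : F.sub p = some (.cost E))
    (hpv : PV F R (l ++ p :: (p ++ [.str x]) :: r) S) : PV F R (l ++ p :: r) S := by
  intro ks hks
  have hvis : ∀ κ x, Vis F κ (p ++ [.str x]) ↔ Vis F κ p := fun κ i =>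
    vis_concat_of_ne_and fun E G => by simp [hp]
  have hv := h.labelValid hT hks
  refine provable_of_contract (b := p) (c := p) (E := E) ?_ ?_ ?_ hv ?_ ?_ ?_
  · exact fmAt_eq hp
  · exact fmAt_eq hp
  · exact fmAt_eq hp
  · exact fun s _ => ⟨Iff.rfl, Iff.rfl⟩
  · exact fun s _ => ⟨Iff.rfl, Iff.rfl⟩
  · have hm : ∀ n, n ∈ (l ++ [p]) ++ p :: r ↔ n ∈ l ++ p :: r := by
      intro n
      simp only [List.mem_append, List.mem_cons, List.not_mem_nil, or_false]
      tauto
    have e := provable_of_cost (fm := fmAt F) (l := l ++ [p]) (r := r) (a := p)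
      (b := p ++ [.str x]) (us := ks.map fun κ => {q | Vis F κ q})
      (os := Set.univ :: S.map fun U => {q | U ∈ R.D q}) ?_ ?_ ?_ ?_ ?_
    · simpa using e
    · rw [fmAt_eq hp, fmAt_eq (G := E)]
      simp [Formula.sub_concat, hp, Formula.child]
    · refine ⟨by simp, hv.us_ne, hv.os_ne, ?_, ?_, ?_⟩
      · simpa only [hm] using hv.us_group
      · simpa only [hm] using hv.os_group
      · simpa only [hm] using hv.covered
    · intro s hs
      obtain ⟨κ, -, rfl⟩ := List.mem_map.1 hs
      exact hvis κ _
    · intro s hs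
      rcases List.mem_cons.1 hs with rfl | hs
      · simp
      · obtain ⟨U, hU, rfl⟩ := List.mem_map.1 hs
        exact fun hU => R.D_str p x hU
    · have := hpv ks ?_
      · simpa using this
      · intro κ
        obtain ⟨κ', hκ', hv⟩ := hks κ
        refine ⟨κ', hκ', fun n hn => ?_⟩
        simp only [List.mem_append, List.mem_cons] at hn hv
        rcases hn with hn | rfl | rfl | hn
        · exact hv n (Or.inl hn)
        · exact hv n (Or.inr (Or.inl rfl))
        · rw [hvis, hvis]
          exact hv p (Or.inr (Or.inl rfl))
        · exact hv n (Or.inr (Or.inr hn))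

/-- An undergroup given by a `κ` under which `p` is visible splits into those of the two
modifications of `κ` at `p`. Nothing else lies below `p`, so the visibility of the other units is
unchanged. -/
theorem PV.of_and {l r S : List Path} {p : Path} {E G : Formula} (h : Inv F R T (l ++ p :: r) S)
    (hT : ∀ κ, ∃ t ∈ T, (∃ P, F.sub t = some (.atom P)) ∧ Vis F κ t)
    (hp : F.sub p = some (.and E G)) (hno : ∀ n, n ∈ l ∨ n ∈ r → ∀ s, ¬ p ++ [s] <+: n)
    (hpv : PV F R (l ++ (p ++ [.side false]) :: (p ++ [.side true]) :: r) S) :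
    PV F R (l ++ p :: r) S := by
  classical
  intro ks hks
  have hvis : ∀ κ i, Vis F κ (p ++ [.side i]) ↔ Vis F κ p ∧ i = κ p := by
    intro κ i
    rw [vis_concat]
    refine and_congr_right fun _ => ⟨fun h => h i rfl ⟨E, G, hp⟩, ?_⟩
    rintro rfl j hj -
    cases hj
    rfl
  have hself : ∀ b κ, Vis F (Function.update κ p b) p ↔ Vis F κ p := fun b κ =>
    vis_update b fun s h => by simpa using h.length_le
  have hother : ∀ b κ n, n ∈ l ∨ n ∈ r → (Vis F (Function.update κ p b) n ↔ Vis F κ n) :=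
    fun b κ n hn => vis_update b (hno n hn)
  have hne : ∀ n, n ∈ l ∨ n ∈ r → ∀ s, n ≠ p ++ [s] := fun n hn s e =>
    hno n hn s (e ▸ List.prefix_rfl)
  have hFT : p ++ [Step.side false] ≠ p ++ [Step.side true] := by simp
  refine provable_of_and (b := p ++ [.side false]) (c := p ++ [.side true])
    (s₀ := fun s => insert (p ++ [.side false]) (s \ {p ++ [.side true]}))
    (s₁ := fun s => insert (p ++ [.side true]) (s \ {p ++ [.side false]})) ?_
    (h.labelValid hT hks) ?_ ?_ ?_ ?_
  · rw [fmAt_eq hp, fmAt_eq (G := E), fmAt_eq (G := G)] <;>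
      simp [Formula.sub_concat, hp, Formula.child]
  · intro s _ _
    refine ⟨⟨fun n hn => ?_, by simp, by simp⟩, fun n hn => ?_, by simp, by simp⟩
    · simp [hne n hn]
    · simp [hne n hn]
  · intro s hs hps
    obtain ⟨κ, -, rfl⟩ := List.mem_map.1 hs
    simp only [Set.mem_ofPred_eq] at hps ⊢
    simp [hvis, hps]
  · intro s hs
    rcases List.mem_cons.1 hs with rfl | hs
    · simp
    · obtain ⟨U, -, rfl⟩ := List.mem_map.1 hs
      simp [R.D_side]
  · set ns' := l ++ (p ++ [Step.side false]) :: (p ++ [Step.side true]) :: r with hns'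
    have hpv' := hpv (ks.flatMap fun κ => if Vis F κ p then
      [Function.update κ p false, Function.update κ p true] else [κ]) ?_
    · convert hpv' using 1
      simp only [labelled, Cirquent.mk.injEq, true_and, and_true]
      rw [List.flatMap_map, List.map_flatMap, List.map_flatMap, List.map_flatMap]
      refine List.flatMap_congr fun κ _ => ?_
      simp only [Set.mem_ofPred_eq]
      split_ifs with hκ
      · simp only [List.map_cons, List.map_nil, List.cons.injEq, and_true]
        constructor
        · refine idx_congr fun n hn => ?_
          simp only [hns', List.mem_append, List.mem_cons] at hn
          simp only [Set.mem_insert_iff, Set.mem_sdiff, Set.mem_ofPred_eq, Set.mem_singleton_iff]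
          rcases hn with hn | rfl | rfl | hn
          · simp [hne n (Or.inl hn), hother _ _ n (Or.inl hn)]
          · simp [hvis, hself, hκ]
          · simp [hvis]
          · simp [hne n (Or.inr hn), hother _ _ n (Or.inr hn)]
        · refine idx_congr fun n hn => ?_
          simp only [hns', List.mem_append, List.mem_cons] at hn
          simp only [Set.mem_insert_iff, Set.mem_sdiff, Set.mem_ofPred_eq, Set.mem_singleton_iff]
          rcases hn with hn | rfl | rfl | hn
          · simp [hne n (Or.inl hn), hother _ _ n (Or.inl hn)]
          · simp [hvis]
          · simp [hvis, hself, hκ]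
          · simp [hne n (Or.inr hn), hother _ _ n (Or.inr hn)]
      · rfl
    · intro κ
      obtain ⟨κ', hκ', hv⟩ := hks κ
      simp only [List.mem_append, List.mem_cons] at hv
      have hvp := hv p (Or.inr (Or.inl rfl))
      by_cases hκ : Vis F κ' p
      · refine ⟨Function.update κ' p (κ p), List.mem_flatMap.2 ⟨κ', hκ', ?_⟩, fun n hn => ?_⟩
        · rw [if_pos hκ]
          cases κ p <;> simp
        · simp only [hns', List.mem_append, List.mem_cons] at hn
          rcases hn with hn | rfl | rfl | hn
          · rw [hother _ _ n (Or.inl hn)]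
            exact hv n (Or.inl hn)
          · rw [hvis, hvis, hself, hvp, Function.update_self]
          · rw [hvis, hvis, hself, hvp, Function.update_self]
          · rw [hother _ _ n (Or.inr hn)]
            exact hv n (Or.inr (Or.inr hn))
      · refine ⟨κ', List.mem_flatMap.2 ⟨κ', hκ', ?_⟩, fun n hn => ?_⟩
        · simp [if_neg hκ]
        · simp only [hns', List.mem_append, List.mem_cons] at hn
          rcases hn with hn | rfl | rfl | hn
          · exact hv n (Or.inl hn)
          · simp [hvis, hκ, hvp]
          · simp [hvis, hκ, hvp]
          · exact hv n (Or.inr (Or.inr hn))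

/-- One step of the bottom-up construction towards the unit `t`. -/
theorem Inv.advance {ns S : List Path} (h : Inv F R T ns S)
    (hT : ∀ κ, ∃ t ∈ T, (∃ P, F.sub t = some (.atom P)) ∧ Vis F κ t)
    (hsubT : ∀ t ∈ T, ∃ G, F.sub t = some G) (hrcT : ∀ t ∈ T, RCons F R.ρ t)
    (hpre : ∀ t ∈ T, ∀ c, c <+: t → c ∈ T)
    {t : Path} (ht : t ∈ T) (htn : ∀ n ∈ ns, ¬ t <+: n)
    (hok : ∀ p x, p ++ [.str x] <+: t → (∃ E, F.sub p = some (.cost E)) → ∀ U ∈ T,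
      (∃ E, F.sub U = some (.st E)) → U ∈ R.D (p ++ [.str x]) → U ∈ S)
    (ih : ∀ ns' S', Inv F R T ns' S' → (∀ n ∈ ns, ∃ n' ∈ ns', n <+: n') →
      (∃ c ∈ T, (∀ n ∈ ns, ¬ c <+: n) ∧ ∃ n' ∈ ns', c <+: n') → PV F R ns' S') :
    PV F R ns S := by
  classical
  -- The unit to be decomposed is the longest present one on the way to `t`.
  obtain ⟨p, hp, hpt, hmax⟩ : ∃ p ∈ ns, p <+: t ∧ ∀ n ∈ ns, n <+: t → n.length ≤ p.length := by
    obtain ⟨q, hq⟩ := List.exists_mem_of_ne_nil _ h.ne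
    obtain ⟨n, hn, -, hnt⟩ := h.cover q hq [] List.nil_prefix t ht List.nil_prefix
    obtain ⟨p, hp, hmax⟩ := Finset.exists_max_image (ns.toFinset.filter (· <+: t)) List.length
      ⟨n, by simpa [hn] using hnt.resolve_right (htn n hn)⟩
    simp only [Finset.mem_filter, List.mem_toFinset] at hp hmax
    exact ⟨p, hp.1, hp.2, fun n hn hnt => hmax n ⟨hn, hnt⟩⟩
  obtain ⟨s, hs⟩ := exists_concat_prefix hpt fun e => htn p hp (e ▸ List.prefix_rfl)
  obtain ⟨Gt, hGt⟩ := hsubT t ht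
  have hcT := hpre t ht _ hs
  -- If the next unit had been entered before, `cover` would give a longer present unit on the way
  -- to `t`.
  have hnew : ∀ n ∈ ns, ¬ p ++ [s] <+: n := by
    intro n hn hc
    obtain ⟨n', hn', hcn, hnt⟩ := h.cover n hn _ hc t ht hs
    have := hmax n' hn' (hnt.resolve_right (htn n' hn'))
    have h2 := hcn.length_le
    simp at h2
    omega
  have hchild : ∀ {G}, F.sub p = some G → (∀ E, G ≠ .cost E) → ∀ s', ∀ n ∈ ns,
      ¬ p ++ [s'] <+: n := by
    intro G hG hc s' n hn hpn
    obtain ⟨E, hE⟩ := h.cost p hp n hn ((List.prefix_append _ _).trans hpn) (by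
      rintro rfl
      simpa using hpn.length_le)
    rw [hG] at hE
    exact hc E (Option.some.inj hE)
  obtain ⟨G, hG⟩ := h.sub p hp
  obtain ⟨l, r, rfl⟩ := List.append_of_mem hp
  have hnd := List.nodup_middle.1 h.nodup
  have hlr : p ∉ l ++ r := (List.nodup_cons.1 hnd).1
  have hmid : ∀ n, n ∈ l ++ p :: r ↔ n = p ∨ n ∈ l ++ r := fun n =>
    by simp only [List.mem_append, List.mem_cons]; tauto
  -- the two premises for conjunctions and disjunctions coincide
  have sides : (∃ E E', G = .and E E' ∨ G = .or E E') →
      PV F R (l ++ (p ++ [.side false]) :: (p ++ [.side true]) :: r) S := by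
    rintro ⟨E, E', hEE⟩
    have hncost : ∀ E, G ≠ .cost E := by rcases hEE with rfl | rfl <;> simp
    have hnst : ¬ ∃ E, F.sub p = some (.st E) := by
      rcases hEE with rfl | rfl <;> simp [hG]
    have hmem : ∀ n, n ∈ l ++ (p ++ [Step.side false]) :: (p ++ [Step.side true]) :: r ↔
        (n ∈ l ++ p :: r ∧ (n = p → ∃ E, F.sub p = some (.cost E))) ∨
          ∃ s ∈ {s | ∃ i, s = Step.side i}, n = p ++ [s] := by
      intro n
      have h1 : (∃ E, F.sub p = some (.cost E)) ↔ False := by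
        simp only [hG, Option.some.injEq, iff_false, not_exists]
        exact hncost
      have h2 : (∃ s ∈ {s | ∃ i, s = Step.side i}, n = p ++ [s]) ↔
          n = p ++ [Step.side false] ∨ n = p ++ [Step.side true] := by
        simp
      rw [h1, h2, hmid]
      have : n ∈ l ++ r → n ≠ p := fun hn e => hlr (e ▸ hn)
      simp only [List.mem_append, List.mem_cons] at this ⊢
      tauto
    have hinv : Inv F R T (l ++ (p ++ [.side false]) :: (p ++ [.side true]) :: r) S := by
      refine h.expand (ss := {s | ∃ i, s = Step.side i}) hp ⟨.side false, false, rfl⟩ ?_ hmem ?_ ?_ ?_ ?_ ?_ ?_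
      · have e : (l ++ (p ++ [Step.side false]) :: (p ++ [Step.side true]) :: r).Perm
            ((p ++ [Step.side false]) :: (p ++ [Step.side true]) :: (l ++ r)) :=
          List.perm_middle.trans (List.Perm.cons _ List.perm_middle)
        rw [e.nodup_iff, List.nodup_cons, List.nodup_cons]
        have hh : ∀ i, p ++ [Step.side i] ∉ l ++ r := fun i hi =>
          hchild hG hncost _ _ ((hmid _).2 (Or.inr hi)) List.prefix_rfl
        refine ⟨?_, hh _, (List.nodup_cons.1 hnd).2⟩
        simp only [List.mem_cons, not_or]
        exact ⟨by simp, hh _⟩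
      · rintro s ⟨i, rfl⟩
        rw [Formula.sub_concat, hG]
        rcases hEE with rfl | rfl <;> simp [Formula.child]
      · exact fun _ _ _ _ hst => absurd hst hnst
      · intro t' ht' s' hs'
        obtain ⟨G', hG'⟩ := hsubT t' ht'
        exact Or.inl (Formula.eq_side_of_and hG' hs' (by
          rcases hEE with rfl | rfl
          · exact Or.inl hG
          · exact Or.inr hG))
      · exact fun s' _ => hchild hG hncost s'
      · intro U
        simp [hnst]
      · rintro s ⟨i, rfl⟩ U hU hst hUD
        rw [R.D_side] at hUD
        exact h.dep p hp U hU hst hUD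
    refine ih _ _ hinv ?_ ?_
    · intro n hn
      rcases (hmid n).1 hn with rfl | hn
      · exact ⟨n ++ [.side false], (hmem _).2 (Or.inr ⟨_, ⟨false, rfl⟩, rfl⟩),
          List.prefix_append _ _⟩
      · refine ⟨n, ?_, List.prefix_rfl⟩
        simp only [List.mem_append, List.mem_cons] at hn ⊢
        tauto
    · refine ⟨_, hcT, hnew, p ++ [s], (hmem _).2 (Or.inr ⟨s, ?_, rfl⟩), List.prefix_rfl⟩
      exact Formula.eq_side_of_and hGt hs (by
          rcases hEE with rfl | rfl
          · exact Or.inl hG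
          · exact Or.inr hG)
  cases G with
  | atom P => exact absurd hs (Formula.not_concat_prefix_of_literal hGt (Or.inl hG))
  | natom P => exact absurd hs (Formula.not_concat_prefix_of_literal hGt (Or.inr hG))
  | and E E' =>
    refine PV.of_and h hT hG (fun n hn s' => ?_) (sides ⟨E, E', Or.inl rfl⟩)
    exact hchild hG (by simp) s' n ((hmid n).2 (Or.inr (List.mem_append.2 hn)))
  | or E E' => exact PV.of_or h hT hG (sides ⟨E, E', Or.inr rfl⟩)
  | st E =>
    have hpT : p ∈ T := hpre t ht p hpt
    have hpS : p ∉ S := by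
      intro hpS
      obtain ⟨-, q, hq, hpq, hne⟩ := h.st p hpS
      obtain ⟨s', hs'⟩ := exists_concat_prefix hpq hne
      exact hchild hG (by simp) s' q hq hs'
    obtain ⟨x, rfl⟩ := Formula.eq_str_of_st hGt hs (Or.inl hG)
    obtain rfl := hrcT t ht _ _ hs ⟨E, hG⟩
    -- If another present unit depended on `p`, the invariant would already count `p` as decomposed.
    refine PV.of_st h hT hG (fun n hn hpn => ?_) ?_ hpS
    · exact hpS (h.dep n ((hmid n).2 (Or.inr (List.mem_append.2 hn))) p hpT ⟨E, hG⟩ hpn)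
    have hmem : ∀ n, n ∈ l ++ (p ++ [Step.str (R.ρ p)]) :: r ↔
        (n ∈ l ++ p :: r ∧ (n = p → ∃ E, F.sub p = some (.cost E))) ∨
          ∃ s ∈ ({Step.str (R.ρ p)} : Set Step), n = p ++ [s] := by
      intro n
      have h1 : (∃ E, F.sub p = some (.cost E)) ↔ False := by simp [hG]
      have : n ∈ l ++ r → n ≠ p := fun hn e => hlr (e ▸ hn)
      rw [h1, hmid]
      simp only [List.mem_append, List.mem_cons, Set.mem_singleton_iff, exists_eq_left] at this ⊢
      tauto
    have hinv : Inv F R T (l ++ (p ++ [Step.str (R.ρ p)]) :: r) (S ++ [p]) := by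
      refine h.expand (ss := {Step.str (R.ρ p)}) hp ⟨_, rfl⟩ ?_ hmem ?_ ?_ ?_ ?_ ?_ ?_
      · rw [List.nodup_middle, List.nodup_cons]
        exact ⟨fun hi => hnew _ ((hmid _).2 (Or.inr hi)) List.prefix_rfl,
          (List.nodup_cons.1 hnd).2⟩
      · rintro s rfl
        simp [Formula.sub_concat, hG, Formula.child]
      · rintro s rfl y hy -
        cases hy
        rfl
      · intro t' ht' s' hs'
        obtain ⟨G', hG'⟩ := hsubT t' ht'
        obtain ⟨y, rfl⟩ := Formula.eq_str_of_st hG' hs' (Or.inl hG)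
        obtain rfl := hrcT t' ht' _ _ hs' ⟨E, hG⟩
        exact Or.inl rfl
      · rintro s' rfl
        exact hnew
      · intro U
        simp [hG]
      · rintro s' rfl U hU hst hUD
        rcases (R.D_rho p U).1 hUD with hUD | rfl
        · exact List.mem_append_left _ (h.dep p hp U hU hst hUD)
        · simp
    refine ih _ _ hinv ?_ ?_
    · intro n hn
      rcases (hmid n).1 hn with rfl | hn
      · exact ⟨n ++ [.str (R.ρ n)], by simp, List.prefix_append _ _⟩
      · refine ⟨n, ?_, List.prefix_rfl⟩
        simp only [List.mem_append, List.mem_cons] at hn ⊢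
        tauto
    · exact ⟨_, hcT, hnew, _, by simp, List.prefix_rfl⟩
  | cost E =>
    obtain ⟨x, rfl⟩ := Formula.eq_str_of_st hGt hs (Or.inr hG)
    refine PV.of_cost (x := x) h hT hG ?_
    have hmem : ∀ n, n ∈ l ++ p :: (p ++ [Step.str x]) :: r ↔
        (n ∈ l ++ p :: r ∧ (n = p → ∃ E, F.sub p = some (.cost E))) ∨
          ∃ s ∈ ({Step.str x} : Set Step), n = p ++ [s] := by
      intro n
      have h1 : (∃ E, F.sub p = some (.cost E)) ↔ True := by simp [hG]
      rw [h1]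
      simp only [List.mem_append, List.mem_cons, Set.mem_singleton_iff, exists_eq_left]
      tauto
    have hinv : Inv F R T (l ++ p :: (p ++ [Step.str x]) :: r) S := by
      refine h.expand (ss := {Step.str x}) hp ⟨_, rfl⟩ ?_ hmem ?_ ?_ ?_ ?_ ?_ ?_
      · have e : (l ++ p :: (p ++ [Step.str x]) :: r).Perm
            ((p ++ [Step.str x]) :: (l ++ p :: r)) :=
          (List.Perm.append_left l (List.Perm.swap _ _ r)).trans List.perm_middle
        rw [e.nodup_iff, List.nodup_cons]
        exact ⟨fun hi => hnew _ hi List.prefix_rfl, h.nodup⟩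
      · rintro s rfl
        simp [Formula.sub_concat, hG, Formula.child]
      · rintro s rfl y hy ⟨E', hst⟩
        simp [hG] at hst
      · exact fun _ _ _ _ => Or.inr ⟨E, hG⟩
      · rintro s' rfl
        exact hnew
      · intro U
        simp [hG]
      · rintro s' rfl U hU hst hUD
        exact hok p x hs ⟨E, hG⟩ U hU hst hUD
    refine ih _ _ hinv ?_ ?_
    · intro n hn
      refine ⟨n, ?_, List.prefix_rfl⟩
      rw [hmem]
      exact Or.inl ⟨hn, fun _ => ⟨E, hG⟩⟩
    · exact ⟨_, hcT, hnew, _, by simp, List.prefix_rfl⟩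

/-- A formula is provable if there are finitely many pairs of dual literals, respected by the
dependencies, such that all choices of components of conjunctions leave some pair visible. -/
theorem Formula.provable_of_resolution (R : Resolution) {pr : Path → Path → Prop}
    (hfin : {q | ∃ a, pr a q ∨ pr q a}.Finite)
    (h1 : ∀ a b b', pr a b → pr a b' → b = b') (h2 : ∀ a a' b, pr a b → pr a' b → a = a')
    (hsub : ∀ a b, pr a b → ∃ P, F.sub a = some (.natom P) ∧ F.sub b = some (.atom P))
    (hrc : ∀ a b, pr a b → RCons F R.ρ a ∧ RCons F R.ρ b)
    (hD : ∀ a b, pr a b → R.D a = R.D b)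
    (hκ : ∀ κ, ∃ a b, pr a b ∧ Vis F κ a ∧ Vis F κ b) : F.Provable := by
  classical
  -- The finite tree of all ancestors of the paired literals: the only units that the construction
  -- aims at.
  set T : Set Path := {t | ∃ q ∈ {q | ∃ a, pr a q ∨ pr q a}, t <+: q} with hTdef
  have hTfin : T.Finite := by
    have : T = ⋃ q ∈ {q | ∃ a, pr a q ∨ pr q a}, {t | t ∈ q.inits} := by
      ext t
      simp [hTdef]
    rw [this]
    exact hfin.biUnion fun q _ => List.finite_toSet _
  have hpre : ∀ t ∈ T, ∀ c, c <+: t → c ∈ T := fun t ⟨q, hq, htq⟩ c hc => ⟨q, hq, hc.trans htq⟩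
  have hrcT : ∀ t ∈ T, RCons F R.ρ t := by
    rintro t ⟨q, ⟨a, h | h⟩, htq⟩
    · exact (hrc _ _ h).2.mono htq
    · exact (hrc _ _ h).1.mono htq
  have hlit : ∀ q, (∃ a, pr a q ∨ pr q a) →
      ∃ P, F.sub q = some (.atom P) ∨ F.sub q = some (.natom P) := by
    rintro q ⟨a, h | h⟩
    · obtain ⟨P, -, h⟩ := hsub _ _ h
      exact ⟨P, Or.inl h⟩
    · obtain ⟨P, h, -⟩ := hsub _ _ h
      exact ⟨P, Or.inr h⟩
  have hsubT : ∀ t ∈ T, ∃ G, F.sub t = some G := by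
    rintro t ⟨q, hq, htq⟩
    obtain ⟨P, h | h⟩ := hlit q hq
    · exact Formula.sub_isSome_of_prefix h htq
    · exact Formula.sub_isSome_of_prefix h htq
  have hT : ∀ κ, ∃ t ∈ T, (∃ P, F.sub t = some (.atom P)) ∧ Vis F κ t := by
    intro κ
    obtain ⟨a, b, hab, -, hb⟩ := hκ κ
    obtain ⟨P, -, hP⟩ := hsub a b hab
    exact ⟨b, ⟨b, ⟨a, Or.inl hab⟩, List.prefix_rfl⟩, ⟨P, hP⟩, hb⟩
  have main : ∀ ns S, Inv F R T ns S → PV F R ns S := by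
    intro ns S hinv
    -- The measure is the number of units in the tree that have not yet been entered.
    induction hN : {t ∈ T | ∀ n ∈ ns, ¬ t <+: n}.ncard using Nat.strong_induction_on
      generalizing ns S with
    | _ N ih =>
    have ih' : ∀ ns' S', Inv F R T ns' S' → (∀ n ∈ ns, ∃ n' ∈ ns', n <+: n') →
        (∃ c ∈ T, (∀ n ∈ ns, ¬ c <+: n) ∧ ∃ n' ∈ ns', c <+: n') → PV F R ns' S' := by
      rintro ns' S' hinv' hext ⟨c, hcT, hc, n', hn', hcn'⟩
      refine ih _ ?_ ns' S' hinv' rfl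
      rw [← hN]
      refine Set.ncard_lt_ncard ⟨?_, ?_⟩ (hTfin.subset fun t ht => ht.1)
      · rintro t ⟨htT, ht⟩
        refine ⟨htT, fun n hn htn => ?_⟩
        obtain ⟨n', hn', hnn⟩ := hext n hn
        exact ht n' hn' (htn.trans hnn)
      · intro hsub
        exact (hsub ⟨hcT, hc⟩ : c ∈ T ∧ _).2 n' hn' hcn'
    by_cases hst : ∃ U ∈ T, (∃ E, F.sub U = some (.st E)) ∧ U ∉ S
    · obtain ⟨U, ⟨hUT, ⟨E, hE⟩, hUS⟩, hmin⟩ := R.wf.has_min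
        {U | U ∈ T ∧ (∃ E, F.sub U = some (.st E)) ∧ U ∉ S} hst
      have htT : U ++ [.str (R.ρ U)] ∈ T := by
        obtain ⟨q, hq, hUq⟩ := hUT
        obtain ⟨P, hP⟩ := hlit q hq
        have hne : U ≠ q := by
          rintro rfl
          rcases hP with hP | hP <;> simp [hE] at hP
        obtain ⟨s, hs⟩ := exists_concat_prefix hUq hne
        have hqT : q ∈ T := ⟨q, hq, List.prefix_rfl⟩
        obtain ⟨G, hG⟩ := hsubT q hqT
        obtain ⟨x, rfl⟩ := Formula.eq_str_of_st hG hs (Or.inl hE)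
        obtain rfl := hrcT q hqT _ _ hs ⟨E, hE⟩
        exact ⟨q, hq, hs⟩
      refine hinv.advance hT hsubT hrcT hpre htT ?_ ?_ ih'
      · intro n hn htn
        exact hUS (hinv.dep n hn U hUT ⟨E, hE⟩ (R.D_mono htn ((R.D_rho _ _).2 (Or.inr rfl))))
      · rintro p x hpx ⟨E', hE'⟩ V hVT hVst hVD
        by_contra hVS
        -- A dependence acquired at a corecurrence above `U` is inherited by `U`, hence is on a
        -- smaller recurrence.
        refine hmin V ⟨hVT, hVst, hVS⟩ (R.lt_of_mem V U (R.D_mono ?_ hVD))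
        rcases List.prefix_concat_iff.1 hpx with e | h
        · obtain ⟨rfl, -⟩ := List.append_inj' e rfl
          simp [hE] at hE'
        · exact h
    · push Not at hst
      -- With all recurrences of the tree decomposed, corecurrences cause no obstruction; the
      -- construction proceeds until all paired literals are present.
      by_cases hall : ∀ q, (∃ a, pr a q ∨ pr q a) → q ∈ ns
      · intro ks hks
        refine provable_of_pairs h1 h2 ?_ hinv.nodup (hinv.labelValid hT hks) ?_ ?_
        · intro a b hab
          obtain ⟨P, hP, hP'⟩ := hsub a b hab
          exact ⟨P, fmAt_eq hP, fmAt_eq hP'⟩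
        · intro u hu
          obtain ⟨κ, -, rfl⟩ := List.mem_map.1 hu
          obtain ⟨a, b, hab, ha, hb⟩ := hκ κ
          exact ⟨a, hall a ⟨b, Or.inr hab⟩, b, hall b ⟨a, Or.inl hab⟩, hab, ha, hb⟩
        · intro o ho a _ b _ hab
          rcases List.mem_cons.1 ho with rfl | ho
          · simp
          · obtain ⟨U, -, rfl⟩ := List.mem_map.1 ho
            simp [hD a b hab]
      · push Not at hall
        obtain ⟨q, hq, hqn⟩ := hall
        refine hinv.advance hT hsubT hrcT hpre (t := q) ⟨q, hq, List.prefix_rfl⟩ ?_ ?_ ih'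
        · intro n hn hqn'
          obtain ⟨s, hs⟩ := exists_concat_prefix hqn' (fun e => hqn (e ▸ hn))
          obtain ⟨G, hG⟩ := hinv.sub n hn
          obtain ⟨P, hP⟩ := hlit q hq
          exact Formula.not_concat_prefix_of_literal hG hP hs
        · exact fun _ _ _ _ U hU hUst _ => hst U hU hUst
  have h0 : Inv F R T [[]] [] := by
    refine ⟨by simp, by simp, ?_, by simp, ?_, ?_, ?_, ?_⟩
    · intro p hp q hq _ hne
      simp only [List.mem_singleton] at hp hq
      exact absurd (hp.trans hq.symm) hne
    · intro q hq U _ _ hU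
      simp only [List.mem_singleton] at hq
      simp [hq, R.D_nil] at hU
    · intro q hq c hc t _ _
      simp only [List.mem_singleton] at hq
      subst hq
      exact ⟨[], by simp, hc, Or.inl List.nil_prefix⟩
    · intro q hq
      simp only [List.mem_singleton] at hq
      exact hq ▸ rcons_nil _
    · intro q hq
      simp only [List.mem_singleton] at hq
      exact ⟨F, hq ▸ rfl⟩
  -- The root is visible under every `κ`, so one choice represents all.
  have := main _ _ h0 [fun _ => false] fun κ => ⟨_, List.mem_singleton_self _, fun n hn => by
    simp only [List.mem_singleton] at hn
    simp [hn, vis_nil]⟩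
  unfold Formula.Provable
  convert this using 1
  have e : ∀ s : Set Path, [] ∈ s → idx [([] : Path)] s = {0} := by
    intro s hs
    ext j
    simp only [mem_idx, Finset.mem_singleton]
    cases j <;> simp [hs]
  simp only [labelled, List.map_cons, List.map_nil, Cirquent.mk.injEq, List.cons.injEq, and_true]
  exact ⟨rfl, (e _ (vis_nil _)).symm, (e _ (Set.mem_univ _)).symm⟩

end Derivation

end CoL

namespace CoL

/-! ## Runs -/

theorem Run.take_succ (Γ : Run) (k : ℕ) : Γ.take (k + 1) = Γ.take k ++ (Γ.get? k).toList := by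
  induction k generalizing Γ with
  | zero =>
    cases Γ using Stream'.Seq.recOn with
    | nil => simp
    | cons a s => simp
  | succ k ih =>
    cases Γ using Stream'.Seq.recOn with
    | nil => simp
    | cons a s =>
      rw [Stream'.Seq.take_succ_cons, ih, Stream'.Seq.take_succ_cons, Stream'.Seq.get?_cons_succ]
      rfl

theorem Run.take_prefix_take (Γ : Run) {j k : ℕ} (h : j ≤ k) : Γ.take j <+: Γ.take k := by
  induction k, h using Nat.le_induction with
  | base => exact List.prefix_rfl
  | succ k _ ih => exact ih.trans (Γ.take_succ k ▸ List.prefix_append _ _)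

theorem Run.mem_take {Γ : Run} {k : ℕ} {l : LabMove} :
    l ∈ Γ.take k ↔ ∃ i < k, Γ.get? i = some l := by
  simp only [List.mem_iff_getElem?, Stream'.Seq.getElem?_take]
  refine exists_congr fun i => ?_
  split_ifs with h <;> simp [h]

theorem prefix_of_chain {L : ℕ → Position} (hL : ∀ k, L k <+: L (k + 1)) {j k : ℕ} (h : j ≤ k) :
    L j <+: L k := by
  induction k, h using Nat.le_induction with
  | base => exact List.prefix_rfl
  | succ k _ ih => exact ih.trans (hL k)

open Classical in
-- Later positions extend earlier ones, so the index chosen in the definition of the limit does not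
-- matter.
theorem Run.get?_limit {L : ℕ → Position} (hL : ∀ k, L k <+: L (k + 1)) {n : ℕ} {l : LabMove} :
    (Run.limit L).get? n = some l ↔ ∃ k, (L k)[n]? = some l := by
  change (if h : ∃ k, n < (L k).length then (L h.choose)[n]? else none) = some l ↔ _
  split_ifs with h
  · constructor
    · exact fun h' => ⟨_, h'⟩
    · rintro ⟨k, hk⟩
      have hj := h.choose_spec
      set j := h.choose
      have key : ∀ {a b : ℕ} {l}, a ≤ b → (L a)[n]? = some l → (L b)[n]? = some l := by
        intro a b l hab ha
        obtain ⟨t, ht⟩ := prefix_of_chain hL hab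
        rw [← ht, List.getElem?_append_left (List.getElem?_eq_some_iff.1 ha).1, ha]
      rcases le_total j k with hjk | hjk
      · have := List.getElem?_eq_getElem hj
        rw [key hjk this] at hk
        rw [this, hk]
      · exact key hjk hk
  · simp only [false_iff, not_exists]
    exact fun k hk => h ⟨k, (List.getElem?_eq_some_iff.1 hk).1⟩

theorem Run.contains_limit {L : ℕ → Position} (hL : ∀ k, L k <+: L (k + 1)) {l : LabMove} :
    (Run.limit L).Contains l ↔ ∃ k, l ∈ L k := by
  simp only [Run.Contains, Run.get?_limit hL, List.mem_iff_getElem?]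
  exact exists_comm

theorem Run.filterMap_chain (f : LabMove → Option LabMove) (Γ : Run) (k : ℕ) :
    (Γ.take k).filterMap f <+: (Γ.take (k + 1)).filterMap f := by
  rw [Run.take_succ, List.filterMap_append]
  exact List.prefix_append _ _

theorem Run.contains_filterMap {f : LabMove → Option LabMove} {Γ : Run} {l : LabMove} :
    (Γ.filterMap f).Contains l ↔ ∃ l₀, Γ.Contains l₀ ∧ f l₀ = some l := by
  rw [Run.filterMap, Run.contains_limit (Run.filterMap_chain f Γ)]
  simp only [List.mem_filterMap, Run.mem_take, Run.Contains]
  constructor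
  · rintro ⟨k, l₀, ⟨i, -, hi⟩, h⟩
    exact ⟨l₀, ⟨i, hi⟩, h⟩
  · rintro ⟨l₀, ⟨i, hi⟩, h⟩
    exact ⟨i + 1, l₀, ⟨i, Nat.lt_succ_self i, hi⟩, h⟩

theorem Run.contains_neg {Γ : Run} {l : LabMove} : Γ.neg.Contains l ↔ Γ.Contains l.neg := by
  have hnn : ∀ l : LabMove, l.neg.neg = l := by
    rintro ⟨p, m⟩
    cases p <;> rfl
  simp only [Run.Contains, Run.neg, Stream'.Seq.map_get?, Option.map_eq_some_iff]
  refine exists_congr fun i => ⟨?_, fun h => ⟨_, h, hnn l⟩⟩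
  rintro ⟨l₀, h, rfl⟩
  rw [h, hnn]

/-! ## Legality determined move by move -/

theorem not_illegalBy_of_legal {Legal : Position → Prop} {Γ : Run} (h : ∀ k, Legal (Γ.take k))
    (p : Player) : ¬ IllegalBy Legal p Γ :=
  fun ⟨k, _, _, hk, _⟩ => hk (h (k + 1))

theorem ofLegal_wn_eq_bot_iff {Legal : Position → Prop} {h0 hp} {W : Run → Prop} {Γ : Run}
    (h : ∀ k, Legal (Γ.take k)) : (ConstGame.ofLegal Legal h0 hp W).Wn Γ = .bot ↔ ¬ W Γ := by
  simp [ConstGame.ofLegal, not_illegalBy_of_legal h]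

theorem ofLegal_wn_eq_top_iff {Legal : Position → Prop} {h0 hp} {W : Run → Prop} {Γ : Run}
    (h : ∀ k, Legal (Γ.take k)) : (ConstGame.ofLegal Legal h0 hp W).Wn Γ = .top ↔ W Γ := by
  simp [ConstGame.ofLegal, not_illegalBy_of_legal h]

theorem exists_first_bad {good : LabMove → Prop} {Γ : Run} {i : ℕ} {l : LabMove}
    (hi : Γ.get? i = some l) (hl : ¬ good l) :
    ∃ k m, Γ.get? k = some m ∧ ¬ good m ∧ k ≤ i ∧ ∀ l ∈ Γ.take k, good l := by
  classical
  have hex : ∃ k, ∃ m, Γ.get? k = some m ∧ ¬ good m := ⟨i, l, hi, hl⟩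
  obtain ⟨m, hm, hbad⟩ := Nat.find_spec hex
  refine ⟨Nat.find hex, m, hm, hbad, Nat.find_min' hex ⟨l, hi, hl⟩, fun l' hl' => ?_⟩
  obtain ⟨j, hj, hj'⟩ := Run.mem_take.1 hl'
  by_contra hb
  exact Nat.find_min hex hj ⟨l', hj', hb⟩

theorem illegalBy_of_first_bad {good : LabMove → Prop} {Legal : Position → Prop}
    (hL : ∀ Φ, Legal Φ ↔ ∀ l ∈ Φ, good l) {Γ : Run} {k : ℕ} {m : LabMove}
    (hk : Γ.get? k = some m) (hm : ¬ good m) (h : ∀ l ∈ Γ.take k, good l) :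
    IllegalBy Legal m.1 Γ := by
  refine ⟨k, m.2, (hL _).2 h, fun h' => hm ((hL _).1 h' m ?_), hk⟩
  exact Run.mem_take.2 ⟨k, Nat.lt_succ_self k, hk⟩

/-! ## Games with moves of a fixed form whose winner depends on the set of moves only -/

theorem exists_isNthMove {p : Player} {Γ : Run} {i : ℕ} {m : Move} (h : Γ.get? i = some (p, m)) :
    ∃ n, IsNthMove p n Γ i :=
  ⟨_, ⟨m, h⟩, rfl⟩

theorem filterMap_label (p : Player) (Φ : Position) :
    Φ.filterMap (fun l => if l.1 = p then some l else none) = Φ.filter fun l => l.1 = p := by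
  rw [← List.filterMap_eq_filter]
  congr 1
  funext l
  simp [Option.guard]

theorem IsNthMove.get?_filterMap {p : Player} {n : ℕ} {Γ : Run} {i : ℕ} (h : IsNthMove p n Γ i) :
    (Γ.filterMap fun l => if l.1 = p then some l else none).get? n = Γ.get? i := by
  obtain ⟨⟨m, hm⟩, hn⟩ := h
  rw [hm, Run.filterMap, Run.get?_limit (Run.filterMap_chain _ Γ)]
  refine ⟨i + 1, ?_⟩
  rw [Run.take_succ, hm, List.filterMap_append, filterMap_label, List.getElem?_append_right hn.le,
    hn]
  simp

theorem exists_isNthMove_of_get? {p : Player} {n : ℕ} {Γ : Run} {l : LabMove}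
    (h : (Γ.filterMap fun l => if l.1 = p then some l else none).get? n = some l) :
    ∃ i, IsNthMove p n Γ i ∧ Γ.get? i = some l := by
  rw [Run.filterMap, Run.get?_limit (Run.filterMap_chain _ Γ)] at h
  obtain ⟨k, hk⟩ := h
  induction k with
  | zero => simp at hk
  | succ k ih =>
    rw [Run.take_succ, List.filterMap_append] at hk
    by_cases hlt : n < ((Γ.take k).filterMap fun l => if l.1 = p then some l else none).length
    · rw [List.getElem?_append_left hlt] at hk
      exact ih hk
    · rw [List.getElem?_append_right (not_lt.1 hlt)] at hk
      cases hg : Γ.get? k with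
      | none => simp [hg] at hk
      | some l' =>
        rw [hg] at hk
        by_cases hp : l'.1 = p
        · simp only [Option.toList_some, List.filterMap_cons, if_pos hp, List.filterMap_nil] at hk
          obtain ⟨h0, hl⟩ := List.getElem?_eq_some_iff.1 hk
          simp only [List.length_singleton, Nat.lt_one_iff] at h0
          simp only [h0, List.getElem_cons_zero] at hl
          subst hl
          refine ⟨k, ⟨⟨l'.2, by rw [hg, ← hp]⟩, ?_⟩, hg⟩
          rw [← filterMap_label]
          omega
        · simp [hp] at hk

theorem IsNthMove.le {p : Player} {n : ℕ} {Γ : Run} {i j : ℕ} (hi : IsNthMove p n Γ i)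
    (hj : IsNthMove p n Γ j) : i ≤ j := by
  by_contra hlt
  push Not at hlt
  obtain ⟨⟨m, hm⟩, hn⟩ := hj
  have hpre := (Γ.take_prefix_take hlt).filter (fun l => decide (l.1 = p))
  have := hpre.length_le
  rw [Run.take_succ, hm, List.filter_append, hi.2, List.length_append, hn] at this
  simp at this

theorem IsDelay.contains_iff {p : Player} {Γ Δ : Run} (h : IsDelay p Γ Δ) (l : LabMove) :
    Γ.Contains l ↔ Δ.Contains l := by
  have key : ∀ Γ : Run, Γ.Contains l ↔
      (Γ.filterMap fun l' => if l'.1 = l.1 then some l' else none).Contains l := by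
    intro Γ
    rw [Run.contains_filterMap]
    constructor
    · exact fun h => ⟨l, h, by simp⟩
    · rintro ⟨l₀, h, h'⟩
      split_ifs at h' with hp
      cases h'
      exact h
  rw [key Γ, key Δ, h.1]

/-- The game in which the legal moves are the numerals and `top` wins a legal run iff the set of its
labmoves satisfies `W`. -/
noncomputable def numGame (W : Set LabMove → Prop) : ConstGame :=
  .ofLegal (fun Φ => ∀ l ∈ Φ, ∃ a, l.2 = numeral a) (by simp)
    (fun Φ l h l' hl' => h l' (List.mem_append_left _ hl')) fun Γ => W {l | Γ.Contains l}

/-- If `p` makes the first bad move of `Δ`, then in `Γ` that move is preceded by a bad move of the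
adversary, who is the first offender there. A delay for `p` keeps this precedence, so that the
adversary's bad move comes earlier in `Δ` as well. -/
theorem IsDelay.not_illegalBy {good : LabMove → Prop} {Legal : Position → Prop}
    (hL : ∀ Φ, Legal Φ ↔ ∀ l ∈ Φ, good l) {p : Player} {Γ Δ : Run} (h : IsDelay p Γ Δ)
    (hΓ : ¬ IllegalBy Legal p Γ) : ¬ IllegalBy Legal p Δ := by
  rintro ⟨i', m, hleg, hbad, hm⟩
  have hm' : ¬ good (p, m) := by
    intro hg
    refine hbad ((hL _).2 fun l hl => ?_)
    rw [Run.take_succ, hm] at hl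
    rcases List.mem_append.1 hl with hl | hl
    · exact (hL _).1 hleg l hl
    · simp only [Option.toList_some, List.mem_singleton] at hl
      exact hl ▸ hg
  obtain ⟨n, hn⟩ := exists_isNthMove hm
  have h1 := hn.get?_filterMap
  rw [← h.1 p, hm] at h1
  obtain ⟨i, hi, him⟩ := exists_isNthMove_of_get? h1
  obtain ⟨j, ⟨q, m'⟩, hj, hbadj, hji, hgood⟩ := exists_first_bad him hm'
  have hill := illegalBy_of_first_bad hL hj hbadj hgood
  have hq : q = p.neg := by
    cases q <;> cases p <;> first | rfl | exact absurd hill hΓ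
  subst hq
  have hne : j ≠ i := by
    rintro rfl
    rw [him] at hj
    cases p <;> simp [Player.neg] at hj
  obtain ⟨k, hk⟩ := exists_isNthMove hj
  obtain ⟨i'', j', hi'', hj', hlt⟩ := h.2 n k i j hi hk (lt_of_le_of_ne hji hne)
  have h2 := hj'.get?_filterMap
  rw [← h.1, hk.get?_filterMap, hj] at h2
  exact hbadj ((hL _).1 hleg _ (Run.mem_take.2 ⟨j', hlt.trans_le (hi''.le hn), h2.symm⟩))

/-- A delay preserves the set of labmoves, on which alone the winner of a legal run depends; only
illegal moves need attention. -/
theorem numGame_isStatic (W : Set LabMove → Prop) : (numGame W).IsStatic := by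
  intro p Γ Δ h
  have hL : ∀ Φ, (numGame W).Legal Φ ↔ ∀ l ∈ Φ, (fun l : LabMove => ∃ a, l.2 = numeral a) l :=
    fun Φ => Iff.rfl
  have hill := h.not_illegalBy hL
  refine ⟨hill, fun hw => ?_⟩
  have hpn : ∀ q : Player, q.neg ≠ q := by
    intro q
    cases q <;> simp [Player.neg]
  have hΓ : ¬ IllegalBy (numGame W).Legal p Γ := fun hΓ =>
    hpn p (((numGame W).wn_illegal p Γ hΓ).symm.trans hw)
  -- Either the adversary is the first offender in `Δ` and `p` wins, or both runs consist of legal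
  -- moves.
  by_cases hΔ : IllegalBy (numGame W).Legal p.neg Δ
  · rw [(numGame W).wn_illegal _ _ hΔ]
    cases p <;> rfl
  have hall : ∀ l, Δ.Contains l → ∃ a, l.2 = numeral a := by
    rintro l ⟨i, hi⟩
    by_contra hb
    obtain ⟨j, ⟨q, m⟩, hj, hbad, -, hgood⟩ :=
      exists_first_bad (good := fun l : LabMove => ∃ a, l.2 = numeral a) hi hb
    have := illegalBy_of_first_bad hL hj hbad hgood
    have hq : q = p ∨ q = p.neg := by cases q <;> cases p <;> simp [Player.neg]
    rcases hq with rfl | rfl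
    · exact hill hΓ this
    · exact hΔ this
  have leg : ∀ Γ : Run, (∀ l, Γ.Contains l → ∃ a, l.2 = numeral a) →
      ∀ k, ∀ l ∈ Γ.take k, ∃ a, l.2 = numeral a := by
    intro Γ hΓ k l hl
    obtain ⟨i, -, hi⟩ := Run.mem_take.1 hl
    exact hΓ l ⟨i, hi⟩
  have hset : {l | Γ.Contains l} = {l | Δ.Contains l} := Set.ext fun l => h.contains_iff l
  have lΔ := leg Δ hall
  have lΓ := leg Γ fun l hl => hall l ((h.contains_iff l).1 hl)
  cases p with
  | top =>
    exact (ofLegal_wn_eq_top_iff lΔ).2 (hset ▸ (ofLegal_wn_eq_top_iff lΓ).1 hw)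
  | bot =>
    exact (ofLegal_wn_eq_bot_iff lΔ).2 (hset ▸ (ofLegal_wn_eq_bot_iff lΓ).1 hw)

theorem numGame_wn_congr {W : Set LabMove → Prop} {Γ Δ : Run} (hΓ : (numGame W).LegalRun Γ)
    (hΔ : (numGame W).LegalRun Δ) (h : ∀ l, Γ.Contains l ↔ Δ.Contains l) :
    (numGame W).Wn Γ = (numGame W).Wn Δ := by
  have hset : {l | Γ.Contains l} = {l | Δ.Contains l} := Set.ext h
  cases hw : (numGame W).Wn Δ with
  | top => exact (ofLegal_wn_eq_top_iff hΓ).2 (hset ▸ (ofLegal_wn_eq_top_iff hΔ).1 hw)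
  | bot => exact (ofLegal_wn_eq_bot_iff hΓ).2 (hset ▸ (ofLegal_wn_eq_bot_iff hΔ).1 hw)

/-- The constant enumeration interpretation given by winning conditions on sets of labmoves. -/
noncomputable def numInterpretation (W : ℕ → Set LabMove → Prop) : Interpretation where
  val P _ := numGame (W P)
  isStatic P _ := numGame_isStatic (W P)

theorem numInterpretation_isConstant (W : ℕ → Set LabMove → Prop) :
    (numInterpretation W).IsConstant := fun _ _ _ => rfl

theorem numInterpretation_isEnumeration (W : ℕ → Set LabMove → Prop) :
    (numInterpretation W).IsEnumeration :=
  fun _ _ => ⟨fun _ => Iff.rfl, fun _ _ hΓ hΔ h => numGame_wn_congr hΓ hΔ h⟩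

end CoL

namespace CoL

/-! ## Moves and units -/

theorem readBits_eq_some {m β : Move} {u : List Bool} :
    readBits m = some (u, β) ↔ m = addrSegment u ++ β := by
  constructor
  · intro h
    induction m generalizing u with
    | nil => simp [readBits] at h
    | cons k m ih =>
      cases k with
      | period =>
        simp only [readBits, Option.some.injEq, Prod.mk.injEq] at h
        obtain ⟨rfl, rfl⟩ := h
        rfl
      | other k => simp [readBits] at h
      | digit d =>
        simp only [readBits] at h
        split_ifs at h with h0 h1
        · obtain ⟨⟨v, γ⟩, hr, he⟩ := Option.map_eq_some_iff.1 h
          simp only [Prod.mk.injEq] at he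
          obtain ⟨rfl, rfl⟩ := he
          rw [ih hr, h0]
          rfl
        · obtain ⟨⟨v, γ⟩, hr, he⟩ := Option.map_eq_some_iff.1 h
          simp only [Prod.mk.injEq] at he
          obtain ⟨rfl, rfl⟩ := he
          rw [ih hr, h1]
          rfl
  · rintro rfl
    induction u with
    | nil => rfl
    | cons b u ih =>
      have e : addrSegment (b :: u) ++ β = bitKey b :: (addrSegment u ++ β) := rfl
      rw [e]
      cases b
      · simp [bitKey, readBits, ih]
      · simp [bitKey, readBits, ih]

/-- The period ends the segment, so the segment can be read off in one way only. -/
theorem addrSegment_append_inj {u v : List Bool} {β γ : Move}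
    (h : addrSegment u ++ β = addrSegment v ++ γ) : u = v ∧ β = γ := by
  have h1 := readBits_eq_some.2 h
  rw [readBits_eq_some.2 rfl] at h1
  simpa using h1

theorem component_eq_some {i : Bool} {m β : Move} :
    component i m = some β ↔ m = addrSegment [i] ++ β := by
  unfold component
  split_ifs with h
  · obtain ⟨t, rfl⟩ := h
    simp
  · simp only [false_iff]
    rintro rfl
    exact h (List.prefix_append _ _)

theorem strand_eq_some {x : ℕ → Bool} {m β : Move} :
    strand x m = some β ↔ ∃ u, Pre u x ∧ m = addrSegment u ++ β := by
  unfold strand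
  split
  · rename_i u γ h
    rw [readBits_eq_some] at h
    subst h
    constructor
    · intro h
      split_ifs at h with hu
      cases h
      exact ⟨u, hu, rfl⟩
    · rintro ⟨v, hv, he⟩
      obtain ⟨rfl, rfl⟩ := addrSegment_append_inj he
      exact if_pos hv
  · rename_i h
    simp only [false_iff, not_exists, not_and, reduceCtorEq]
    rintro u - rfl
    rw [readBits_eq_some.2 rfl] at h
    cases h

theorem exists_pre (u : List Bool) : ∃ x, Pre u x :=
  ⟨fun i => u.getD i false, pre_iff.2 fun i c h => by simp [h]⟩

/-- The part of a set of labmoves that belongs to a subunit, with its address removed. -/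
def proj : Step → Set LabMove → Set LabMove
  | .side i, C => {l | (l.1, addrSegment [i] ++ l.2) ∈ C}
  | .str x, C => {l | ∃ u, Pre u x ∧ (l.1, addrSegment u ++ l.2) ∈ C}

/-- The part of a set of labmoves that belongs to a unit, with its address removed. -/
def prs : Path → Set LabMove → Set LabMove
  | [], C => C
  | s :: p, C => prs p (proj s C)

theorem prs_concat (p : Path) (s : Step) (C : Set LabMove) :
    prs (p ++ [s]) C = proj s (prs p C) := by
  induction p generalizing C with
  | nil => rfl
  | cons t p ih => exact ih _

theorem contains_component {i : Bool} {Γ : Run} :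
    {l | (Γ.component i).Contains l} = proj (.side i) {l | Γ.Contains l} := by
  ext ⟨p, β⟩
  simp only [Set.mem_ofPred_eq, proj, Run.component, Run.contains_filterMap, onMove,
    Option.map_eq_some_iff, component_eq_some, Prod.mk.injEq]
  constructor
  · rintro ⟨⟨q, m⟩, h, γ, rfl, rfl, rfl⟩
    exact h
  · exact fun h => ⟨_, h, β, rfl, rfl, rfl⟩

theorem contains_strand {x : ℕ → Bool} {Γ : Run} :
    {l | (Γ.strand x).Contains l} = proj (.str x) {l | Γ.Contains l} := by
  ext ⟨p, β⟩
  simp only [Set.mem_ofPred_eq, proj, Run.strand, Run.contains_filterMap, onMove,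
    Option.map_eq_some_iff, strand_eq_some, Prod.mk.injEq]
  constructor
  · rintro ⟨⟨q, m⟩, h, γ, ⟨u, hu, rfl⟩, rfl, rfl⟩
    exact ⟨u, hu, h⟩
  · exact fun ⟨u, hu, h⟩ => ⟨_, h, β, ⟨u, hu, rfl⟩, rfl, rfl⟩

theorem payload_pair {E G : Formula} {m γ : Move} :
    ((component false m).bind (payload E)).or ((component true m).bind (payload G)) = some γ ↔
      ∃ i β, m = addrSegment [i] ++ β ∧ payload (bif i then G else E) β = some γ := by
  cases h0 : component false m with
  | some β =>
    have hm := component_eq_some.1 h0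
    have h1 : component true m = none := by
      cases h1 : component true m with
      | none => rfl
      | some γ =>
        have := addrSegment_append_inj (hm.symm.trans (component_eq_some.1 h1))
        simp at this
    simp only [h1, Option.bind_some, Option.bind_none, Option.or_none]
    constructor
    · exact fun h => ⟨false, β, hm, h⟩
    · rintro ⟨i, β', hm', h⟩
      have := addrSegment_append_inj (hm.symm.trans hm')
      simp only [List.cons.injEq, and_true] at this
      obtain ⟨rfl, rfl⟩ := this
      exact h
  | none =>
    simp only [Option.bind_none, Option.none_or, Option.bind_eq_some_iff, component_eq_some]
    constructor
    · rintro ⟨β, hm, h⟩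
      exact ⟨true, β, hm, h⟩
    · rintro ⟨i, β, hm, h⟩
      cases i with
      | false =>
        rw [component_eq_some.2 hm] at h0
        cases h0
      | true => exact ⟨β, hm, h⟩

theorem payload_and {E G : Formula} {m γ : Move} : payload (.and E G) m = some γ ↔
    ∃ i β, m = addrSegment [i] ++ β ∧ payload (bif i then G else E) β = some γ := payload_pair

theorem payload_or {E G : Formula} {m γ : Move} : payload (.or E G) m = some γ ↔
    ∃ i β, m = addrSegment [i] ++ β ∧ payload (bif i then G else E) β = some γ := payload_pair

theorem payload_bits {E : Formula} {m γ : Move} :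
    ((readBits m).bind fun r => payload E r.2) = some γ ↔
      ∃ u β, m = addrSegment u ++ β ∧ payload E β = some γ := by
  simp only [Option.bind_eq_some_iff, Prod.exists, readBits_eq_some]

theorem payload_st {E : Formula} {m γ : Move} : payload (.st E) m = some γ ↔
    ∃ u β, m = addrSegment u ++ β ∧ payload E β = some γ := payload_bits

theorem payload_cost {E : Formula} {m γ : Move} : payload (.cost E) m = some γ ↔
    ∃ u β, m = addrSegment u ++ β ∧ payload E β = some γ := payload_bits

/-- The moves that consist of an address of a literal of `F` and a numeral. -/
def NumericMove (F : Formula) (m : Move) : Prop := ∃ a, payload F m = some (numeral a)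

theorem parLegal_iff {A B : ConstGame} {E G : Formula}
    (hA : ∀ Φ, A.Legal Φ ↔ ∀ l ∈ Φ, NumericMove E l.2)
    (hB : ∀ Φ, B.Legal Φ ↔ ∀ l ∈ Φ, NumericMove G l.2) (Φ : Position) :
    parLegal A B Φ ↔ ∀ l ∈ Φ, ∃ a i β, l.2 = addrSegment [i] ++ β ∧
      payload (bif i then G else E) β = some (numeral a) := by
  simp only [parLegal, hA, hB, List.mem_filterMap, onMove, Option.map_eq_some_iff,
    component_eq_some, Option.isSome_iff_exists]
  constructor
  · rintro ⟨h, h0, h1⟩ l hl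
    rcases h l hl with ⟨β, hβ⟩ | ⟨β, hβ⟩
    · obtain ⟨a, ha⟩ := h0 (l.1, β) ⟨l, hl, β, hβ, rfl⟩
      exact ⟨a, false, β, hβ, ha⟩
    · obtain ⟨a, ha⟩ := h1 (l.1, β) ⟨l, hl, β, hβ, rfl⟩
      exact ⟨a, true, β, hβ, ha⟩
  · intro h
    refine ⟨fun l hl => ?_, ?_, ?_⟩
    · obtain ⟨a, i, β, hβ, -⟩ := h l hl
      cases i
      · exact Or.inl ⟨β, hβ⟩
      · exact Or.inr ⟨β, hβ⟩
    · rintro _ ⟨l, hl, β, hβ, rfl⟩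
      obtain ⟨a, i, β', hβ', ha⟩ := h l hl
      obtain ⟨hi, rfl⟩ := addrSegment_append_inj (hβ.symm.trans hβ')
      simp only [List.cons.injEq, and_true] at hi
      subst hi
      exact ⟨a, ha⟩
    · rintro _ ⟨l, hl, β, hβ, rfl⟩
      obtain ⟨a, i, β', hβ', ha⟩ := h l hl
      obtain ⟨hi, rfl⟩ := addrSegment_append_inj (hβ.symm.trans hβ')
      simp only [List.cons.injEq, and_true] at hi
      subst hi
      exact ⟨a, ha⟩

/-- Every finite bitstring lies on some infinite one, so legality along all of these amounts to a
condition on each move separately. -/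
theorem recLegal_iff {A : ConstGame} {E : Formula}
    (hA : ∀ Φ, A.Legal Φ ↔ ∀ l ∈ Φ, NumericMove E l.2) (Φ : Position) :
    recLegal A Φ ↔ ∀ l ∈ Φ, ∃ a u β, l.2 = addrSegment u ++ β ∧
      payload E β = some (numeral a) := by
  simp only [recLegal, hA, List.mem_filterMap, onMove, Option.map_eq_some_iff,
    strand_eq_some, Option.isSome_iff_exists, Prod.exists, readBits_eq_some]
  constructor
  · rintro ⟨h, h0⟩ l hl
    obtain ⟨u, β, hβ⟩ := h l hl
    obtain ⟨x, hx⟩ := exists_pre u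
    obtain ⟨a, ha⟩ := h0 x (l.1, β) ⟨l.1, l.2, hl, β, ⟨u, hx, hβ⟩, rfl⟩
    exact ⟨a, u, β, hβ, ha⟩
  · intro h
    refine ⟨fun l hl => ?_, ?_⟩
    · obtain ⟨a, u, β, hβ, -⟩ := h l hl
      exact ⟨u, β, hβ⟩
    · rintro x _ ⟨p, m, hl, β, ⟨u, hu, hβ⟩, rfl⟩
      obtain ⟨a, u', β', hβ', ha⟩ := h _ hl
      obtain ⟨rfl, rfl⟩ := addrSegment_append_inj (hβ.symm.trans hβ')
      exact ⟨a, ha⟩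

/-- For enumeration interpretations legality is decided move by move and does not depend on the
interpretation, so it can be examined before the winning conditions are fixed. -/
theorem legal_iff {I : Interpretation} (hI : I.IsEnumeration) (F : Formula) (e : Valuation)
    (Φ : Position) : (F.game I e).Legal Φ ↔ ∀ l ∈ Φ, NumericMove F l.2 := by
  induction F generalizing Φ with
  | atom P =>
    refine ((hI P e).1 Φ).trans ?_
    simp [NumericMove, payload]
  | natom P =>
    refine ((hI P e).1 (Φ.map LabMove.neg)).trans ?_
    simp only [NumericMove, payload, LabMove.neg, List.forall_mem_map, Option.some.injEq]
  | and E G ihE ihG =>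
    refine (parLegal_iff ihE ihG Φ).trans ?_
    simp only [NumericMove, payload_and]
  | or E G ihE ihG =>
    refine (parLegal_iff ihE ihG Φ).trans ?_
    simp only [NumericMove, payload_or]
  | st E ih =>
    refine (recLegal_iff ih Φ).trans ?_
    simp only [NumericMove, payload_st]
  | cost E ih =>
    refine (recLegal_iff ih Φ).trans ?_
    simp only [NumericMove, payload_cost]

theorem legal_take {I : Interpretation} (hI : I.IsEnumeration) {F : Formula} (e : Valuation)
    {Γ : Run} (h : ∀ l, Γ.Contains l → NumericMove F l.2) (k : ℕ) :
    (F.game I e).Legal (Γ.take k) := by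
  rw [legal_iff hI]
  intro l hl
  obtain ⟨i, -, hi⟩ := Run.mem_take.1 hl
  exact h l ⟨i, hi⟩

/-- The labmoves in `L` are those in `M` with the labels reversed. -/
def Opp (C : Set LabMove) (L M : Path) : Prop := prs L C = {l | l.neg ∈ prs M C}

/-- If the winning conditions declare exactly the contents dual to those of visible negative literals
to be won, and no visible positive literal is dual to a visible negative literal, then all visible
units are lost. -/
theorem wn_eq_bot {F : Formula} {C : Set LabMove} {κ : Path → Bool} {ρ : Path → ℕ → Bool}
    {W : ℕ → Set LabMove → Prop}
    (hW : ∀ P X, W P X ↔ ∃ M, F.sub M = some (.natom P) ∧ Vis F κ M ∧ RCons F ρ M ∧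
      X = {l | l.neg ∈ prs M C})
    (hno : ∀ P L M, F.sub L = some (.atom P) → F.sub M = some (.natom P) → Vis F κ L →
      RCons F ρ L → Vis F κ M → RCons F ρ M → ¬ Opp C L M)
    (e : Valuation) {G : Formula} {p : Path} (hp : F.sub p = some G) (hv : Vis F κ p)
    (hr : RCons F ρ p) {Γ : Run} (hΓ : {l | Γ.Contains l} = prs p C)
    (hnum : ∀ l, Γ.Contains l → NumericMove G l.2) :
    (G.game (numInterpretation W) e).Wn Γ = .bot := by
  have hI := numInterpretation_isEnumeration W
  have hside : ∀ {p : Path} {Γ : Run} {E G E' : Formula} (i : Bool),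
      {l | Γ.Contains l} = prs p C → (∀ l, Γ.Contains l → NumericMove E' l.2) →
      (E' = .and E G ∨ E' = .or E G) →
      {l | (Γ.component i).Contains l} = prs (p ++ [.side i]) C ∧
        ∀ l, (Γ.component i).Contains l → NumericMove (bif i then G else E) l.2 := by
    intro p Γ E G E' i hΓ hnum hE
    have h1 := contains_component (i := i) (Γ := Γ)
    refine ⟨by rw [h1, hΓ, prs_concat], fun l hl => ?_⟩
    have hl' : l ∈ {l | (Γ.component i).Contains l} := hl
    rw [h1] at hl'
    obtain ⟨a, ha⟩ := hnum _ hl'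
    have ha' : ∃ j β, addrSegment [i] ++ l.2 = addrSegment [j] ++ β ∧
        payload (bif j then G else E) β = some (numeral a) := by
      rcases hE with rfl | rfl
      · exact payload_and.1 ha
      · exact payload_or.1 ha
    obtain ⟨j, β, hj, ha⟩ := ha'
    obtain ⟨hij, rfl⟩ := addrSegment_append_inj hj
    simp only [List.cons.injEq, and_true] at hij
    subst hij
    exact ⟨a, ha⟩
  have hstr : ∀ {p : Path} {Γ : Run} {E E' : Formula} (x : ℕ → Bool),
      {l | Γ.Contains l} = prs p C → (∀ l, Γ.Contains l → NumericMove E' l.2) →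
      (E' = .st E ∨ E' = .cost E) →
      {l | (Γ.strand x).Contains l} = prs (p ++ [.str x]) C ∧
        ∀ l, (Γ.strand x).Contains l → NumericMove E l.2 := by
    intro p Γ E E' x hΓ hnum hE
    have h1 := contains_strand (x := x) (Γ := Γ)
    refine ⟨by rw [h1, hΓ, prs_concat], fun l hl => ?_⟩
    have hl' : l ∈ {l | (Γ.strand x).Contains l} := hl
    rw [h1] at hl'
    obtain ⟨u, -, hl'⟩ := hl'
    obtain ⟨a, ha⟩ := hnum _ hl'
    have ha' : ∃ v β, addrSegment u ++ l.2 = addrSegment v ++ β ∧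
        payload E β = some (numeral a) := by
      rcases hE with rfl | rfl
      · exact payload_st.1 ha
      · exact payload_cost.1 ha
    obtain ⟨j, β, hj, ha⟩ := ha'
    obtain ⟨rfl, rfl⟩ := addrSegment_append_inj hj
    exact ⟨a, ha⟩
  have hchild : ∀ {p : Path} {G : Formula} (s : Step), F.sub p = some G →
      F.sub (p ++ [s]) = G.child s := by
    intro p G s hG
    rw [Formula.sub_concat, hG]
    rfl
  induction G generalizing p Γ with
  -- If a visible positive literal were won, its content would be opposite to that of a visible
  -- negative one, contrary to `hno`.
  | atom P =>
    refine (ofLegal_wn_eq_bot_iff (legal_take hI e hnum)).2 fun hw => ?_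
    obtain ⟨M, hM, hvM, hrM, hX⟩ := (hW _ _).1 hw
    exact hno P p M hp hM hv hr hvM hrM (hΓ.symm.trans hX)
  -- The winning condition was made to hold for the reversed content of every visible negative
  -- literal, so the literal itself is lost.
  | natom P =>
    refine (ofLegal_wn_eq_bot_iff (legal_take hI (F := .natom P) e hnum)).2 ?_
    have hnum' : ∀ l, Γ.neg.Contains l → NumericMove (.atom P) l.2 := fun l hl =>
      hnum l.neg (Run.contains_neg.1 hl)
    have : ((numInterpretation W).val P e).Wn Γ.neg = .top := by
      refine (ofLegal_wn_eq_top_iff (legal_take hI (F := .atom P) e hnum')).2 ?_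
      refine (hW _ _).2 ⟨p, hp, hv, hr, ?_⟩
      rw [← hΓ]
      ext l
      exact Run.contains_neg
    rw [this]
    simp
  | and E G ihE ihG =>
    refine (ofLegal_wn_eq_bot_iff (legal_take hI (F := .and E G) e hnum)).2 ?_
    rintro ⟨hE, hG⟩
    have hv' : ∀ i, i = κ p → Vis F κ (p ++ [.side i]) := by
      rintro i hi
      refine vis_concat.2 ⟨hv, fun j hj _ => ?_⟩
      cases hj
      exact hi
    have hr' : ∀ i, RCons F ρ (p ++ [.side i]) := fun i =>
      rcons_concat.2 ⟨hr, fun x hx => by cases hx⟩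
    -- One lost conjunct suffices: the visible one.
    cases hi : κ p with
    | false =>
      obtain ⟨h1, h2⟩ := hside false hΓ hnum (Or.inl rfl)
      rw [ihE (hchild _ hp) (hv' _ hi.symm) (hr' _) h1 h2] at hE
      cases hE
    | true =>
      obtain ⟨h1, h2⟩ := hside true hΓ hnum (Or.inl rfl)
      rw [ihG (hchild _ hp) (hv' _ hi.symm) (hr' _) h1 h2] at hG
      cases hG
  | or E G ihE ihG =>
    refine (ofLegal_wn_eq_bot_iff (legal_take hI (F := .or E G) e hnum)).2 ?_
    have hv' : ∀ i, Vis F κ (p ++ [.side i]) := fun i =>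
      (vis_concat_of_ne_and fun E G => by simp [hp]).2 hv
    have hr' : ∀ i, RCons F ρ (p ++ [.side i]) := fun i =>
      rcons_concat.2 ⟨hr, fun x hx => by cases hx⟩
    rintro (hE | hG)
    · obtain ⟨h1, h2⟩ := hside false hΓ hnum (Or.inr rfl)
      rw [ihE (hchild _ hp) (hv' _) (hr' _) h1 h2] at hE
      cases hE
    · obtain ⟨h1, h2⟩ := hside true hΓ hnum (Or.inr rfl)
      rw [ihG (hchild _ hp) (hv' _) (hr' _) h1 h2] at hG
      cases hG
  | st E ih =>
    refine (ofLegal_wn_eq_bot_iff (legal_take hI (F := .st E) e hnum)).2 fun hw => ?_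
    -- One lost copy suffices for a recurrence, namely that of `ρ p`; a corecurrence needs the loss
    -- along every `x`.
    obtain ⟨h1, h2⟩ := hstr (ρ p) hΓ hnum (Or.inl rfl)
    have hw := hw (ρ p)
    rw [ih (hchild _ hp) ((vis_concat_of_ne_and fun E G => by simp [hp]).2 hv)
      (rcons_concat.2 ⟨hr, fun x hx _ => by cases hx; rfl⟩) h1 h2] at hw
    cases hw
  | cost E ih =>
    refine (ofLegal_wn_eq_bot_iff (legal_take hI (F := .cost E) e hnum)).2 fun ⟨x, hw⟩ => ?_
    obtain ⟨h1, h2⟩ := hstr x hΓ hnum (Or.inr rfl)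
    rw [ih (hchild _ hp) ((vis_concat_of_ne_and fun E G => by simp [hp]).2 hv)
      (rcons_concat.2 ⟨hr, fun x hx hst => by simp [hp] at hst⟩) h1 h2] at hw
    cases hw

end CoL

namespace CoL

/-! ## Addresses of literals -/

/-- The bitstrings on a path. -/
def strs : Path → List (ℕ → Bool)
  | [] => []
  | .side _ :: p => strs p
  | .str x :: p => x :: strs p

/-- The path with its bitstrings removed. -/
def sk : Path → List (Option Bool)
  | [] => []
  | .side i :: p => some i :: sk p
  | .str _ :: p => none :: sk p

/-- The address with the given finite bitstrings along a path without bitstrings. -/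
def addrOf : List (Option Bool) → List (List Bool) → Move
  | [], _ => []
  | some i :: k, us => addrSegment [i] ++ addrOf k us
  | none :: k, u :: us => addrSegment u ++ addrOf k us
  | none :: _, [] => []

theorem strs_append (p q : Path) : strs (p ++ q) = strs p ++ strs q := by
  induction p with
  | nil => rfl
  | cons s p ih => cases s <;> simp [strs, ih]

theorem path_ext {p q : Path} (h1 : sk p = sk q) (h2 : strs p = strs q) : p = q := by
  induction p generalizing q with
  | nil =>
    cases q with
    | nil => rfl
    | cons s q => cases s <;> simp [sk] at h1
  | cons s p ih =>
    cases q with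
    | nil => cases s <;> simp [sk] at h1
    | cons t q =>
      cases s <;> cases t <;> simp only [sk, strs, List.cons.injEq, Option.some.injEq, true_and,
        reduceCtorEq, false_and] at h1 h2
      · rw [h1.1, ih h1.2 h2]
      · rw [h2.1, ih h1 h2.2]

theorem mem_prs {p : Path} {C : Set LabMove} {q : Player} {β : Move} :
    (q, β) ∈ prs p C ↔
      ∃ us, List.Forall₂ Pre us (strs p) ∧ (q, addrOf (sk p) us ++ β) ∈ C := by
  induction p generalizing C with
  | nil => simp [prs, strs, sk, addrOf]
  | cons s p ih =>
    rw [prs, ih]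
    cases s with
    | side i => simp [strs, sk, addrOf, proj]
    | str x =>
      simp only [strs, sk, proj, Set.mem_ofPred_eq]
      constructor
      · rintro ⟨us, hus, u, hu, h⟩
        exact ⟨u :: us, List.Forall₂.cons hu hus, by simpa [addrOf] using h⟩
      · rintro ⟨us, hus, h⟩
        cases hus with
        | cons hu hus => exact ⟨_, hus, _, hu, by simpa [addrOf] using h⟩

/-- The path leads to a literal. -/
def Formula.IsLit (F : Formula) (p : Path) : Prop :=
  ∃ P, F.sub p = some (.atom P) ∨ F.sub p = some (.natom P)

theorem Formula.IsLit.cases {F : Formula} {p : Path} (h : F.IsLit p) :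
    (p = [] ∧ ∃ P, F = .atom P ∨ F = .natom P) ∨
    (∃ i q E G, p = .side i :: q ∧ (F = .and E G ∨ F = .or E G) ∧ (bif i then G else E).IsLit q) ∨
    ∃ x q E, p = .str x :: q ∧ (F = .st E ∨ F = .cost E) ∧ E.IsLit q := by
  obtain ⟨P, hP⟩ := h
  cases p with
  | nil => exact Or.inl ⟨rfl, P, by simpa [Formula.sub] using hP⟩
  | cons s q =>
    right
    simp only [Formula.sub] at hP
    cases s with
    | side i =>
      left
      cases F <;> simp only [Formula.child, Option.bind_none, Option.bind_some, reduceCtorEq,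
        or_self] at hP
      · exact ⟨i, q, _, _, rfl, Or.inl rfl, P, hP⟩
      · exact ⟨i, q, _, _, rfl, Or.inr rfl, P, hP⟩
    | str x =>
      right
      cases F <;> simp only [Formula.child, Option.bind_none, Option.bind_some, reduceCtorEq,
        or_self] at hP
      · exact ⟨x, q, _, rfl, Or.inl rfl, P, hP⟩
      · exact ⟨x, q, _, rfl, Or.inr rfl, P, hP⟩

theorem payload_addrOf {F : Formula} {p : Path} (h : F.IsLit p) {us : List (List Bool)}
    (hus : us.length = (strs p).length) (β : Move) :
    payload F (addrOf (sk p) us ++ β) = some β := by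
  induction p generalizing F us with
  | nil =>
    rcases h.cases with ⟨-, P, rfl | rfl⟩ | ⟨_, _, _, _, h, -⟩ | ⟨_, _, _, h, -⟩
    · rfl
    · rfl
    · cases h
    · cases h
  | cons s p ih =>
    rcases h.cases with ⟨h, -⟩ | ⟨i, q, E, G, h, hF, hq⟩ | ⟨x, q, E, h, hF, hq⟩
    · cases h
    · cases h
      have e := ih hq hus
      rcases hF with rfl | rfl
      · exact payload_and.2 ⟨i, _, by simp [sk, addrOf], e⟩
      · exact payload_or.2 ⟨i, _, by simp [sk, addrOf], e⟩
    · cases h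
      cases us with
      | nil => simp [strs] at hus
      | cons u us =>
        have e := ih hq (us := us) (by simpa [strs] using hus)
        rcases hF with rfl | rfl
        · exact payload_st.2 ⟨u, _, by simp [sk, addrOf], e⟩
        · exact payload_cost.2 ⟨u, _, by simp [sk, addrOf], e⟩

/-- The formula dictates which kind of segment comes next, and segments delimit themselves, so a
move determines the skeleton and the bitstrings of its address. -/
theorem addrOf_inj {F : Formula} {p p' : Path} (h : F.IsLit p) (h' : F.IsLit p')
    {us us' : List (List Bool)} (hus : us.length = (strs p).length)
    (hus' : us'.length = (strs p').length) {β β' : Move}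
    (he : addrOf (sk p) us ++ β = addrOf (sk p') us' ++ β') : sk p = sk p' ∧ us = us' := by
  induction p generalizing F p' us us' with
  | nil =>
    have hF : ∃ P, F = .atom P ∨ F = .natom P := by
      rcases h.cases with ⟨-, h⟩ | ⟨_, _, _, _, h, -⟩ | ⟨_, _, _, h, -⟩
      · exact h
      · cases h
      · cases h
    obtain ⟨P, hF⟩ := hF
    rcases h'.cases with ⟨rfl, -⟩ | ⟨_, _, _, _, -, hF', -⟩ | ⟨_, _, _, -, hF', -⟩
    · simp only [strs, List.length_nil, List.length_eq_zero_iff] at hus hus'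
      simp [hus, hus']
    · rcases hF with rfl | rfl <;> rcases hF' with h | h <;> cases h
    · rcases hF with rfl | rfl <;> rcases hF' with h | h <;> cases h
  | cons s p ih =>
    rcases h.cases with ⟨h, -⟩ | ⟨i, q, E, G, h, hF, hq⟩ | ⟨x, q, E, h, hF, hq⟩
    · cases h
    · cases h
      rcases h'.cases with ⟨-, P, hF'⟩ | ⟨i', q', E', G', rfl, hF', hq'⟩ | ⟨_, _, _, -, hF', -⟩
      · rcases hF with rfl | rfl <;> rcases hF' with h | h <;> cases h
      · simp only [sk, addrOf, List.append_assoc] at he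
        obtain ⟨hi, he'⟩ := addrSegment_append_inj he
        simp only [List.cons.injEq, and_true] at hi
        subst hi
        have hEG : E = E' ∧ G = G' := by
          rcases hF with rfl | rfl <;> rcases hF' with h | h <;> cases h <;> exact ⟨rfl, rfl⟩
        obtain ⟨rfl, rfl⟩ := hEG
        obtain ⟨h1, h2⟩ := ih hq hq' hus hus' he'
        exact ⟨by simp [sk, h1], h2⟩
      · rcases hF with rfl | rfl <;> rcases hF' with h | h <;> cases h
    · cases h
      rcases h'.cases with ⟨-, P, hF'⟩ | ⟨_, _, _, _, -, hF', -⟩ | ⟨x', q', E', rfl, hF', hq'⟩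
      · rcases hF with rfl | rfl <;> rcases hF' with h | h <;> cases h
      · rcases hF with rfl | rfl <;> rcases hF' with h | h <;> cases h
      · cases us with
        | nil => simp [strs] at hus
        | cons u us =>
        cases us' with
        | nil => simp [strs] at hus'
        | cons u' us' =>
        simp only [sk, addrOf, List.append_assoc] at he
        obtain ⟨rfl, he'⟩ := addrSegment_append_inj he
        have hEG : E = E' := by
          rcases hF with rfl | rfl <;> rcases hF' with h | h <;> cases h <;> rfl
        subst hEG
        obtain ⟨h1, h2⟩ := ih hq hq' (by simpa [strs] using hus) (by simpa [strs] using hus') he'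
        exact ⟨by simp [sk, h1], by rw [h2]⟩

theorem addrOf_mem_literalAddresses {F : Formula} {p : Path} (h : F.IsLit p) (n : ℕ) :
    addrOf (sk p) ((strs p).map (trunc n)) ∈ literalAddresses n F := by
  induction p generalizing F with
  | nil =>
    rcases h.cases with ⟨-, P, rfl | rfl⟩ | ⟨_, _, _, _, h, -⟩ | ⟨_, _, _, h, -⟩
    · simp [sk, addrOf, literalAddresses]
    · simp [sk, addrOf, literalAddresses]
    · cases h
    · cases h
  | cons s p ih =>
    rcases h.cases with ⟨h, -⟩ | ⟨i, q, E, G, h, hF, hq⟩ | ⟨x, q, E, h, hF, hq⟩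
    · cases h
    · cases h
      have e := ih hq
      rcases hF with rfl | rfl <;> cases i <;>
        simpa [sk, addrOf, literalAddresses, strs, addrSegment, bitKey] using e
    · cases h
      have e := ih hq
      have e' : ∃ u ∈ bitstrings n, addrOf (sk (.str x :: p)) ((strs (.str x :: p)).map (trunc n)) ∈
          (literalAddresses n E).map (addrSegment u ++ ·) :=
        ⟨trunc n x, mem_bitstrings.2 (length_trunc n x), List.mem_map.2 ⟨_, e, rfl⟩⟩
      rcases hF with rfl | rfl <;> exact List.mem_flatMap.2 e'

theorem payload_of_mem_literalAddresses {F : Formula} {n : ℕ} {α : Move}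
    (h : α ∈ literalAddresses n F) (β : Move) : payload F (α ++ β) = some β := by
  induction F generalizing α with
  | atom P =>
    simp only [literalAddresses, List.mem_singleton] at h
    simp [h, payload]
  | natom P =>
    simp only [literalAddresses, List.mem_singleton] at h
    simp [h, payload]
  | and E G ihE ihG =>
    simp only [literalAddresses, List.mem_append, List.mem_map] at h
    rcases h with ⟨α, h, rfl⟩ | ⟨α, h, rfl⟩
    · exact payload_and.2 ⟨false, _, List.append_assoc _ _ _, ihE h⟩
    · exact payload_and.2 ⟨true, _, List.append_assoc _ _ _, ihG h⟩
  | or E G ihE ihG =>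
    simp only [literalAddresses, List.mem_append, List.mem_map] at h
    rcases h with ⟨α, h, rfl⟩ | ⟨α, h, rfl⟩
    · exact payload_or.2 ⟨false, _, List.append_assoc _ _ _, ihE h⟩
    · exact payload_or.2 ⟨true, _, List.append_assoc _ _ _, ihG h⟩
  | st E ih =>
    simp only [literalAddresses, List.mem_flatMap, List.mem_map] at h
    obtain ⟨u, -, α, h, rfl⟩ := h
    exact payload_st.2 ⟨u, _, List.append_assoc _ _ _, ih h⟩
  | cost E ih =>
    simp only [literalAddresses, List.mem_flatMap, List.mem_map] at h
    obtain ⟨u, -, α, h, rfl⟩ := h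
    exact payload_cost.2 ⟨u, _, List.append_assoc _ _ _, ih h⟩

theorem le_activeHeight {F : Formula} {p : Path} (h : F.IsLit p) (hne : strs p ≠ []) (n : ℕ)
    (β : Move) : n ≤ activeHeight F (addrOf (sk p) ((strs p).map (trunc n)) ++ β) := by
  induction p generalizing F with
  | nil => simp [strs] at hne
  | cons s p ih =>
    rcases h.cases with ⟨h, -⟩ | ⟨i, q, E, G, h, hF, hq⟩ | ⟨x, q, E, h, hF, hq⟩
    · cases h
    · cases h
      have e := ih hq hne
      have hc := component_eq_some (i := i)
        (m := addrOf (sk (.side i :: p)) ((strs (.side i :: p)).map (trunc n)) ++ β)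
        (β := addrOf (sk p) ((strs p).map (trunc n)) ++ β) |>.2 (by simp [sk, addrOf, strs])
      cases i
      · rcases hF with rfl | rfl <;> simp only [activeHeight, hc] <;> exact le_max_of_le_left e
      · rcases hF with rfl | rfl <;> simp only [activeHeight, hc] <;> exact le_max_of_le_right e
    · cases h
      have hc := readBits_eq_some
        (m := addrOf (sk (.str x :: p)) ((strs (.str x :: p)).map (trunc n)) ++ β)
        (β := addrOf (sk p) ((strs p).map (trunc n)) ++ β) (u := trunc n x) |>.2
        (by simp [sk, addrOf, strs])
      rcases hF with rfl | rfl <;> simp [activeHeight, hc]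

/-! ## The runs against the counterstrategy -/

theorem activeHeight_lt_promptHeight (F : Formula) {Φ : Position} {l : LabMove} (h : l ∈ Φ) :
    activeHeight F l.2 < promptHeight F Φ := by
  unfold promptHeight
  induction Φ with
  | nil => cases h
  | cons a Φ ih =>
    simp only [List.map_cons, List.foldr_cons]
    rcases List.mem_cons.1 h with rfl | h
    · exact lt_max_of_lt_left (Nat.lt_succ_self _)
    · exact lt_max_of_lt_right (ih h)

theorem exists_mem_freshMoves (F : Formula) {αs : List Move} {α : Move} (h : α ∈ αs)
    (Φ : Position) : ∃ a, α ++ numeral a ∈ freshMoves F αs Φ := by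
  induction αs generalizing Φ with
  | nil => cases h
  | cons γ αs ih =>
    rcases List.mem_cons.1 h with rfl | h
    · exact ⟨fresh F Φ, by simp [freshMoves]⟩
    · obtain ⟨a, ha⟩ := ih h (Φ ++ [(.bot, γ ++ numeral (fresh F Φ))])
      exact ⟨a, List.mem_cons_of_mem _ ha⟩

/-- The environment's moves are numeric, and no number is used twice by the environment. -/
def BotFresh (F : Formula) (C : Set LabMove) : Prop :=
  (∀ m, (Player.bot, m) ∈ C → NumericMove F m) ∧
    ∀ m m', (Player.bot, m) ∈ C → (Player.bot, m') ∈ C → payload F m = payload F m' → m = m'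

/-- Each new number differs from all payloads of the position so far, including the moves made
earlier in the same round. -/
theorem BotFresh.freshMoves {F : Formula} {αs : List Move}
    (hα : ∀ α ∈ αs, ∀ β, payload F (α ++ β) = some β) {Φ : Position}
    (h : BotFresh F {l | l ∈ Φ}) :
    BotFresh F {l | l ∈ Φ ++ (freshMoves F αs Φ).map fun β => (Player.bot, β)} := by
  induction αs generalizing Φ with
  | nil => simpa [CoL.freshMoves] using h
  | cons α αs ih =>
    have hpay := hα α List.mem_cons_self (numeral (fresh F Φ))
    have hfresh : ∀ l ∈ Φ, payload F l.2 ≠ some (numeral (fresh F Φ)) :=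
      Nat.find_spec (exists_fresh F Φ)
    have h1 : BotFresh F {l | l ∈ Φ ++ [(Player.bot, α ++ numeral (fresh F Φ))]} := by
      simp only [BotFresh, Set.mem_ofPred_eq, List.mem_append, List.mem_singleton, Prod.mk.injEq,
        true_and]
      refine ⟨?_, ?_⟩
      · rintro m (hm | rfl)
        · exact h.1 m hm
        · exact ⟨_, hpay⟩
      · rintro m m' (hm | rfl) (hm' | rfl) he
        · exact h.2 m m' hm hm' he
        · exact absurd (he.trans hpay) (hfresh _ hm)
        · exact absurd (he.symm.trans hpay) (hfresh _ hm')
        · rfl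
    have h2 := ih (fun α hα' => hα α (List.mem_cons_of_mem _ hα')) h1
    simpa [CoL.freshMoves] using h2

section Branch

variable (M : HPM) (e : Valuation) (F : Formula)

theorem run_branchVs_succ (σ : EnvStrategy) (i : ℕ) : ∃ Φ : Position, (∀ l ∈ Φ, l.1 = .top) ∧
    (M.branchVs e σ (i + 1)).run =
      (M.branchVs e σ i).run ++ (σ (M.branchVs e σ i).run).map (fun β => (Player.bot, β)) ++ Φ := by
  refine ⟨_, ?_, rfl⟩
  intro l hl
  split_ifs at hl
  · simp only [List.mem_singleton] at hl
    rw [hl]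
  · cases hl

theorem branchVs_chain (σ : EnvStrategy) (i : ℕ) :
    (M.branchVs e σ i).run <+: (M.branchVs e σ (i + 1)).run := by
  obtain ⟨Φ, -, h⟩ := run_branchVs_succ M e σ i
  rw [h, List.append_assoc]
  exact List.prefix_append _ _

theorem contains_branchVs {σ : EnvStrategy} {l : LabMove} :
    (M.runOf (M.branchVs e σ)).Contains l ↔ ∃ i, l ∈ (M.branchVs e σ i).run :=
  Run.contains_limit (branchVs_chain M e σ)

theorem botFresh_branchVs (i : ℕ) :
    BotFresh F {l | l ∈ (M.branchVs e (counterstrategy F) i).run} := by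
  induction i with
  | zero =>
    change BotFresh F {l | l ∈ ([] : Position)}
    simp [BotFresh]
  | succ i ih =>
    obtain ⟨Φ, hΦ, h⟩ := run_branchVs_succ M e (counterstrategy F) i
    have h1 := ih.freshMoves (αs := literalAddresses (promptHeight F
      (M.branchVs e (counterstrategy F) i).run) F) fun α hα => payload_of_mem_literalAddresses hα
    rw [h]
    have hbot : ∀ m : Move, (Player.bot, m) ∉ Φ := by
      intro m hm
      have := hΦ _ hm
      cases this
    simpa [BotFresh, hbot, counterstrategy] using h1

theorem botFresh_run :
    BotFresh F {l | (M.runOf (M.branchVs e (counterstrategy F))).Contains l} := by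
  simp only [contains_branchVs]
  refine ⟨?_, ?_⟩
  · rintro m ⟨i, hi⟩
    exact (botFresh_branchVs M e F i).1 m hi
  · rintro m m' ⟨i, hi⟩ ⟨j, hj⟩
    exact (botFresh_branchVs M e F (max i j)).2 m m'
      ((prefix_of_chain (branchVs_chain M e _) (le_max_left i j)).subset hi)
      ((prefix_of_chain (branchVs_chain M e _) (le_max_right i j)).subset hj)

/-- The environment prompts the unit `p` at arbitrarily great heights. -/
theorem exists_prompt {p : Path} (hp : F.IsLit p) (k : ℕ) : ∃ n, k ≤ n ∧ ∃ a,
    (Player.bot, addrOf (sk p) ((strs p).map (trunc n)) ++ numeral a) ∈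
      {l | (M.runOf (M.branchVs e (counterstrategy F))).Contains l} := by
  have hround : ∀ i, ∃ a, (Player.bot, addrOf (sk p) ((strs p).map (trunc
      (promptHeight F (M.branchVs e (counterstrategy F) i).run))) ++ numeral a) ∈
        (M.branchVs e (counterstrategy F) (i + 1)).run := by
    intro i
    obtain ⟨Φ, -, h⟩ := run_branchVs_succ M e (counterstrategy F) i
    obtain ⟨a, ha⟩ := exists_mem_freshMoves F (addrOf_mem_literalAddresses hp
      (promptHeight F (M.branchVs e (counterstrategy F) i).run))
      (M.branchVs e (counterstrategy F) i).run
    refine ⟨a, ?_⟩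
    rw [h]
    exact List.mem_append_left _ (List.mem_append_right _ (List.mem_map_of_mem ha))
  -- Without bitstrings on the path there is nothing to truncate, and any `n` serves.
  by_cases hs : strs p = []
  · obtain ⟨a, ha⟩ := hround 0
    refine ⟨k, le_rfl, a, (contains_branchVs M e).2 ⟨1, ?_⟩⟩
    simpa [hs] using ha
  -- Each round leaves a move of at least the current prompt height, which forces the next prompt
  -- height to be greater.
  · have hgrow : ∀ i, i ≤ promptHeight F (M.branchVs e (counterstrategy F) i).run := by
      intro i
      induction i with
      | zero => exact Nat.zero_le _
      | succ i ih =>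
        obtain ⟨a, ha⟩ := hround i
        exact (ih.trans (le_activeHeight hp hs _ _)).trans_lt (activeHeight_lt_promptHeight F ha)
    obtain ⟨a, ha⟩ := hround k
    exact ⟨_, hgrow k, a, (contains_branchVs M e).2 ⟨_, ha⟩⟩

end Branch

end CoL

namespace CoL

open Cardinal

/-! ## Dependence of dual literals -/

section Dual

variable {F : Formula} {C : Set LabMove}

theorem Opp.symm {L M : Path} (h : Opp C L M) : Opp C M L := by
  have hnn : ∀ l : LabMove, l.neg.neg = l := by
    rintro ⟨p, m⟩
    cases p <;> rfl
  unfold Opp at *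
  rw [h]
  ext l
  simp [hnn]

/-- The number of a prompt in `L` also occurs in the content of `M`; being used only once by the
environment, it identifies the address. Arbitrarily long initial segments of the bitstrings of `L`
and `M` therefore coincide. -/
theorem eq_of_prs_eq (hC : BotFresh F C)
    (hpr : ∀ p, F.IsLit p → ∀ k, ∃ n, k ≤ n ∧ ∃ a,
      (Player.bot, addrOf (sk p) ((strs p).map (trunc n)) ++ numeral a) ∈ C)
    {L M : Path} (hL : F.IsLit L) (hM : F.IsLit M) (h : prs L C = prs M C) : L = M := by
  have key : ∀ k, ∃ n, k ≤ n ∧ sk L = sk M ∧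
      List.Forall₂ Pre ((strs L).map (trunc n)) (strs M) := by
    intro k
    obtain ⟨n, hkn, a, ha⟩ := hpr L hL k
    have hmem : (Player.bot, numeral a) ∈ prs M C := by
      rw [← h, mem_prs]
      refine ⟨_, ?_, ha⟩
      rw [List.forall₂_map_left_iff, List.forall₂_same]
      exact fun x _ => pre_trunc n x
    obtain ⟨us, hus, hm⟩ := mem_prs.1 hmem
    have heq := hC.2 _ _ ha hm (by
      rw [payload_addrOf hL (by simp), payload_addrOf hM hus.length_eq])
    obtain ⟨h1, rfl⟩ := addrOf_inj hL hM (by simp) hus.length_eq heq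
    exact ⟨n, hkn, h1, hus⟩
  obtain ⟨-, -, hsk, -⟩ := key 0
  refine path_ext hsk ?_
  have hlen : (strs L).length = (strs M).length := by
    obtain ⟨n, -, -, h⟩ := key 0
    simpa using h.length_eq
  refine List.ext_getElem hlen fun i h1 h2 => eq_of_forall_pre_trunc fun k => ?_
  obtain ⟨n, hkn, -, h⟩ := key k
  refine ⟨n, hkn, ?_⟩
  have := (List.forall₂_iff_get.1 h).2 i (by simpa using h1) h2
  simpa using this

theorem Opp.right_unique (hC : BotFresh F C)
    (hpr : ∀ p, F.IsLit p → ∀ k, ∃ n, k ≤ n ∧ ∃ a,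
      (Player.bot, addrOf (sk p) ((strs p).map (trunc n)) ++ numeral a) ∈ C)
    {L M M' : Path} (hM : F.IsLit M) (hM' : F.IsLit M') (h : Opp C L M) (h' : Opp C L M') :
    M = M' := by
  refine eq_of_prs_eq hC hpr hM hM' ?_
  have h1 : prs M C = {l | l.neg ∈ prs L C} := h.symm
  have h2 : prs M' C = {l | l.neg ∈ prs L C} := h'.symm
  rw [h1, h2]

/-- The operation that recovers the `j`-th bitstring of a unit with skeleton `m` from the bitstrings
of a dual unit with skeleton `l`, by tracing back the numbers that were copied from the latter. -/
def traceOp (C : Set LabMove) (r : ℕ) (q : List (Option Bool) × List (Option Bool) × ℕ) : Op r :=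
  fun k c => {a | ∃ (us : Fin r → List Bool) (vs : List (List Bool)) (v : List Bool) (β : Move),
    (∀ i, Pre (us i) (a i)) ∧ (Player.top, addrOf q.1 (List.ofFn us) ++ β) ∈ C ∧
    vs.length = q.2.1.count none ∧ (Player.bot, addrOf q.2.1 vs ++ β) ∈ C ∧
    vs[q.2.2]? = some v ∧ v[k]? = some c}

/-- Membership is witnessed by finite initial segments of the arguments. -/
theorem isOpen_traceOp (C : Set LabMove) (r : ℕ)
    (q : List (Option Bool) × List (Option Bool) × ℕ) : (traceOp C r q).IsOpen := by
  intro k c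
  refine isOpen_iff_forall_mem_open.2 ?_
  rintro a ⟨us, vs, v, β, hus, h⟩
  refine ⟨⋂ i, {b | Pre (us i) (b i)}, ?_, ?_, Set.mem_iInter.2 hus⟩
  · exact fun b hb => ⟨us, vs, v, β, Set.mem_iInter.1 hb, h⟩
  · refine isOpen_iInter_of_finite fun i => ?_
    have hi : IsOpen ((fun b : Fin r → ℕ → Bool => b i) ⁻¹' {x | Pre (us i) x}) :=
      (isOpen_pre (us i)).preimage (continuous_apply i)
    exact hi

theorem length_strs (p : Path) : (strs p).length = (sk p).count none := by
  induction p with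
  | nil => rfl
  | cons s p ih => cases s <;> simp [strs, sk, ih]

/-- The moves of `top` in `L` carry the same numbers as the environment's moves in `M`. Such a
number, found along the bitstrings of `L`, leads back to a unique move of the environment whose
address shows an initial segment of the bitstring sought. -/
theorem Opp.computes (hC : BotFresh F C)
    (hpr : ∀ p, F.IsLit p → ∀ k, ∃ n, k ≤ n ∧ ∃ a,
      (Player.bot, addrOf (sk p) ((strs p).map (trunc n)) ++ numeral a) ∈ C)
    {L M : Path} (hM : F.IsLit M) (h : Opp C L M) {j : ℕ} {y : ℕ → Bool}
    (hj : (strs M)[j]? = some y) :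
    (traceOp C (strs L).length (sk L, sk M, j)).Computes (strs L).get y := by
  intro k c
  constructor
  · rintro ⟨us, vs, v, β, hus, htop, hlen, hbot, hv, hvk⟩
    have hmem : (Player.top, β) ∈ prs L C := by
      refine mem_prs.2 ⟨List.ofFn us, ?_, htop⟩
      rw [List.forall₂_iff_get]
      exact ⟨by simp, fun i h1 h2 => by simpa using hus ⟨i, h2⟩⟩
    rw [h] at hmem
    obtain ⟨ws, hws, hbot'⟩ := mem_prs.1 (show (Player.bot, β) ∈ prs M C from hmem)
    have hlen' : vs.length = (strs M).length := by rw [hlen, length_strs]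
    -- The number was used only once by the environment, so the guessed address is the one belonging
    -- to `M`.
    have heq := hC.2 _ _ hbot hbot' (by
      rw [payload_addrOf hM hlen', payload_addrOf hM hws.length_eq])
    obtain ⟨-, rfl⟩ := addrOf_inj hM hM hlen' hws.length_eq heq
    obtain ⟨h1, h1'⟩ := List.getElem?_eq_some_iff.1 hv
    obtain ⟨h2, h2'⟩ := List.getElem?_eq_some_iff.1 hj
    have := (List.forall₂_iff_get.1 hws).2 j h1 h2
    rw [List.get_eq_getElem, List.get_eq_getElem, h1', h2'] at this
    exact pre_iff.1 this k c hvk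
  · rintro rfl
    -- A prompt of height above `k` displays bit `k`.
    obtain ⟨n, hkn, a, ha⟩ := hpr M hM (k + 1)
    have hmem : (Player.top, numeral a) ∈ prs L C := by
      rw [h]
      refine mem_prs.2 ⟨_, ?_, ha⟩
      rw [List.forall₂_map_left_iff, List.forall₂_same]
      exact fun x _ => pre_trunc n x
    obtain ⟨us, hus, htop⟩ := mem_prs.1 hmem
    obtain ⟨hl, hus'⟩ := List.forall₂_iff_get.1 hus
    refine ⟨fun i => us.get (i.cast hl.symm), (strs M).map (trunc n), trunc n y, numeral a,
      fun i => hus' i (by simp [hl]) i.2, ?_, by simp [length_strs], ha, by simp [hj],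
      getElem?_trunc y hkn⟩
    convert htop using 4
    refine List.ext_getElem (by simp [hl]) fun i h1 h2 => ?_
    simp

theorem mk_path_le : #Path ≤ 𝔠 := by
  have hinj : Function.Injective fun s : Step => match s with
      | .side i => (Sum.inl i : Bool ⊕ (ℕ → Bool))
      | .str x => Sum.inr x := by
    intro s t h
    cases s <;> cases t <;> simp_all
  have h1 : #Step ≤ 𝔠 := by
    refine (Cardinal.mk_le_of_injective hinj).trans ?_
    simp only [Cardinal.mk_sum, Cardinal.lift_id, Cardinal.mk_pi, Cardinal.prod_const,
      Cardinal.mk_bool, Cardinal.mk_nat]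
    rw [Cardinal.two_power_aleph0]
    exact Cardinal.add_le_of_le Cardinal.aleph0_le_continuum
      (mod_cast (Cardinal.nat_lt_continuum 2).le) le_rfl
  exact (Cardinal.mk_list_le_max _).trans (max_le Cardinal.aleph0_le_continuum h1)

/-- The base operations are the tracing operations of the run; they are countably many, since
skeletons and positions in them are countable. Dependence is determined by the closure of the
bitstrings on a path. -/
theorem exists_resolution_opp (hC : BotFresh F C)
    (hpr : ∀ p, F.IsLit p → ∀ k, ∃ n, k ≤ n ∧ ∃ a,
      (Player.bot, addrOf (sk p) ((strs p).map (trunc n)) ++ numeral a) ∈ C) :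
    ∃ R : Resolution, ∀ L M, F.IsLit L → F.IsLit M → Opp C L M → R.D L = R.D M := by
  let base : (r : ℕ) → Set (Op r) := fun r => Set.range (traceOp C r)
  have hb : ∀ r, ∀ f ∈ base r, f.IsOpen := by
    rintro r _ ⟨q, rfl⟩
    exact isOpen_traceOp C r q
  obtain ⟨lt, ρ, D, wo, hmono, hρ, hlt, hnil⟩ := exists_resolution mk_path_le strs hb
    (fun r => Set.countable_range _)
  have hsub : ∀ {l l' : List (ℕ → Bool)}, l ⊆ l' → D l ⊆ D l' := fun h =>
    hmono _ _ (cl_mono hb h)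
  refine ⟨⟨ρ, fun p => D (strs p), lt, wo.toIsWellFounded.wf, hnil, ?_, ?_, ?_, hlt⟩, ?_⟩
  · intro p i
    simp [strs_append, strs]
  · intro p x
    exact hsub (by simp [strs_append])
  · intro p U
    rw [← hρ]
    have : D (strs (p ++ [.str (ρ p)])) = D (ρ p :: strs p) := by
      apply Set.Subset.antisymm
      · exact hsub (by intro y; simp [strs_append, strs]; tauto)
      · exact hsub (by intro y; simp [strs_append, strs]; tauto)
    rw [this]
  -- Each literal's bitstrings are computable from those of its opposite, so the closures, and with
  -- them the dependences, are equal.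
  · have half : ∀ L M, F.IsLit M → Opp C L M → D (strs M) ⊆ D (strs L) := by
      intro L M hM h
      refine hmono _ _ (cl_subset_cl hb fun y hy => ?_)
      obtain ⟨j, hj⟩ := List.mem_iff_getElem?.1 hy
      exact mem_cl_of_base (base := base) (Set.mem_range_self _) (h.computes hC hpr hM hj)
    exact fun L M hL hM h => Set.Subset.antisymm (half M L hL h.symm) (half L M hM h)

/-- Only the finitely many conjunctions on the path matter, each fixing one coordinate of `κ`. -/
theorem isOpen_vis (q : Path) : IsOpen {κ : Path → Bool | Vis F κ q} := by
  induction q using List.reverseRecOn with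
  | nil => simp [vis_nil]
  | append_singleton p s ih =>
    have hset : {κ : Path → Bool | Vis F κ (p ++ [s])} = {κ | Vis F κ p} ∩
        {κ | ∀ i, s = .side i → (∃ E G, F.sub p = some (.and E G)) → i = κ p} :=
      Set.ext fun κ => vis_concat
    rw [hset]
    refine ih.inter ?_
    by_cases h : ∃ i, s = .side i ∧ ∃ E G, F.sub p = some (.and E G)
    · obtain ⟨i, rfl, hEG⟩ := h
      have : {κ : Path → Bool | ∀ j, Step.side i = .side j →
          (∃ E G, F.sub p = some (.and E G)) → j = κ p} = (fun κ => κ p) ⁻¹' {i} := by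
        ext κ
        simp only [Set.mem_ofPred_eq, Set.mem_preimage, Set.mem_singleton_iff, Step.side.injEq]
        constructor
        · exact fun h => (h i rfl hEG).symm
        · rintro rfl j rfl -
          rfl
      rw [this]
      exact (isOpen_discrete _).preimage (continuous_apply p)
    · have : {κ : Path → Bool | ∀ i, s = .side i →
          (∃ E G, F.sub p = some (.and E G)) → i = κ p} = Set.univ :=
        Set.eq_univ_of_forall fun κ i hi hEG => absurd ⟨i, hi, hEG⟩ h
      rw [this]
      exact isOpen_univ

/-- For an unprovable formula, the environment can choose a bitstring for every recurrence and a
component of every conjunction so that no visible literals are dual. -/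
theorem exists_no_dual_pair (hF : ¬ F.Provable) (hC : BotFresh F C)
    (hpr : ∀ p, F.IsLit p → ∀ k, ∃ n, k ≤ n ∧ ∃ a,
      (Player.bot, addrOf (sk p) ((strs p).map (trunc n)) ++ numeral a) ∈ C) :
    ∃ (κ : Path → Bool) (ρ : Path → ℕ → Bool), ∀ P L M, F.sub L = some (.atom P) →
      F.sub M = some (.natom P) → Vis F κ L → RCons F ρ L → Vis F κ M → RCons F ρ M →
        ¬ Opp C L M := by
  obtain ⟨R, hR⟩ := exists_resolution_opp hC hpr
  -- The bitstrings of the resolution are kept fixed; only `κ` varies in what follows.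
  by_contra hcon
  push Not at hcon
  let Q : Set (Path × Path) := {q | (∃ P, F.sub q.1 = some (.natom P) ∧ F.sub q.2 = some (.atom P)) ∧
    RCons F R.ρ q.1 ∧ RCons F R.ρ q.2 ∧ Opp C q.2 q.1}
  have hcover : (Set.univ : Set (Path → Bool)) ⊆
      ⋃ q : Q, {κ | Vis F κ q.1.1} ∩ {κ | Vis F κ q.1.2} := by
    intro κ _
    obtain ⟨P, L, M, hL, hM, hvL, hrL, hvM, hrM, ho⟩ := hcon κ R.ρ
    exact Set.mem_iUnion.2 ⟨⟨(M, L), ⟨P, hM, hL⟩, hrM, hrL, ho⟩, hvM, hvL⟩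
  -- Compactness leaves finitely many opposite pairs, one of which is visible under each `κ`.
  obtain ⟨t, ht⟩ := isCompact_univ.elim_finite_subcover
    (fun q : Q => {κ | Vis F κ q.1.1} ∩ {κ | Vis F κ q.1.2})
    (fun q => (isOpen_vis _).inter (isOpen_vis _)) hcover
  let pr : Path → Path → Prop := fun a b => ∃ q ∈ t, q.1 = (a, b)
  have hpr' : ∀ {a b}, pr a b → (a, b) ∈ Q := by
    rintro a b ⟨q, -, hq⟩
    exact hq ▸ q.2
  have hlit : ∀ {a b}, pr a b → F.IsLit a ∧ F.IsLit b := by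
    intro a b h
    obtain ⟨⟨P, ha, hb⟩, -⟩ := hpr' h
    exact ⟨⟨P, Or.inr ha⟩, P, Or.inl hb⟩
  refine hF (Formula.provable_of_resolution R (pr := pr) ?_ ?_ ?_ ?_ ?_ ?_ ?_)
  · have hfin := ((t : Set Q).toFinite.image fun q : Q => q.1.1).union
      ((t : Set Q).toFinite.image fun q : Q => q.1.2)
    refine hfin.subset ?_
    rintro q ⟨a, ⟨r, hr, he⟩ | ⟨r, hr, he⟩⟩
    · exact Or.inr ⟨r, hr, by simp [he]⟩
    · exact Or.inl ⟨r, hr, by simp [he]⟩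
  -- The pairing is one-to-one because a literal is determined by its content.
  · intro a b b' h h'
    exact (hpr' h).2.2.2.symm.right_unique hC hpr (hlit h).2 (hlit h').2 (hpr' h').2.2.2.symm
  · intro a a' b h h'
    exact (hpr' h).2.2.2.right_unique hC hpr (hlit h).1 (hlit h').1 (hpr' h').2.2.2
  · exact fun a b h => (hpr' h).1
  · exact fun a b h => ⟨(hpr' h).2.1, (hpr' h).2.2.1⟩
  · exact fun a b h => (hR b a (hlit h).2 (hlit h).1 (hpr' h).2.2.2).symm
  · intro κ
    obtain ⟨q, hq⟩ := Set.mem_iUnion.1 (ht (Set.mem_univ κ))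
    obtain ⟨hqt, h1, h2⟩ := Set.mem_iUnion.1 hq
    exact ⟨q.1.1, q.1.2, ⟨q, hqt, rfl⟩, h1, h2⟩

end Dual

/-! ## Incompleteness against every machine -/

/-- The run comes first and the winning conditions are read off it, by way of the choices that leave
no opposite visible literals. -/
theorem exists_losing_interpretation {F : Formula} (hF : ¬ F.Provable) (M : HPM) (e : Valuation) :
    ∃ I : Interpretation, I.IsConstant ∧ I.IsEnumeration ∧
      M.LosesAgainst (F.game I) (counterstrategy F) e := by
  set Γ := M.runOf (M.branchVs e (counterstrategy F)) with hΓ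
  have hC : BotFresh F {l | Γ.Contains l} := botFresh_run M e F
  obtain ⟨κ, ρ, hno⟩ := exists_no_dual_pair hF hC fun p hp k => exists_prompt M e F hp k
  let W : ℕ → Set LabMove → Prop := fun P X => ∃ N, F.sub N = some (.natom P) ∧ Vis F κ N ∧
    RCons F ρ N ∧ X = {l | l.neg ∈ prs N {l | Γ.Contains l}}
  have hI := numInterpretation_isEnumeration W
  refine ⟨numInterpretation W, numInterpretation_isConstant W, hI, ?_⟩
  change (F.game (numInterpretation W) e).Wn Γ = .bot
  -- All moves of the environment are numeric, so if some move is not, the first offender is the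
  -- machine and it loses under any enumeration interpretation.
  by_cases hnum : ∀ l, Γ.Contains l → NumericMove F l.2
  · exact wn_eq_bot (p := []) (fun P X => Iff.rfl) hno e rfl (vis_nil κ) (rcons_nil ρ) rfl hnum
  · push Not at hnum
    obtain ⟨l, ⟨i, hi⟩, hl⟩ := hnum
    obtain ⟨k, ⟨q, m⟩, hk, hbad, -, hgood⟩ :=
      exists_first_bad (good := fun l : LabMove => NumericMove F l.2) hi hl
    have hill := illegalBy_of_first_bad (legal_iff hI F e) hk hbad hgood
    cases q with
    | top => exact (F.game (numInterpretation W) e).wn_illegal _ _ hill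
    | bot => exact absurd (hC.1 m ⟨k, hk⟩) hbad

/-! ### Countability of the set of machines and diagonalization -/

instance : Finite Key := by
  refine Finite.of_injective (fun k : Key => match k with
    | .digit d => (Sum.inl d : Fin 10 ⊕ Option (Fin 84))
    | .period => Sum.inr none
    | .other j => Sum.inr (some j)) ?_
  intro a b h
  cases a <;> cases b <;> simp_all

instance : Finite Player := by
  refine Finite.of_injective (fun p : Player => match p with
    | .top => true
    | .bot => false) ?_
  intro a b h
  cases a <;> cases b <;> simp_all

instance : Finite Dir := by
  refine Finite.of_injective (fun p : Dir => match p with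
    | .left => (0 : Fin 3)
    | .stay => 1
    | .right => 2) ?_
  intro a b h
  cases a <;> cases b <;> simp_all

instance : Countable HPM := by
  let f : HPM → (n : ℕ) × (x : ℕ) × Fin n × (Fin n → Bool) ×
      (Fin n → ValSym → RunSym → WorkSym x → Fin n × WorkSym x × Dir × Dir × Dir) :=
    fun M => ⟨M.numStates, M.numExtra, M.start, M.isMoveState, M.trans⟩
  have h1 : ∀ n x : ℕ, Countable (WorkSym x → Fin n × WorkSym x × Dir × Dir × Dir) :=
    fun n x => inferInstance
  have h2 : ∀ n x : ℕ, Countable (Fin n → ValSym → RunSym → WorkSym x →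
      Fin n × WorkSym x × Dir × Dir × Dir) := fun n x => inferInstance
  refine Function.Injective.countable (f := f) ?_
  rintro ⟨n, x, s, m, t⟩ ⟨n', x', s', m', t'⟩ h
  simp only [f] at h
  cases h
  rfl

instance : Nonempty HPM := ⟨⟨1, 0, 0, fun _ => false, fun _ _ _ _ => (0, none, .stay, .stay, .stay)⟩⟩

theorem isBranch_branchVs (M : HPM) (e : Valuation) (σ : EnvStrategy) :
    M.IsBranch e (M.branchVs e σ) :=
  ⟨rfl, fun _ => ⟨_, rfl⟩⟩

/-- The instance of a compound game at `e` is built from instances of the atoms at the same `e`,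
which lets the dagger interpretation be exchanged for a member of the sequence at a single
valuation. -/
theorem Formula.game_congr (F : Formula) {I J : Interpretation} {e : Valuation}
    (h : ∀ P, I.val P e = J.val P e) : F.game I e = F.game J e := by
  induction F with
  | atom P => exact h P
  | natom P => simp only [Formula.game, h P]
  | and E G ihE ihG => simp only [Formula.game, ihE, ihG]
  | or E G ihE ihG => simp only [Formula.game, ihE, ihG]
  | st E ih => simp only [Formula.game, ih]
  | cost E ih => simp only [Formula.game, ih]

end CoL

theorem mainTheorem2 (F₀ : CoL.Formula) (hF₀ : ¬ F₀.Provable) (x : ℕ) :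
    (∃ H : ℕ → CoL.HPM, Function.Surjective H) ∧
    (∀ H : ℕ → CoL.HPM, Function.Surjective H →
      ∃ star : ℕ → CoL.Interpretation,
        (∀ n, (star n).IsConstant ∧ (star n).IsEnumeration ∧
          (H n).LosesAgainst (F₀.game (star n)) (CoL.counterstrategy F₀) (CoL.diagVal x n)) ∧
        ∃ dagger : CoL.Interpretation,
          (∀ P e, dagger.val P e = (star (e x)).val P e) ∧
          dagger.IsEnumeration ∧ dagger.IsUnaryIn x ∧
          ∀ M : CoL.HPM, ¬ M.Wins (F₀.game dagger)) ∧
    ¬ CoL.MultiformlyValid F₀ := by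
  have hsurj : ∃ H : ℕ → CoL.HPM, Function.Surjective H := exists_surjective_nat _
  have main : ∀ H : ℕ → CoL.HPM, Function.Surjective H →
      ∃ star : ℕ → CoL.Interpretation,
        (∀ n, (star n).IsConstant ∧ (star n).IsEnumeration ∧
          (H n).LosesAgainst (F₀.game (star n)) (CoL.counterstrategy F₀) (CoL.diagVal x n)) ∧
        ∃ dagger : CoL.Interpretation,
          (∀ P e, dagger.val P e = (star (e x)).val P e) ∧
          dagger.IsEnumeration ∧ dagger.IsUnaryIn x ∧
          ∀ M : CoL.HPM, ¬ M.Wins (F₀.game dagger) := by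
    intro H hH
    choose star hstar using fun n =>
      CoL.exists_losing_interpretation hF₀ (H n) (CoL.diagVal x n)
    refine ⟨star, hstar, ⟨fun P e => (star (e x)).val P e, fun P e => (star (e x)).isStatic P e⟩,
      fun P e => rfl, fun P e => (hstar (e x)).2.1 P e, fun P e e' h => ?_, fun M hM => ?_⟩
    · change (star (e x)).val P e = (star (e' x)).val P e'
      rw [h]
      exact (hstar (e' x)).1 P e e'
    · obtain ⟨n, rfl⟩ := hH M
      have hlose := (hstar n).2.2
      have hwin := hM (CoL.diagVal x n) _
        (CoL.isBranch_branchVs (H n) (CoL.diagVal x n) (CoL.counterstrategy F₀))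
      -- At the valuation assigning `n` to `x` the dagger interpretation coincides with the `n`-th
      -- one, under which machine `n` has lost.
      rw [CoL.Formula.game_congr (J := star n) F₀ fun P => by simp [CoL.diagVal]] at hwin
      rw [CoL.HPM.LosesAgainst, hwin] at hlose
      cases hlose
  refine ⟨hsurj, main, fun hvalid => ?_⟩
  obtain ⟨H, hH⟩ := hsurj
  obtain ⟨-, -, dagger, -, -, -, hno⟩ := main H hH
  obtain ⟨M, hM⟩ := hvalid dagger
  exact hno M hM
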